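/- Let $m\ge 2$ be an even integer. For $\tau=u+iv$ in the upper half-plane $\mathbb H$ and $z\in\mathbb C$ put $q=e^{2\pi i\tau}$, $\zeta=e^{2\pi i z}$, $$\vartheta(z;\tau)=\sum_{\nu\in\frac12+\mathbb Z}e^{\pi i\nu^2\tau+2\pi i\nu(z+\frac12)},\qquad \varphi(z;\tau)=\left(\frac{\vartheta(z+\frac12;\tau)}{\vartheta(z;\tau)}\right)^m ,$$ and let $D_n(\tau)$ be the coefficient of $(2\pi i z)^{-n}$ in the Laurent expansion of $\varphi(z;\tau)$ at $z=0$. With the Bernoulli numbers $B_r$ and $E_{2j}(\tau)=1-\frac{4j}{B_{2j}}\sum_{\ell\ge1}\sigma_{2j-1}(\ell)q^\ell$ define $$\widehat\varphi^F(\tau)=D_0(\tau)+\sum_{j=1}^{m/2}\frac{B_{2j}}{(2j)!}D_{2j}(\tau)E_{2j}(\tau)-\frac{D_2(\tau)}{4\pi v},$$ $$\widehat\varphi^P(z;\tau)=\sum_{j=1}^{m/2}\frac{D_{2j}(\tau)}{(2j-1)!}\sum_{r\ne0}\frac{r^{2j-1}}{1-q^r}\zeta^r+\frac{D_2(\tau)}{4\pi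 v}\qquad(0<\operatorname{Im}z<\operatorname{Im}\tau).$$ For $\gamma=\begin{pmatrix}a&b\\c&d\end{pmatrix}\in\Gamma_0(2)$ let $\psi(\gamma)=(-1)^{mc/4}$. **Theorem.** The series above converge absolutely for $0<\operatorname{Im}z<\operatorname{Im}\tau$, and there $$\varphi(z;\tau)=\widehat\varphi^F(\tau)+\widehat\varphi^P(z;\tau).$$ The function $\widehat\varphi^P$ extends to all $\tau\in\mathbb H$, $z\in\mathbb C\setminus(\mathbb Z\tau+\mathbb Z)$ so that this identity persists, and: 1. $\widehat\varphi^F$ is an almost holomorphic modular form of weight $0$ on $\Gamma_0(2)$ with Nebentypus character $\psi$. That is, $\widehat\varphi^F(\gamma\tau)=\psi(\gamma)\widehat\varphi^F(\tau)$ for $\gamma\in\Gamma_0(2)$, and for every $\gamma\in\mathrm{SL}_2(\mathbb Z)$ the function $\widehat\varphi^F(\gamma\tau)$ is a polynomial in $1/v$ whose coefficients are holomorphic on $\mathbb H$ and become bounded as $v\to\infty$ after multiplication by some power of $q$ (so poles at the cusps are allowed). 2. $\widehat\varphi^P$ is a (non-holomorphic) Jacobi form of weight $0$ and index $0$ on $\Gamma_0(2)$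 with Nebentypus character $\psi$. That is, for $z\notin\mathbb Z\tau+\mathbb Z$, $$\widehat\varphi^P\!\left(\tfrac{z}{c\tau+d};\gamma\tau\right)=\psi(\gamma)\,\widehat\varphi^P(z;\tau)\quad(\gamma\in\Gamma_0(2)),\qquad \widehat\varphi^P(z+\lambda\tau+\mu;\tau)=\widehat\varphi^P(z;\tau)\quad(\lambda,\mu\in\mathbb Z),$$ and for every $\gamma=\begin{pmatrix}a&b\\c&d\end{pmatrix}\in\mathrm{SL}_2(\mathbb Z)$ the function $\widehat\varphi^P(\frac{z}{c\tau+d};\gamma\tau)$ is a polynomial in $1/v$ whose coefficients are meromorphic in $(z,\tau)\in\mathbb C\times\mathbb H$ with poles only at $z\in\mathbb Z\tau+\mathbb Z$ and have, for $0<\operatorname{Im}z<\operatorname{Im}\tau$, absolutely convergent Fourier developments $\sum_{n,r\in\mathbb Z}c(n,r)q^{n/h}\zeta^r$ with some integer $h\ge1$ and with $n$ bounded below. -/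

import Mathlib

open UpperHalfPlane hiding I
open ModularForm Complex Filter Topology
open scoped MatrixGroups Manifold Real

noncomputable section

namespace KacWakimoto

/-! ### The functions -/

/-- The nome `q ^ x = exp (2 π i x τ)` for a real exponent `x`. -/
def qpow (x : ℝ) (τ : ℍ) : ℂ := cexp (2 * π * I * x * (τ : ℂ))

/-- `ζ ^ r = exp (2 π i r z)` for an integer `r`. -/
def zetapow (r : ℤ) (z : ℂ) : ℂ := cexp (2 * π * I * r * z)

/-- Jacobi's theta function: the sum over `ν = n + 1/2`, `n ∈ ℤ`, of
`exp (π i ν² τ + 2 π i ν (z + 1/2))`. -/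
def theta (z : ℂ) (τ : ℍ) : ℂ :=
  ∑' n : ℤ, cexp (π * I * ((n : ℂ) + 1 / 2) ^ 2 * (τ : ℂ)
    + 2 * π * I * ((n : ℂ) + 1 / 2) * (z + 1 / 2))

/-- `φ(z; τ) = (ϑ(z + 1/2; τ) / ϑ(z; τ)) ^ m`; its poles are the points of `ℤ τ + ℤ`
(where the Lean expression has a meaningless value). -/
def phi (m : ℕ) (z : ℂ) (τ : ℍ) : ℂ := (theta (z + 1 / 2) τ / theta z τ) ^ m

/-- The coefficient of `z ^ k` in the Laurent expansion at `0` of a function that is holomorphic in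
a punctured neighbourhood of `0`: the value of `(2 π i)⁻¹ ∮ f(z) z ^ (-k - 1) dz` over
all small circles around `0`. -/
def laurentCoeff (f : ℂ → ℂ) (k : ℤ) : ℂ :=
  limUnder (𝓝[>] (0 : ℝ)) fun r : ℝ => (2 * π * I)⁻¹ * ∮ z in C(0, r), z ^ (-k - 1) * f z

/-- `D_n(τ)`: the coefficient of `(2 π i z) ^ (-n)` in the Laurent expansion of `φ(z; τ)` at
`z = 0`. -/
def D (m n : ℕ) (τ : ℍ) : ℂ :=
  (2 * π * I) ^ n * laurentCoeff (fun z => phi m z τ) (-(n : ℤ))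

/-- The Eisenstein series `E_{2j}(τ) = 1 - (4j / B_{2j}) ∑_{ℓ ≥ 1} σ_{2j-1}(ℓ) q ^ ℓ`, `j ≥ 1`. -/
def eisen (j : ℕ) (τ : ℍ) : ℂ :=
  1 - (4 * (j : ℂ) / ((bernoulli (2 * j) : ℚ) : ℂ)) *
    ∑' l : ℕ+, (ArithmeticFunction.sigma (2 * j - 1) (l : ℕ) : ℂ) * qpow ((l : ℕ) : ℝ) τ

/-- The finite part `φ^F(τ)`. -/
def phiF (m : ℕ) (τ : ℍ) : ℂ :=
  D m 0 τ + ∑ j ∈ Finset.Icc 1 (m / 2),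
    ((bernoulli (2 * j) : ℚ) : ℂ) / ((2 * j).factorial : ℂ) * D m (2 * j) τ * eisen j τ

/-- The general term of the series `∑_{r ≠ 0} r ^ (2j-1) / (1 - q ^ r) ζ ^ r`. -/
def polarTerm (j : ℕ) (z : ℂ) (τ : ℍ) (r : {r : ℤ // r ≠ 0}) : ℂ :=
  ((r : ℤ) : ℂ) ^ (2 * j - 1) / (1 - qpow ((r : ℤ) : ℝ) τ) * zetapow (r : ℤ) z

/-- The polar part `φ^P(z; τ)`, given by its series for `0 < Im z < Im τ`. -/
def phiP (m : ℕ) (z : ℂ) (τ : ℍ) : ℂ :=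
  ∑ j ∈ Finset.Icc 1 (m / 2),
    D m (2 * j) τ / ((2 * j - 1).factorial : ℂ) * ∑' r, polarTerm j z τ r

/-- The completed finite part `φ^F(τ) - D_2(τ) / (4 π v)`, where `v = Im τ`. -/
def phiFHat (m : ℕ) (τ : ℍ) : ℂ := phiF m τ - D m 2 τ / (4 * π * (τ.im : ℂ))

/-- The completed polar part `φ^P(z; τ) + D_2(τ) / (4 π v)`, for `0 < Im z < Im τ`. -/
def phiPHat (m : ℕ) (z : ℂ) (τ : ℍ) : ℂ := phiP m z τ + D m 2 τ / (4 * π * (τ.im : ℂ))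

/-- The character `ψ(γ) = (-1) ^ (m c / 4)` of `Γ₀(2)`, for even `m`: then `4 ∣ m c` and the integer
division is exact. -/
def psi (m : ℕ) (γ : SL(2, ℤ)) : ℂ := (-1) ^ ((m : ℤ) * γ 1 0 / 4)

/-! ### Almost holomorphic modular forms -/

/-- `g` is holomorphic on `ℍ` with at most a pole at `i∞`, that is, `q ^ N g` is bounded there for
some `N`. (For `g` invariant under some `τ ↦ τ + h` this says that `g` has an expansion in
powers of `q ^ (1/h)` with only finitely many negative exponents.) -/
def IsWeaklyHolomorphicAtInfty (g : ℍ → ℂ) : Prop :=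
  MDifferentiable 𝓘(ℂ) 𝓘(ℂ) g ∧
    ∃ N : ℕ, IsBoundedAtImInfty fun τ => qpow (N : ℝ) τ * g τ

/-- Almost holomorphic modular forms of weight `κ` on `Γ` with Nebentypus character `χ`: functions
that transform like modular forms and are polynomials in `1 / v` whose coefficients are holomorphic
on `ℍ`, with poles allowed at the cusps. The cusp `γ (i∞)` is examined through `f ∣[κ] γ`; taking
`γ = 1` gives the expansion of `f` itself. -/
structure IsAlmostHolomorphicModularForm (κ : ℤ) (Γ : Subgroup SL(2, ℤ)) (χ : SL(2, ℤ) → ℂ)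
    (f : ℍ → ℂ) : Prop where
  slash_eq : ∀ γ ∈ Γ, ∀ τ : ℍ, (f ∣[κ] γ) τ = χ γ * f τ
  expansion : ∀ γ : SL(2, ℤ), ∃ (p : ℕ) (g : ℕ → ℍ → ℂ),
    (∀ k ≤ p, IsWeaklyHolomorphicAtInfty (g k)) ∧
    ∀ τ : ℍ, (f ∣[κ] γ) τ = ∑ k ∈ Finset.range (p + 1), g k τ * ((τ.im : ℂ)⁻¹) ^ k

/-! ### Non-holomorphic Jacobi forms -/

/-- The lattice `ℤ τ + ℤ`. -/
def lattice (τ : ℍ) : Set ℂ := {z | ∃ l n : ℤ, z = l * (τ : ℂ) + n}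

/-- The action of weight `κ` and index `M` of `SL₂(ℤ)` on functions of `(z; τ)`. -/
def jacobiSlash (κ M : ℤ) (f : ℂ → ℍ → ℂ) (γ : SL(2, ℤ)) (z : ℂ) (τ : ℍ) : ℂ :=
  (((γ 1 0 : ℤ) : ℂ) * τ + ((γ 1 1 : ℤ) : ℂ)) ^ (-κ) *
    cexp (-(2 * π * I * M * ((γ 1 0 : ℤ) : ℂ) * z ^ 2 /
      (((γ 1 0 : ℤ) : ℂ) * τ + ((γ 1 1 : ℤ) : ℂ)))) *
    f (z / (((γ 1 0 : ℤ) : ℂ) * τ + ((γ 1 1 : ℤ) : ℂ))) (γ • τ)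

/-- `g(z; τ)` is meromorphic on `ℂ × ℍ` with poles only at `z ∈ ℤ τ + ℤ`: it is jointly holomorphic
off these points, and near each of them it is `(z - l τ - n) ^ (-N)` times a function that is
jointly holomorphic there. -/
def IsMeromorphicOffLattice (g : ℂ → ℍ → ℂ) : Prop :=
  DifferentiableOn ℂ (fun x : ℂ × ℂ => g x.1 (ofComplex x.2))
      {x : ℂ × ℂ | 0 < x.2.im ∧ x.1 ∉ lattice (ofComplex x.2)} ∧
  ∀ (τ : ℍ) (l n : ℤ), ∃ (N : ℕ) (H : ℂ × ℂ → ℂ),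
    ∀ᶠ x : ℂ × ℂ in 𝓝 ((l : ℂ) * (τ : ℂ) + n, (τ : ℂ)),
      DifferentiableAt ℂ H x ∧
        (x.1 ≠ l * x.2 + n → (x.1 - l * x.2 - n) ^ N * g x.1 (ofComplex x.2) = H x)

/-- `g(z; τ)` has, for `0 < Im z < Im τ`, an absolutely convergent Fourier development
`∑ c(n, r) q ^ (n / h) ζ ^ r` in which `n` is bounded below. -/
def HasFourierDevelopment (g : ℂ → ℍ → ℂ) : Prop :=
  ∃ (h : ℕ) (n₀ : ℤ) (c : ℤ → ℤ → ℂ), 0 < h ∧ (∀ n r : ℤ, n < n₀ → c n r = 0) ∧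
    ∀ (τ : ℍ) (z : ℂ), 0 < z.im → z.im < τ.im →
      HasSum (fun x : ℤ × ℤ => c x.1 x.2 * qpow ((x.1 : ℝ) / (h : ℝ)) τ * zetapow x.2 z) (g z τ)

/-- Non-holomorphic Jacobi forms of weight `κ` and index `M` on `Γ` with Nebentypus character `χ`:
functions with the modular and the elliptic transformation law of a Jacobi form that are polynomials
in `1 / v` whose coefficients are meromorphic in `(z; τ)` with poles at lattice points
`z ∈ ℤ τ + ℤ` only, and have Fourier developments with poles allowed at the cusps. The cusp
`γ (i∞)` is examined through the function slashed by `γ`; taking `γ = 1` gives the function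
itself. Values at the lattice points are disregarded. -/
structure IsNonholomorphicJacobiForm (κ M : ℤ) (Γ : Subgroup SL(2, ℤ)) (χ : SL(2, ℤ) → ℂ)
    (f : ℂ → ℍ → ℂ) : Prop where
  modular : ∀ γ ∈ Γ, ∀ (τ : ℍ) (z : ℂ), z ∉ lattice τ →
    jacobiSlash κ M f γ z τ = χ γ * f z τ
  elliptic : ∀ (l n : ℤ) (τ : ℍ) (z : ℂ), z ∉ lattice τ →
    f (z + l * (τ : ℂ) + n) τ =
      cexp (-(2 * π * I * M * ((l : ℂ) ^ 2 * (τ : ℂ) + 2 * l * z))) * f z τ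
  expansion : ∀ γ : SL(2, ℤ), ∃ (p : ℕ) (g : ℕ → ℂ → ℍ → ℂ),
    (∀ k ≤ p, IsMeromorphicOffLattice (g k) ∧ HasFourierDevelopment (g k)) ∧
    ∀ (τ : ℍ) (z : ℂ), z ∉ lattice τ →
      jacobiSlash κ M f γ z τ = ∑ k ∈ Finset.range (p + 1), g k z τ * ((τ.im : ℂ)⁻¹) ^ k

end KacWakimoto

end

noncomputable section

namespace KacWakimoto

/-! ### Jacobi's theta function on `ℂ × ℂ` -/

/-! Write `m = 2p`. The function `φ` is the `m`-th power of the member `(a, b) = (0, 1)` of the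
family `thetaQuot a b` of quotients of theta functions with half-integral characteristics. `SL₂(ℤ)`
permutes this family by `(a, b) ↦ (a, b)γ` without multiplier (`thetaQuot_smul`), and changing `(a,
b)` by even integers costs only a sign on `m`-th powers (`thetaQuot_shift_pow`). For `γ ∈ Γ₀(2)` the
bottom row is `(0, 1)` modulo 2, and the sign is `ψ(γ)`.

As a function of `z` each such power is even and doubly periodic, with poles of order at most `m`,
at lattice points only (`thetaC_ne_zero`). On the strip `|Im z| < Im τ`, `polarFun j` has the same
periods, principal part `(2j-1)!/(2πiz)^(2j)` at `0` and constant term `-B_{2j}/(2j) E_{2j}`.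
Subtracting the right multiples removes all poles; a Liouville argument
(`eq_of_tendsto_of_periodic`) leaves a constant, and the limit at `z = 0` identifies it as the
finite part (`thetaQuot_pow_eq`). The zeros of theta are located by the same Liouville argument,
applied to theta divided by its infinite product.

The Laurent coefficient `D_n` transforms with weight `-n`, since `z` is scaled by `cτ + d`, and
`E_{2j}` has weight `2j` for `j ≥ 2`. Only `D_2 E_2` fails to be invariant, and the anomaly of `E_2`
is cancelled by the `1/v` term (`phiFHat_smul`). The completed polar part is `φ` minus the completed
finite part, so it inherits its transformation laws.

The analytic conditions come from Cauchy integrals over circles of fixed radius: they give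
holomorphy of the coefficients in `τ`, growth bounds at the cusp and joint meromorphy in `(z, τ)`.
Period `8` in `τ` gives expansions in `q^(1/8)`, and the geometric series for `1/(1 - q^r)` gives
the Fourier development of the polar part. -/

/-- `theta` as a function of two complex variables. -/
def thetaC (z t : ℂ) : ℂ :=
  cexp (π * I * t / 4 + π * I * (z + 1 / 2)) * jacobiTheta₂ (z + 1 / 2 + t / 2) t

lemma theta_eq_thetaC (z : ℂ) (τ : ℍ) : theta z τ = thetaC z τ := by
  rw [theta, thetaC, jacobiTheta₂, ← tsum_mul_left]
  refine tsum_congr fun n => ?_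
  rw [jacobiTheta₂_term, ← Complex.exp_add]
  ring_nf

lemma exp_int_mul_pi (n : ℤ) : cexp (π * I * n) = (-1) ^ n := by
  rw [mul_comm, exp_int_mul, exp_pi_mul_I]

lemma neg_exp_eq (x : ℂ) : -cexp x = cexp (x + π * I) := by
  rw [Complex.exp_add, exp_pi_mul_I, mul_neg_one]

lemma thetaC_add_one (z t : ℂ) : thetaC (z + 1) t = -thetaC z t := by
  rw [thetaC, thetaC, show z + 1 + 1 / 2 + t / 2 = z + 1 / 2 + t / 2 + 1 by ring,
    jacobiTheta₂_add_left, show (π : ℂ) * I * t / 4 + π * I * (z + 1 + 1 / 2)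
      = (π * I * t / 4 + π * I * (z + 1 / 2)) + π * I by ring, Complex.exp_add, exp_pi_mul_I]
  ring

lemma thetaC_add_self (z t : ℂ) :
    thetaC (z + t) t = -(cexp (-π * I * t - 2 * π * I * z) * thetaC z t) := by
  rw [thetaC, thetaC, show z + t + 1 / 2 + t / 2 = z + 1 / 2 + t / 2 + t by ring,
    jacobiTheta₂_add_left', ← mul_assoc, ← mul_assoc, ← Complex.exp_add, ← Complex.exp_add,
    ← neg_mul, neg_exp_eq]
  congr 1
  rw [Complex.exp_eq_exp_iff_exists_int]
  exact ⟨-1, by push_cast; ring⟩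

lemma thetaC_neg (z t : ℂ) : thetaC (-z) t = -thetaC z t := by
  have h1 : -z + 1 / 2 + t / 2 = -(z - 1 / 2 - t / 2) := by ring
  have h2 : z + 1 / 2 + t / 2 = z - 1 / 2 - t / 2 + 1 + t := by ring
  rw [thetaC, thetaC, h1, jacobiTheta₂_neg_left, h2, jacobiTheta₂_add_left',
    jacobiTheta₂_add_left, ← mul_assoc, ← Complex.exp_add,
    ← neg_mul, neg_exp_eq]
  congr 1
  rw [Complex.exp_eq_exp_iff_exists_int]
  exact ⟨0, by push_cast; ring⟩

lemma thetaC_zero (t : ℂ) : thetaC 0 t = 0 := by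
  have := thetaC_neg 0 t
  rw [neg_zero] at this
  exact self_eq_neg.mp this

/-- Since `n² ≡ n` modulo 2, the new factor `exp(πi n²)` is `exp(πi n)`, a half-period shift. -/
lemma jacobiTheta₂_add_one_right (z t : ℂ) :
    jacobiTheta₂ z (t + 1) = jacobiTheta₂ (z + 1 / 2) t := by
  refine tsum_congr fun n => ?_
  rw [jacobiTheta₂_term, jacobiTheta₂_term, Complex.exp_eq_exp_iff_exists_int]
  obtain ⟨k, hk⟩ := Int.even_mul_pred_self n
  refine ⟨k, ?_⟩
  have : (n : ℂ) * (n - 1) = k + k := by exact_mod_cast hk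
  linear_combination π * I * this

lemma thetaC_add_one_right (z t : ℂ) : thetaC z (t + 1) = cexp (π * I / 4) * thetaC z t := by
  rw [thetaC, thetaC, jacobiTheta₂_add_one_right,
    show z + 1 / 2 + (t + 1) / 2 + 1 / 2 = z + 1 / 2 + t / 2 + 1 by ring, jacobiTheta₂_add_left,
    ← mul_assoc, ← Complex.exp_add]
  ring_nf

/-- Jacobi's inversion formula at `z + t/2 - 1/2`. The factor `(-It)^(1/2)` does not depend on `z`,
so it cancels in theta quotients and its branch never matters. -/
lemma thetaC_div (z : ℂ) {t : ℂ} (ht : t ≠ 0) :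
    thetaC (z / t) (-1 / t) =
      -I * (-I * t) ^ (1 / 2 : ℂ) * cexp (π * I * z ^ 2 / t) * thetaC z t := by
  have h0 : (-I * t) ^ (1 / 2 : ℂ) ≠ 0 := by
    rw [Ne, Complex.cpow_eq_zero_iff]
    simp [ht]
  have h1 : z / t + 1 / 2 + -1 / t / 2 = (z + t / 2 - 1 / 2) / t := by field_simp; ring
  have h2 := jacobiTheta₂_functional_equation (z + t / 2 - 1 / 2) t
  have h3 : z + 1 / 2 + t / 2 = z + t / 2 - 1 / 2 + 1 := by ring
  rw [thetaC, thetaC, h1, h3, jacobiTheta₂_add_left, h2]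
  have h4 : -I = cexp (-(π / 2) * I) := by
    rw [neg_mul, Complex.exp_neg, Complex.exp_pi_div_two_mul_I, Complex.inv_I]
  have h5 : ∀ A B C D R J : ℂ, R ≠ 0 → A = -I * (B * C * D) →
      A * J = -I * R * B * (C * (1 / R * D * J)) := by
    rintro A B C D R J hR rfl
    field_simp
  refine h5 _ _ _ _ _ _ h0 ?_
  rw [← Complex.exp_add, ← Complex.exp_add, h4, ← Complex.exp_add,
    Complex.exp_eq_exp_iff_exists_int]
  refine ⟨0, ?_⟩
  field_simp
  push_cast
  ring

lemma thetaC_add_int (z t : ℂ) (l : ℤ) : thetaC (z + l) t = (-1) ^ l * thetaC z t := by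
  induction l using Int.induction_on with
  | zero => simp
  | succ n ih =>
    rw [show z + ((n + 1 : ℤ) : ℂ) = z + ((n : ℤ) : ℂ) + 1 by push_cast; ring, thetaC_add_one, ih,
      zpow_add_one₀ (by norm_num)]
    ring
  | pred n ih =>
    have := thetaC_add_one (z + ((-n - 1 : ℤ) : ℂ)) t
    rw [show z + ((-n - 1 : ℤ) : ℂ) + 1 = z + ((-n : ℤ) : ℂ) by push_cast; ring, ih] at this
    rw [← neg_eq_iff_eq_neg.mpr this, zpow_sub_one₀ (by norm_num)]
    norm_num

lemma thetaC_add_int_mul (z t : ℂ) (k : ℤ) :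
    thetaC (z + k * t) t =
      (-1) ^ k * cexp (-π * I * k ^ 2 * t - 2 * π * I * k * z) * thetaC z t := by
  induction k using Int.induction_on with
  | zero => simp
  | succ n ih =>
    rw [show z + ((n + 1 : ℤ) : ℂ) * t = z + ((n : ℤ) : ℂ) * t + t by push_cast; ring,
      thetaC_add_self, ih, zpow_add_one₀ (by norm_num),
      show -π * I * ((n + 1 : ℤ) : ℂ) ^ 2 * t - 2 * π * I * ((n + 1 : ℤ) : ℂ) * z =
        (-π * I * t - 2 * π * I * (z + ((n : ℤ) : ℂ) * t)) +
        (-π * I * ((n : ℤ) : ℂ) ^ 2 * t - 2 * π * I * ((n : ℤ) : ℂ) * z) by push_cast; ring,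
      Complex.exp_add]
    ring
  | pred n ih =>
    have h := thetaC_add_self (z + ((-n - 1 : ℤ) : ℂ) * t) t
    rw [show z + ((-n - 1 : ℤ) : ℂ) * t + t = z + ((-n : ℤ) : ℂ) * t by push_cast; ring, ih] at h
    have h' := Complex.exp_ne_zero (-π * I * t - 2 * π * I * (z + ((-n - 1 : ℤ) : ℂ) * t))
    rw [← mul_right_inj' h', ← neg_eq_iff_eq_neg.mpr h, zpow_sub_one₀ (by norm_num),
      show -π * I * ((-n : ℤ) : ℂ) ^ 2 * t - 2 * π * I * ((-n : ℤ) : ℂ) * z =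
        (-π * I * t - 2 * π * I * (z + ((-n - 1 : ℤ) : ℂ) * t)) +
        (-π * I * ((-n - 1 : ℤ) : ℂ) ^ 2 * t - 2 * π * I * ((-n - 1 : ℤ) : ℂ) * z) by
          push_cast; ring,
      Complex.exp_add, show ((-1 : ℂ))⁻¹ = -1 by norm_num]
    ring

lemma thetaC_add_lattice (z t : ℂ) (k l : ℤ) :
    thetaC (z + k * t + l) t =
      (-1) ^ (k + l) * cexp (-π * I * k ^ 2 * t - 2 * π * I * k * z) * thetaC z t := by
  rw [thetaC_add_int, thetaC_add_int_mul, zpow_add₀ (by norm_num)]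
  ring

/-! ### Quotients of theta functions with characteristics -/

/-- The theta function shifted by the half period `(a t + b) / 2`, with the exponential factor that
makes its quotient by `thetaC` equivariant under `SL₂(ℤ)`. -/
def thetaNum (a b : ℤ) (z t : ℂ) : ℂ :=
  cexp (π * I * (a / 2) * (a * t / 2 + b / 2) + π * I * a * z) * thetaC (z + (a * t + b) / 2) t

/-- The quotient of the shifted theta function by the theta function. -/
def thetaQuot (a b : ℤ) (z t : ℂ) : ℂ := thetaNum a b z t / thetaC z t

lemma phi_eq_thetaQuot (m : ℕ) (z : ℂ) (τ : ℍ) : phi m z τ = thetaQuot 0 1 z τ ^ m := by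
  simp [phi, thetaQuot, thetaNum, theta_eq_thetaC]

/-- The argument moves by the lattice vector `kt + l`. Quasi-periodicity and the prefactor leave a
constant phase: a sign and the exponential of the symplectic pairing `al - kb`. -/
lemma thetaNum_shift (a b k l : ℤ) (z t : ℂ) :
    thetaNum (a + 2 * k) (b + 2 * l) z t =
      (-1) ^ (k + l + k * l) * cexp (π * I * ((a * l - k * b : ℤ) / 2)) * thetaNum a b z t := by
  rw [thetaNum, thetaNum,
    show z + (((a + 2 * k : ℤ) : ℂ) * t + ((b + 2 * l : ℤ) : ℂ)) / 2 = z + (a * t + b) / 2 + k * t + l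
      by push_cast; ring, thetaC_add_lattice, zpow_add₀ (by norm_num : (-1 : ℂ) ≠ 0) (k + l),
    ← exp_int_mul_pi (k * l)]
  have h : ∀ A B C D E S T : ℂ, A * C = B * D * E →
      A * (S * C * T) = S * B * D * (E * T) := by
    intro A B C D E S T h
    linear_combination S * T * h
  apply h
  rw [← Complex.exp_add, ← Complex.exp_add, ← Complex.exp_add, Complex.exp_eq_exp_iff_exists_int]
  exact ⟨0, by push_cast; ring⟩

lemma thetaQuot_shift (a b k l : ℤ) (z t : ℂ) :
    thetaQuot (a + 2 * k) (b + 2 * l) z t =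
      (-1) ^ (k + l + k * l) * cexp (π * I * ((a * l - k * b : ℤ) / 2)) * thetaQuot a b z t := by
  rw [thetaQuot, thetaNum_shift, thetaQuot, mul_div_assoc]

lemma neg_one_zpow_pow_two_mul (n : ℤ) (p : ℕ) : ((-1 : ℂ) ^ n) ^ (2 * p) = 1 := by
  rw [pow_mul, ← zpow_natCast (_ ^ n) 2, ← zpow_mul, mul_comm n, zpow_mul]
  norm_num

/-- The even exponent kills the sign and turns the fourth root of unity into a sign. With `(a, b) =
(0, 1)` this is the origin of the character `psi`. -/
lemma thetaQuot_shift_pow (a b k l : ℤ) (z t : ℂ) (p : ℕ) :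
    thetaQuot (a + 2 * k) (b + 2 * l) z t ^ (2 * p) =
      (-1) ^ ((a * l - k * b) * p) * thetaQuot a b z t ^ (2 * p) := by
  rw [thetaQuot_shift, mul_pow, mul_pow, neg_one_zpow_pow_two_mul, one_mul,
    ← exp_int_mul_pi, ← Complex.exp_nat_mul]
  congr 2
  push_cast
  ring

lemma thetaQuot_neg (a b : ℤ) (z t : ℂ) : thetaQuot a b (-z) t = thetaQuot (-a) (-b) z t := by
  rw [thetaQuot, thetaQuot, thetaNum, thetaNum, thetaC_neg,
    show -z + (a * t + b) / 2 = -(z + (((-a : ℤ) : ℂ) * t + ((-b : ℤ) : ℂ)) / 2) by push_cast; ring,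
    thetaC_neg, mul_neg, neg_div_neg_eq]
  congr 3
  push_cast
  ring

/-- Negating `z` negates the characteristic, and `(-a, -b) = (a, b) + 2(-a, -b)` is an even shift on
which the symplectic pairing vanishes. -/
lemma thetaQuot_neg_pow (a b : ℤ) (z t : ℂ) (p : ℕ) :
    thetaQuot a b (-z) t ^ (2 * p) = thetaQuot a b z t ^ (2 * p) := by
  have := thetaQuot_shift_pow a b (-a) (-b) z t p
  rw [thetaQuot_neg, show -a = a + 2 * -a by ring, show -b = b + 2 * -b by ring, this,
    show a * -b - -a * b = 0 by ring]
  simp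

lemma thetaQuot_add_one (a b : ℤ) (z t : ℂ) :
    thetaQuot a b (z + 1) t = (-1) ^ a * thetaQuot a b z t := by
  rw [thetaQuot, thetaQuot, thetaNum, thetaNum, thetaC_add_one,
    show z + 1 + (a * t + b) / 2 = z + (a * t + b) / 2 + 1 by ring, thetaC_add_one, mul_neg,
    neg_div_neg_eq, ← exp_int_mul_pi, mul_div_assoc (cexp _), mul_div_assoc (cexp _),
    ← mul_assoc (cexp _) (cexp _), ← Complex.exp_add]
  congr 2
  ring

lemma thetaQuot_add_self (a b : ℤ) (z t : ℂ) :
    thetaQuot a b (z + t) t = (-1) ^ b * thetaQuot a b z t := by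
  have h : cexp (-π * I * t - 2 * π * I * z) ≠ 0 := Complex.exp_ne_zero _
  have hb : ((-1 : ℂ)) ^ b = (-1) ^ (-b) := by
    rw [zpow_neg, ← inv_zpow]; norm_num
  rw [thetaQuot, thetaQuot, thetaNum, thetaNum, thetaC_add_self,
    show z + t + (a * t + b) / 2 = z + (a * t + b) / 2 + t by ring, thetaC_add_self, mul_neg,
    neg_div_neg_eq]
  have key : ∀ A X E B D T S : ℂ, E ≠ 0 → A * X = D * (E * B) →
      A * (X * T) / (E * S) = D * (B * T / S) := by
    intro A X E B D T S hE h
    rw [show A * (X * T) = E * (D * (B * T)) by linear_combination T * h,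
      mul_div_mul_left _ _ hE, mul_div_assoc]
  apply key _ _ _ _ _ _ _ h
  rw [hb, ← exp_int_mul_pi, ← Complex.exp_add, ← Complex.exp_add, ← Complex.exp_add]
  congr 1
  push_cast
  ring

lemma thetaQuot_pow_add_one (a b : ℤ) (z t : ℂ) (p : ℕ) :
    thetaQuot a b (z + 1) t ^ (2 * p) = thetaQuot a b z t ^ (2 * p) := by
  rw [thetaQuot_add_one, mul_pow, neg_one_zpow_pow_two_mul, one_mul]

lemma thetaQuot_pow_add_self (a b : ℤ) (z t : ℂ) (p : ℕ) :
    thetaQuot a b (z + t) t ^ (2 * p) = thetaQuot a b z t ^ (2 * p) := by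
  rw [thetaQuot_add_self, mul_pow, neg_one_zpow_pow_two_mul, one_mul]

lemma apply_add_lattice {f : ℂ → ℂ} {t : ℂ} (h1 : ∀ z, f (z + 1) = f z) (h2 : ∀ z, f (z + t) = f z)
    (k l : ℤ) (z : ℂ) : f (z + k * t + l) = f z := by
  have p1 : Function.Periodic f (l * 1) := Function.Periodic.int_mul (c := (1 : ℂ)) h1 l
  have p2 : Function.Periodic f (k * t) := Function.Periodic.int_mul (c := t) h2 k
  rw [← mul_one (l : ℂ), p1, p2]

lemma thetaQuot_pow_add_lattice (a b : ℤ) (z t : ℂ) (k l : ℤ) (p : ℕ) :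
    thetaQuot a b (z + k * t + l) t ^ (2 * p) = thetaQuot a b z t ^ (2 * p) :=
  apply_add_lattice (f := fun z => thetaQuot a b z t ^ (2 * p))
    (fun z => thetaQuot_pow_add_one a b z t p) (fun z => thetaQuot_pow_add_self a b z t p) k l z

lemma thetaQuot_add_one_right (a b : ℤ) (z t : ℂ) :
    thetaQuot a b z (t + 1) = thetaQuot a (a + b) z t := by
  rw [thetaQuot, thetaQuot, thetaNum, thetaNum, thetaC_add_one_right, thetaC_add_one_right,
    mul_left_comm, mul_div_mul_left _ _ (Complex.exp_ne_zero _)]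
  push_cast
  congr 3 <;> ring

lemma thetaQuot_div (a b : ℤ) (z : ℂ) {t : ℂ} (ht : t ≠ 0) :
    thetaQuot a b (z / t) (-1 / t) = thetaQuot b (-a) z t := by
  have h0 : (-I * t) ^ (1 / 2 : ℂ) ≠ 0 := by
    rw [Ne, Complex.cpow_eq_zero_iff]
    simp [ht]
  rw [thetaQuot, thetaQuot, thetaNum, thetaNum, thetaC_div z ht,
    show z / t + (a * (-1 / t) + b) / 2 = (z + (b * t + ((-a : ℤ) : ℂ)) / 2) / t by
      field_simp; push_cast; ring,
    thetaC_div _ ht]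
  have h : ∀ A B C D R S T : ℂ, R ≠ 0 → C ≠ 0 → A * B = C * D →
      A * (-I * R * B * S) / (-I * R * C * T) = D * S / T := by
    intro A B C D R S T hR hC h
    have : -I * R * C ≠ 0 := by simp [hR, hC]
    rw [show A * (-I * R * B * S) = -I * R * C * (D * S) by linear_combination (-I * R * S) * h,
      mul_div_mul_left _ _ this]
  apply h _ _ _ _ _ _ _ h0 (Complex.exp_ne_zero _)
  rw [← Complex.exp_add, ← Complex.exp_add]
  congr 1
  field_simp
  push_cast
  ring

/-- Eight translations send `b` to `b + 8a`, the even shift by `l = 4a`, whose phase is `exp(2πi a²)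
= 1`. Hence the expansions in powers of `q^(1/8)` at every cusp. -/
lemma thetaQuot_add_eight (a b : ℤ) (z t : ℂ) : thetaQuot a b z (t + 8) = thetaQuot a b z t := by
  rw [show t + 8 = t + 1 + 1 + 1 + 1 + 1 + 1 + 1 + 1 by ring]
  simp only [thetaQuot_add_one_right]
  have := thetaQuot_shift a b 0 (4 * a) z t
  rw [show a + (a + (a + (a + (a + (a + (a + (a + b))))))) = b + 2 * (4 * a) by ring]
  rw [show a + 2 * 0 = a by ring] at this
  rw [this, show π * I * (((a * (4 * a) - 0 * b : ℤ) : ℂ) / 2) = ((a * a : ℤ) : ℂ) * (2 * π * I) by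
    push_cast; ring, exp_int_mul_two_pi_mul_I, show 0 + 4 * a + 0 * (4 * a) = 2 * (2 * a) by ring,
    zpow_mul]
  norm_num

/-! ### The action of `SL₂(ℤ)` on the characteristics. -/

lemma coe_specialLinearGroup_apply (γ : SL(2, ℤ)) (τ : ℍ) :
    ((γ • τ : ℍ) : ℂ) = (γ 0 0 * τ + γ 0 1) / (γ 1 0 * τ + γ 1 1) := by
  rw [UpperHalfPlane.specialLinearGroup_apply]
  simp

lemma cocycle_ne_zero (h : SL(2, ℤ)) (τ : ℍ) : (h 1 0 * τ + h 1 1 : ℂ) ≠ 0 := by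
  have := UpperHalfPlane.denom_ne_zero (h : GL (Fin 2) ℝ) τ
  rwa [ModularGroup.denom_apply] at this

lemma cocycle_mul (g h : SL(2, ℤ)) (τ : ℍ) :
    ((g * h) 1 0 * τ + (g * h) 1 1 : ℂ) =
      (g 1 0 * ((h • τ : ℍ) : ℂ) + g 1 1) * (h 1 0 * τ + h 1 1) := by
  have h0 := cocycle_ne_zero h τ
  rw [coe_specialLinearGroup_apply, add_mul, mul_assoc, div_mul_cancel₀ _ h0]
  simp only [Matrix.SpecialLinearGroup.coe_mul, Matrix.mul_apply, Fin.sum_univ_two]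
  push_cast
  ring

/-- The theta quotients are permuted by `SL₂(ℤ)`, without any multiplier. -/
theorem thetaQuot_smul (γ : SL(2, ℤ)) (a b : ℤ) (z : ℂ) (τ : ℍ) :
    thetaQuot a b (z / (γ 1 0 * τ + γ 1 1)) (γ • τ : ℍ) =
      thetaQuot (a * γ 0 0 + b * γ 1 0) (a * γ 0 1 + b * γ 1 1) z τ := by
  have hγ : γ ∈ Subgroup.closure {ModularGroup.S, ModularGroup.T} := by
    simp [SpecialLinearGroup.SL2Z_generators]
  induction hγ using Subgroup.closure_induction generalizing a b z τ with
  | one => simp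
  | mem g hg =>
    rcases hg with rfl | rfl
    · have := thetaQuot_div a b z τ.ne_zero
      rw [coe_specialLinearGroup_apply]
      simpa [ModularGroup.S] using this
    · rw [coe_specialLinearGroup_apply]
      simpa [ModularGroup.T] using thetaQuot_add_one_right a b z τ
  | mul g h _ _ ig ih =>
    rw [cocycle_mul, mul_smul, mul_comm, ← div_div, ig, ih]
    simp only [Matrix.SpecialLinearGroup.coe_mul, Matrix.mul_apply, Fin.sum_univ_two]
    congr 1 <;> ring
  | inv g _ ig =>
    -- The statement for `g`, read at the characteristic moved by `g⁻¹` and at the point `g⁻¹ • τ`,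
    -- is the statement for `g⁻¹` read backwards.
    have h := ig (a * g⁻¹ 0 0 + b * g⁻¹ 1 0) (a * g⁻¹ 0 1 + b * g⁻¹ 1 1)
      (z / (g⁻¹ 1 0 * τ + g⁻¹ 1 1)) (g⁻¹ • τ)
    have hc := cocycle_mul g g⁻¹ τ
    rw [smul_inv_smul, div_div, mul_comm (_ + _), ← hc, mul_inv_cancel] at h
    have e (i j : Fin 2) : g⁻¹ i 0 * g 0 j + g⁻¹ i 1 * g 1 j = (1 : SL(2, ℤ)) i j := by
      rw [← inv_mul_cancel g, Matrix.SpecialLinearGroup.coe_mul, Matrix.mul_apply,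
        Fin.sum_univ_two]
    have h1 : (a * g⁻¹ 0 0 + b * g⁻¹ 1 0) * g 0 0 + (a * g⁻¹ 0 1 + b * g⁻¹ 1 1) * g 1 0 = a := by
      have e1 := e 0 0
      have e2 := e 1 0
      simp only [Matrix.SpecialLinearGroup.coe_one, Matrix.one_apply_eq, ne_eq, one_ne_zero,
        not_false_eq_true, Matrix.one_apply_ne] at e1 e2
      linear_combination a * e1 + b * e2
    have h2 : (a * g⁻¹ 0 0 + b * g⁻¹ 1 0) * g 0 1 + (a * g⁻¹ 0 1 + b * g⁻¹ 1 1) * g 1 1 = b := by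
      have e1 := e 0 1
      have e2 := e 1 1
      simp only [Matrix.SpecialLinearGroup.coe_one, Matrix.one_apply_eq, ne_eq, zero_ne_one,
        not_false_eq_true, Matrix.one_apply_ne] at e1 e2
      linear_combination a * e1 + b * e2
    rw [h1, h2] at h
    simpa using h.symm

/-! ### A Liouville theorem on a strip -/

lemma isClosed_range_intCast : IsClosed (Set.range ((↑) : ℤ → ℂ)) :=
  Int.isClosedEmbedding_coe_real.isClosed_range.preimage Complex.continuous_re |>.inter
    (isClosed_singleton.preimage Complex.continuous_im (t := {(0 : ℝ)})) |> fun h => by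
    convert h using 1
    ext z
    constructor
    · rintro ⟨n, rfl⟩
      exact ⟨⟨n, by simp⟩, by simp⟩
    · rintro ⟨⟨n, hn⟩, h0⟩
      exact ⟨n, Complex.ext (by simpa using hn) (by simpa using h0.symm)⟩

lemma eventually_not_int {z : ℂ} (hz : ∀ n : ℤ, z ≠ n) : ∀ᶠ w : ℂ in 𝓝 z, ∀ n : ℤ, w ≠ n := by
  have : z ∈ (Set.range ((↑) : ℤ → ℂ))ᶜ := by
    rintro ⟨n, hn⟩
    exact hz n hn.symm
  filter_upwards [isClosed_range_intCast.isOpen_compl.mem_nhds this] with w hw n h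
  exact hw ⟨n, h.symm⟩

lemma eventually_punctured_not_int : ∀ᶠ w : ℂ in 𝓝[≠] (0 : ℂ), ∀ n : ℤ, w ≠ n := by
  have h1 : ∀ᶠ w in 𝓝[≠] (0 : ℂ), ‖w‖ < 1 :=
    nhdsWithin_le_nhds (continuous_norm.continuousAt.eventually_lt continuousAt_const (by simp))
  filter_upwards [h1, self_mem_nhdsWithin] with w hw h0 n hn
  have h2 : ‖((n : ℤ) : ℂ)‖ < 1 := hn ▸ hw
  rw [Complex.norm_intCast] at h2
  have h3 : n = 0 := Int.abs_lt_one_iff.mp (by exact_mod_cast h2)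
  exact h0 (by simp [hn, h3])

lemma isOpen_strip (v : ℝ) : IsOpen {z : ℂ | |z.im| < v} :=
  isOpen_lt (continuous_abs.comp Complex.continuous_im) continuous_const

/-- A function on the strip `|Im z| < Im t` with periods `1` and `t`, holomorphic except for
removable singularities at the integers, is constant. -/
theorem eq_of_tendsto_of_periodic {t : ℂ} (ht : 0 < t.im) {g : ℂ → ℂ} {c : ℂ}
    (hd : ∀ z : ℂ, |z.im| < t.im → (∀ n : ℤ, z ≠ n) → DifferentiableAt ℂ g z)
    (h1 : ∀ z : ℂ, |z.im| < t.im → g (z + 1) = g z)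
    (h2 : ∀ z : ℂ, -t.im < z.im → z.im < 0 → g (z + t) = g z)
    (h0 : Tendsto g (𝓝[≠] 0) (𝓝 c)) {z : ℂ} (hz : |z.im| < t.im) (hz' : ∀ n : ℤ, z ≠ n) :
    g z = c := by
  classical
  set G : ℂ → ℂ := fun z => if ∃ n : ℤ, z = n then c else g z with hG
  have hGg : ∀ z : ℂ, (∀ n : ℤ, z ≠ n) → G z = g z := fun z h => if_neg (by push Not; exact h)
  have hGn : ∀ n : ℤ, G n = c := fun n => if_pos ⟨n, rfl⟩
  have hG1 : ∀ z : ℂ, |z.im| < t.im → G (z + 1) = G z := by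
    intro z hz
    by_cases h : ∃ n : ℤ, z = n
    · obtain ⟨n, rfl⟩ := h
      rw [hGn, show (n : ℂ) + 1 = ((n + 1 : ℤ) : ℂ) by push_cast; rfl, hGn]
    · push Not at h
      rw [hGg z h, hGg, h1 z hz]
      intro n hn
      exact h (n - 1) (by push_cast; rw [← hn]; ring)
  have hGN : ∀ (n : ℤ) (z : ℂ), |z.im| < t.im → G (z + n) = G z := by
    intro n
    induction n using Int.induction_on with
    | zero => simp
    | succ n ih =>
      intro z hz
      rw [show z + ((n + 1 : ℤ) : ℂ) = z + (n : ℤ) + 1 by push_cast; ring, hG1 _ (by simpa using hz),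
        ih z hz]
    | pred n ih =>
      intro z hz
      rw [← ih z hz, show z + ((-n : ℤ) : ℂ) = z + ((-n - 1 : ℤ) : ℂ) + 1 by push_cast; ring,
        hG1 _ (by simpa using hz)]
  -- Neither `z` nor `z + t` is real here, so the modified values at the integers play no role.
  have hG2 : ∀ z : ℂ, -t.im < z.im → z.im < 0 → G (z + t) = G z := by
    intro z ha hb
    rw [hGg, hGg, h2 z ha hb]
    · rintro n rfl
      simp at hb
    · intro n hn
      have := congrArg Complex.im hn
      simp at this
      linarith
  have hGd : ∀ z : ℂ, |z.im| < t.im → DifferentiableAt ℂ G z := by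
    intro z hz
    by_cases h : ∃ n : ℤ, z = n
    -- Riemann's removable singularity theorem at `0`; the period `1` carries the result to every
    -- integer.
    · have hd0 : DifferentiableAt ℂ G 0 := by
        refine (Complex.analyticAt_of_differentiable_on_punctured_nhds_of_continuousAt ?_
          ?_).differentiableAt
        · have hU : ∀ᶠ w : ℂ in 𝓝[≠] 0, |w.im| < t.im :=
            nhdsWithin_le_nhds ((isOpen_strip t.im).mem_nhds (by simpa using ht))
          filter_upwards [hU, eventually_punctured_not_int] with w hw hw'
          refine (hd w hw hw').congr_of_eventuallyEq ?_
          filter_upwards [eventually_not_int hw'] with y hy using hGg y hy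
        · rw [continuousAt_iff_punctured_nhds, show G 0 = c by simpa using hGn 0]
          refine h0.congr' ?_
          filter_upwards [eventually_punctured_not_int] with y hy using (hGg y hy).symm
      obtain ⟨n, rfl⟩ := h
      have : G =ᶠ[𝓝 (n : ℂ)] fun w => G (w - n) := by
        filter_upwards [(isOpen_strip t.im).mem_nhds hz] with w hw
        rw [← hGN n (w - n) (by simpa using hw), sub_add_cancel]
      refine DifferentiableAt.congr_of_eventuallyEq ?_ this
      have hd0' : DifferentiableAt ℂ G ((n : ℂ) - n) := by rwa [sub_self]
      exact DifferentiableAt.comp (f := fun w : ℂ => w - n) (n : ℂ) hd0'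
        (differentiableAt_id.sub_const _)
    · push Not at h
      refine (hd z hz h).congr_of_eventuallyEq ?_
      filter_upwards [eventually_not_int h] with y hy using hGg y hy
  set U : Set ℂ := {z : ℂ | |z.im| < t.im} with hU
  have hUc : IsPreconnected U := by
    refine Convex.isPreconnected ?_
    have : U = Complex.imCLM ⁻¹' Set.Ioo (-t.im) t.im := by
      ext z
      simp [hU, abs_lt]
    rw [this]
    exact (convex_Ioo _ _).linear_preimage Complex.imCLM.toLinearMap
  obtain ⟨z₀, hz₀, hmax⟩ :=
    ((isCompact_Icc (a := (0 : ℝ)) (b := 1)).reProdIm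
      (isCompact_Icc (a := -(t.im / 2)) (b := t.im / 2))).exists_isMaxOn
      ⟨0, by simp [Complex.mem_reProdIm]; linarith⟩
      (f := fun z => ‖G z‖) (by
        intro w hw
        rw [Complex.mem_reProdIm] at hw
        refine ((hGd w ?_).continuousAt.norm).continuousWithinAt
        rw [abs_lt]
        constructor <;> linarith [hw.2.1, hw.2.2])
  have hz₀U : z₀ ∈ U := by
    rw [Complex.mem_reProdIm] at hz₀
    simp only [hU, Set.mem_ofPred_eq, abs_lt]
    constructor <;> linarith [hz₀.2.1, hz₀.2.2]
  -- The two periods move every point of the strip into the rectangle `0 ≤ Re ≤ 1`, `|Im| ≤ Im t /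
  -- 2`. So the maximum over this compact set is attained inside the open strip, and the maximum
  -- principle applies.
  have hmaxU : IsMaxOn (norm ∘ G) U z₀ := by
    have red : ∀ w : ℂ, |w.im| ≤ t.im / 2 → ‖G w‖ ≤ ‖G z₀‖ := by
      intro w hw
      have hw' : |w.im| < t.im := by linarith
      have := hGN (-⌊w.re⌋) w hw'
      rw [← this]
      refine hmax ?_
      rw [Complex.mem_reProdIm]
      rw [abs_le] at hw
      simp only [Complex.add_re, Complex.add_im, Complex.intCast_re, Complex.intCast_im, add_zero]
      refine ⟨⟨?_, ?_⟩, hw⟩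
      · push_cast
        linarith [Int.floor_le w.re]
      · push_cast
        linarith [Int.lt_floor_add_one w.re]
    intro w hw
    simp only [hU, Set.mem_ofPred_eq, abs_lt] at hw
    simp only [Set.mem_ofPred_eq, Function.comp_apply]
    rcases le_or_gt |w.im| (t.im / 2) with h | h
    · exact red w h
    · rcases lt_abs.mp h with h | h
      · have e := hG2 (w - t) (by simp; linarith) (by simp; linarith)
        rw [sub_add_cancel] at e
        rw [e]
        apply red
        rw [abs_le]
        simp
        constructor <;> linarith
      · rw [← hG2 w (by linarith) (by linarith)]
        apply red
        rw [abs_le]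
        simp
        constructor <;> linarith
  have hconst := Complex.eqOn_of_isPreconnected_of_isMaxOn_norm hUc (isOpen_strip t.im)
    (fun w hw => (hGd w hw).differentiableWithinAt) hz₀U hmaxU
  have e0 : G 0 = G z₀ := hconst (show (0 : ℂ) ∈ U by simpa [hU] using ht)
  rw [← hGg z hz', hconst hz, Function.const_apply, ← hGn 0, Int.cast_zero, e0]

section

/-! ### Lambert series -/

lemma zetapow_add (r : ℤ) (z w : ℂ) : zetapow r (z + w) = zetapow r z * zetapow r w := by
  rw [zetapow, zetapow, zetapow, ← Complex.exp_add]
  ring_nf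

lemma zetapow_neg (r : ℤ) (z : ℂ) : zetapow (-r) z = zetapow r (-z) := by
  rw [zetapow, zetapow]
  push_cast
  ring_nf

lemma zetapow_neg_right (r : ℤ) (z : ℂ) : zetapow r (-z) = (zetapow r z)⁻¹ := by
  rw [zetapow, zetapow, ← Complex.exp_neg]
  ring_nf

lemma zetapow_ne_zero (r : ℤ) (z : ℂ) : zetapow r z ≠ 0 := Complex.exp_ne_zero _

lemma zetapow_int (r n : ℤ) : zetapow r n = 1 := by
  rw [zetapow, show 2 * π * I * r * n = ((r * n : ℤ) : ℂ) * (2 * π * I) by push_cast; ring,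
    exp_int_mul_two_pi_mul_I]

lemma zetapow_zero_right (r : ℤ) : zetapow r 0 = 1 := by simpa using zetapow_int r 0

lemma zetapow_add_one (r : ℤ) (z : ℂ) : zetapow r (z + 1) = zetapow r z := by
  have := zetapow_int r 1
  rw [Int.cast_one] at this
  rw [zetapow_add, this, mul_one]

lemma zetapow_natCast (r : ℕ) (z : ℂ) : zetapow r z = cexp (2 * π * I * z) ^ r := by
  rw [zetapow, ← Complex.exp_nat_mul]
  push_cast
  ring_nf

lemma norm_zetapow (r : ℤ) (z : ℂ) : ‖zetapow r z‖ = Real.exp (-(2 * π * r * z.im)) := by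
  rw [zetapow, Complex.norm_exp]
  congr 1
  simp [mul_assoc]

lemma norm_zetapow_natCast (r : ℕ) (z : ℂ) : ‖zetapow r z‖ = Real.exp (-(2 * π * z.im)) ^ r := by
  rw [norm_zetapow, ← Real.exp_nat_mul]
  push_cast
  ring_nf

lemma qpow_intCast (r : ℤ) (τ : ℍ) : qpow (r : ℝ) τ = zetapow r τ := by
  rw [qpow, zetapow]
  push_cast
  rfl

lemma norm_cexp_lt_one {t : ℂ} (ht : 0 < t.im) : ‖cexp (2 * π * I * t)‖ < 1 := by
  have := norm_zetapow_natCast 1 t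
  rw [zetapow_natCast, pow_one, pow_one] at this
  rw [this, Real.exp_lt_one_iff]
  have := Real.pi_pos
  have : 0 < 2 * π * t.im := by positivity
  linarith

lemma one_sub_zetapow_ne_zero {t : ℂ} (ht : 0 < t.im) {r : ℕ} (hr : r ≠ 0) :
    1 - zetapow r t ≠ 0 := by
  rw [zetapow_natCast, sub_ne_zero]
  intro h
  have h1 := congrArg norm h
  rw [norm_pow, norm_one] at h1
  exact absurd h1.symm (pow_lt_one₀ (norm_nonneg _) (norm_cexp_lt_one ht) hr).ne

/-- The power series `∑ w(r) ζ ^ r`. -/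
def powSum (w : ℕ → ℂ) (z : ℂ) : ℂ := ∑' r : ℕ, w r * zetapow r z

/-- The Lambert series `∑ w(r) q ^ r / (1 - q ^ r) ζ ^ r`. -/
def lambertHalf (w : ℕ → ℂ) (t z : ℂ) : ℂ :=
  ∑' r : ℕ, w r * (zetapow r t / (1 - zetapow r t)) * zetapow r z

/-- The Lambert series `∑ w(r) q ^ r / (1 - q ^ r) (ζ ^ r + ζ ^ (-r))`. -/
def lambert (w : ℕ → ℂ) (t z : ℂ) : ℂ := lambertHalf w t z + lambertHalf w t (-z)

/-- Sequences bounded by `r ^ k`; for `k ≠ 0` they vanish at `0`. -/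
def HasGrowth (w : ℕ → ℂ) (k : ℕ) : Prop := ∀ r, ‖w r‖ ≤ (r : ℝ) ^ k

variable {w : ℕ → ℂ} {k : ℕ} {t z : ℂ}

lemma summable_pow_mul_exp_pow (k : ℕ) {y : ℝ} (hy : 0 < y) (C : ℝ) :
    Summable fun r : ℕ => C * ((r : ℝ) ^ k * Real.exp (-(2 * π * y)) ^ r) := by
  refine (summable_pow_mul_geometric_of_norm_lt_one k ?_).mul_left C
  rw [Real.norm_eq_abs, abs_of_pos (Real.exp_pos _), Real.exp_lt_one_iff]
  have := Real.pi_pos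
  have : 0 < 2 * π * y := by positivity
  linarith

lemma HasGrowth.norm_mul_zetapow_le (hw : HasGrowth w k) {y : ℝ} (hz : y ≤ z.im) (r : ℕ) :
    ‖w r * zetapow r z‖ ≤ (r : ℝ) ^ k * Real.exp (-(2 * π * y)) ^ r := by
  rw [norm_mul, norm_zetapow_natCast]
  have := Real.pi_pos
  gcongr
  exact hw r

lemma HasGrowth.summable_powSum (hw : HasGrowth w k) (hz : 0 < z.im) :
    Summable fun r : ℕ => w r * zetapow r z :=
  Summable.of_norm_bounded (by simpa using summable_pow_mul_exp_pow k hz 1)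
    (fun r => hw.norm_mul_zetapow_le le_rfl r)

lemma norm_div_one_sub_le (ht : 0 < t.im) (r : ℕ) :
    ‖zetapow r t / (1 - zetapow r t)‖ ≤
      (1 - Real.exp (-(2 * π * t.im)))⁻¹ * Real.exp (-(2 * π * t.im)) ^ r := by
  have hπ := Real.pi_pos
  have h1 : Real.exp (-(2 * π * t.im)) < 1 := by
    rw [Real.exp_lt_one_iff]
    have : 0 < 2 * π * t.im := by positivity
    linarith
  -- At `r = 0` the denominator vanishes and the quotient is `0` by convention.
  rcases eq_or_ne r 0 with rfl | hr
  · simp only [Nat.cast_zero, pow_zero, mul_one]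
    rw [zetapow]
    simp only [Int.cast_zero, mul_zero, zero_mul, Complex.exp_zero, sub_self, div_zero, norm_zero]
    exact inv_nonneg.mpr (by linarith)
  · rw [norm_div, norm_zetapow_natCast, div_eq_inv_mul]
    refine mul_le_mul_of_nonneg_right (inv_anti₀ (by linarith) ?_) (by positivity)
    · calc 1 - Real.exp (-(2 * π * t.im)) ≤ 1 - ‖zetapow r t‖ := by
            rw [norm_zetapow_natCast]
            have := pow_le_of_le_one (Real.exp_pos (-(2 * π * t.im))).le h1.le hr
            linarith
        _ ≤ ‖1 - zetapow r t‖ := by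
            have := norm_sub_norm_le 1 (zetapow r t)
            rwa [norm_one] at this

lemma HasGrowth.norm_lambertTerm_le (hw : HasGrowth w k) (ht : 0 < t.im) {y : ℝ}
    (hz : -y ≤ z.im) (r : ℕ) :
    ‖w r * (zetapow r t / (1 - zetapow r t)) * zetapow r z‖ ≤
      (1 - Real.exp (-(2 * π * t.im)))⁻¹ *
        ((r : ℝ) ^ k * Real.exp (-(2 * π * (t.im - y))) ^ r) := by
  have hπ := Real.pi_pos
  have h1 : Real.exp (-(2 * π * t.im)) < 1 := by
    rw [Real.exp_lt_one_iff]
    have : 0 < 2 * π * t.im := by positivity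
    linarith
  have h2 : 0 ≤ (1 - Real.exp (-(2 * π * t.im)))⁻¹ := inv_nonneg.mpr (by linarith)
  calc _ ≤ (r : ℝ) ^ k * ((1 - Real.exp (-(2 * π * t.im)))⁻¹ * Real.exp (-(2 * π * t.im)) ^ r) *
        Real.exp (-(2 * π * -y)) ^ r := by
        rw [norm_mul, norm_mul, norm_zetapow_natCast r z]
        gcongr
        · exact hw r
        · exact norm_div_one_sub_le ht r
    _ = _ := by
        rw [show -(2 * π * (t.im - y)) = -(2 * π * t.im) + -(2 * π * -y) by ring, Real.exp_add,
          mul_pow]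
        ring

lemma HasGrowth.summable_lambertHalf (hw : HasGrowth w k) (ht : 0 < t.im) (hz : -t.im < z.im) :
    Summable fun r : ℕ => w r * (zetapow r t / (1 - zetapow r t)) * zetapow r z := by
  refine Summable.of_norm_bounded (summable_pow_mul_exp_pow k (y := t.im - -z.im) (by linarith) _)
    (fun r => hw.norm_lambertTerm_le ht (y := -z.im) (by simp) r)

lemma differentiable_zetapow (r : ℤ) : Differentiable ℂ (zetapow r) := by
  unfold zetapow
  fun_prop

lemma HasGrowth.differentiableAt_lambertHalf (hw : HasGrowth w k) (ht : 0 < t.im)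
    (hz : -t.im < z.im) : DifferentiableAt ℂ (lambertHalf w t) z := by
  obtain ⟨y, hy0, hy⟩ := exists_between hz
  have ho : IsOpen {z : ℂ | y < z.im} := isOpen_lt continuous_const Complex.continuous_im
  refine (differentiableOn_tsum_of_summable_norm (U := {z : ℂ | y < z.im})
    (summable_pow_mul_exp_pow k (y := t.im - -y) (by linarith) _) (fun r => ?_) ho
    (fun r z hz => hw.norm_lambertTerm_le ht (y := -y) ?_ r)).differentiableAt (ho.mem_nhds hy)
  · exact ((differentiable_zetapow r).const_mul _).differentiableOn
  · rw [neg_neg]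
    exact le_of_lt hz

lemma HasGrowth.differentiableAt_lambert (hw : HasGrowth w k) (ht : 0 < t.im)
    (hz : |z.im| < t.im) : DifferentiableAt ℂ (lambert w t) z := by
  rw [abs_lt] at hz
  refine (hw.differentiableAt_lambertHalf ht hz.1).add ?_
  have h : DifferentiableAt ℂ (lambertHalf w t) (-z) :=
    hw.differentiableAt_lambertHalf ht (by rw [Complex.neg_im]; linarith)
  exact h.comp z differentiableAt_id.neg

lemma lambert_add_one (w : ℕ → ℂ) (t z : ℂ) : lambert w t (z + 1) = lambert w t z := by
  have h (r : ℤ) : zetapow r (-(z + 1)) = zetapow r (-z) := by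
    rw [zetapow_neg_right, zetapow_neg_right, zetapow_add_one]
  simp only [lambert, lambertHalf, zetapow_add_one, h]

/-- Termwise `q^r · q^r/(1 - q^r) = q^r/(1 - q^r) - q^r` and `q^(-r) · q^r/(1 - q^r) = q^r/(1 - q^r)
+ 1`; the corrections sum to the two power series. The condition `k ≠ 0` forces `w 0 = 0`, which
removes the term `r = 0` where these identities fail. -/
lemma HasGrowth.lambert_add_self (hw : HasGrowth w k) (hk : k ≠ 0) (h1 : -t.im < z.im)
    (h2 : z.im < 0) :
    lambert w t (z + t) = lambert w t z + powSum w (-z) - powSum w (z + t) := by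
  have ht : 0 < t.im := by linarith
  have hw0 : w 0 = 0 := by
    have := hw 0
    rwa [Nat.cast_zero, zero_pow hk, norm_le_zero_iff] at this
  have s1 := hw.summable_lambertHalf ht (z := z + t) (by simp; linarith)
  have s2 := hw.summable_lambertHalf ht (z := -(z + t)) (by simp; linarith)
  have s3 := hw.summable_lambertHalf ht h1
  have s4 := hw.summable_lambertHalf ht (z := -z) (by simp; linarith)
  have s5 := hw.summable_powSum (z := -z) (by simpa using h2)
  have s6 := hw.summable_powSum (z := z + t) (by simp; linarith)
  rw [lambert, lambert, lambertHalf, lambertHalf, lambertHalf, lambertHalf, powSum, powSum,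
    ← s1.tsum_add s2, ← s3.tsum_add s4, ← (s3.add s4).tsum_add s5,
    ← ((s3.add s4).add s5).tsum_sub s6]
  refine tsum_congr fun r => ?_
  rcases eq_or_ne r 0 with rfl | hr
  · simp [hw0]
  · have := one_sub_zetapow_ne_zero ht hr
    have hz0 := zetapow_ne_zero r z
    have ht0 := zetapow_ne_zero r t
    rw [zetapow_neg_right, zetapow_neg_right, zetapow_add]
    field_simp
    ring

lemma hasGrowth_pow (k : ℕ) : HasGrowth (fun r => (r : ℂ) ^ k) k := fun r => by simp

lemma hasGrowth_inv : HasGrowth (fun r => (r : ℂ)⁻¹) 1 := fun r => by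
  rcases eq_or_ne r 0 with rfl | hr
  · simp
  · have h : (1 : ℝ) ≤ r := by exact_mod_cast Nat.one_le_iff_ne_zero.mpr hr
    rw [norm_inv, Complex.norm_natCast, pow_one]
    exact (inv_le_one_of_one_le₀ h).trans h

lemma exp_powSum_inv (hz : 0 < z.im) :
    cexp (powSum (fun r => (r : ℂ)⁻¹) z) = (1 - zetapow 1 z)⁻¹ := by
  have h1 : zetapow 1 z = cexp (2 * π * I * z) := by simpa using zetapow_natCast 1 z
  have h2 := Complex.hasSum_taylorSeries_neg_log (norm_cexp_lt_one hz)
  have h3 : powSum (fun r => (r : ℂ)⁻¹) z = -Complex.log (1 - cexp (2 * π * I * z)) := by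
    rw [← h2.tsum_eq]
    refine tsum_congr fun r => ?_
    rw [zetapow_natCast, div_eq_inv_mul]
  have h4 : 1 - cexp (2 * π * I * z) ≠ 0 := by
    rw [← h1]
    exact_mod_cast one_sub_zetapow_ne_zero hz one_ne_zero
  rw [h3, Complex.exp_neg, Complex.exp_log h4, h1]

lemma HasGrowth.lambert_zero (hw : HasGrowth w k) (hk : k ≠ 0) (ht : 0 < t.im) :
    lambert w t 0 = 2 * ∑' r : ℕ+, w r * (zetapow (r : ℕ) t / (1 - zetapow (r : ℕ) t)) := by
  have hw0 : w 0 = 0 := by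
    have := hw 0
    rwa [Nat.cast_zero, zero_pow hk, norm_le_zero_iff] at this
  have h : lambertHalf w t 0 = ∑' r : ℕ+, w r * (zetapow (r : ℕ) t / (1 - zetapow (r : ℕ) t)) := by
    rw [lambertHalf, ← tsum_zero_pnat_eq_tsum_nat]
    · simp [hw0, zetapow_zero_right]
    · exact hw.summable_lambertHalf ht (by simpa using ht)
  rw [lambert, neg_zero, h, two_mul]

lemma hasSum_of_forall_eq {ι : Type*} {f g : ι → ℂ} {a : ℂ} (h : HasSum g a)
    (e : ∀ i, f i = g i) : HasSum f a := by
  rwa [funext e]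

/-- The polar series is a Lambert series. -/
lemma hasSum_polarTerm {j : ℕ} (hj : 1 ≤ j) {τ : ℍ} (h1 : 0 < z.im) (h2 : z.im < τ.im) :
    HasSum (polarTerm j z τ) (powSum (fun r => (r : ℂ) ^ (2 * j - 1)) z +
      lambert (fun r => (r : ℂ) ^ (2 * j - 1)) τ z) := by
  have hw := hasGrowth_pow (2 * j - 1)
  have hk : 2 * j - 1 ≠ 0 := by omega
  have hodd : Odd (2 * j - 1) := ⟨j - 1, by omega⟩
  have ht : 0 < (τ : ℂ).im := τ.im_pos
  set f : ℤ → ℂ := fun r => (r : ℂ) ^ (2 * j - 1) / (1 - zetapow r τ) * zetapow r z with hf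
  have hfp : polarTerm j z τ = f ∘ (Subtype.val : {r : ℤ // r ≠ 0} → ℤ) := by
    ext r
    simp only [polarTerm, hf, Function.comp_apply, qpow_intCast]
  have s1 := hw.summable_powSum h1
  have s2 := hw.summable_lambertHalf ht (z := z) (by linarith)
  have s3 := hw.summable_lambertHalf ht (z := -z)
    (by rw [Complex.neg_im, UpperHalfPlane.coe_im]; linarith)
  have hf0 : f 0 = 0 := by simp [hf, hk]
  rw [hfp]
  refine (hasSum_subtype_iff_of_support_subset (s := {r : ℤ | r ≠ 0}) ?_).mpr ?_
  · intro r hr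
    simp only [Function.mem_support] at hr
    rintro rfl
    exact hr hf0
  -- For `r > 0`, `1/(1 - q^r) = 1 + q^r/(1 - q^r)`. For negative indices, `-1/(1 - q^(-r)) = q^r/(1
  -- - q^r)`, where the sign comes from the odd power `2j - 1`.
  · have hp : HasSum (fun n : ℕ => f n) (powSum (fun r => (r : ℂ) ^ (2 * j - 1)) z +
        lambertHalf (fun r => (r : ℂ) ^ (2 * j - 1)) τ z) := by
      refine hasSum_of_forall_eq (s1.hasSum.add s2.hasSum) fun r => ?_
      rcases eq_or_ne r 0 with rfl | hr
      · simp [hf, hk]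
      · have := one_sub_zetapow_ne_zero ht hr
        simp only [hf, Int.cast_natCast]
        field_simp
        ring
    have hn : HasSum (fun n : ℕ => f (-n)) (lambertHalf (fun r => (r : ℂ) ^ (2 * j - 1)) τ (-z)) := by
      refine hasSum_of_forall_eq s3.hasSum fun r => ?_
      rcases eq_or_ne r 0 with rfl | hr
      · simp [hf, hk]
      · have := one_sub_zetapow_ne_zero ht hr
        have h0 := zetapow_ne_zero r (τ : ℂ)
        have h3 : 1 - (zetapow r (τ : ℂ))⁻¹ ≠ 0 := by
          rw [sub_ne_zero] at this ⊢
          intro h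
          exact this (by rw [← inv_inv (zetapow _ _), ← h, inv_one])
        simp only [hf, Int.cast_natCast, Int.cast_neg]
        rw [hodd.neg_pow, zetapow_neg, zetapow_neg, zetapow_neg_right (r : ℤ) (τ : ℂ)]
        have h4 : 1 - (zetapow r (τ : ℂ))⁻¹ = -((1 - zetapow r (τ : ℂ)) / zetapow r (τ : ℂ)) := by
          field_simp
          ring
        rw [h4, neg_div_neg_eq]
        field_simp
    have := HasSum.of_nat_of_neg hp hn
    rwa [hf0, sub_zero, add_assoc] at this

end

section

/-! ### The sums `∑ 1 / (z + n) ^ (k + 1)` -/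

variable {k : ℕ} {z : ℂ}

/-- The terms of `∑ 1 / (z + n) ^ (k + 1)` with `|n| ≥ N`. -/
def poleTail (k N : ℕ) (z : ℂ) : ℂ :=
  ∑' n : ℤ, if n.natAbs < N then 0 else 1 / (z + n) ^ (k + 1)

lemma half_abs_le_norm_add {N : ℕ} (hz : ‖z‖ < N / 2) {n : ℤ} (hn : ¬ n.natAbs < N) :
    |(n : ℝ)| / 2 ≤ ‖z + n‖ := by
  have h1 : (N : ℝ) ≤ |(n : ℝ)| := by
    rw [← Int.cast_abs, ← Int.natCast_natAbs]
    exact_mod_cast not_lt.mp hn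
  have h2 := norm_sub_norm_le (n : ℂ) (-z)
  rw [norm_neg, Complex.norm_intCast, sub_neg_eq_add, add_comm] at h2
  linarith

lemma norm_poleTail_term_le {N : ℕ} (hN : 1 ≤ N) (hz : ‖z‖ < N / 2) (n : ℤ) :
    ‖if n.natAbs < N then (0 : ℂ) else 1 / (z + n) ^ (k + 1)‖ ≤
      2 ^ (k + 1) * |1 / (n : ℝ) ^ (k + 1)| := by
  split_ifs with h
  · rw [norm_zero]
    positivity
  · have h1 : 0 < |(n : ℝ)| := by
      rw [abs_pos]
      rintro h0
      have : n = 0 := by exact_mod_cast h0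
      simp [this] at h
      omega
    rw [norm_div, norm_one, norm_pow, abs_div, abs_one, abs_pow]
    calc 1 / ‖z + n‖ ^ (k + 1) ≤ 1 / (|(n : ℝ)| / 2) ^ (k + 1) := by
          gcongr
          exact half_abs_le_norm_add hz h
      _ = _ := by
          rw [div_pow]
          field_simp

lemma summable_poleTail_bound (hk : 1 ≤ k) :
    Summable fun n : ℤ => (2 : ℝ) ^ (k + 1) * |1 / (n : ℝ) ^ (k + 1)| :=
  (Real.summable_one_div_int_pow.mpr (by omega)).abs.mul_left _

lemma differentiableAt_poleTail (hk : 1 ≤ k) {N : ℕ} (hN : 1 ≤ N) (hz : ‖z‖ < N / 2) :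
    DifferentiableAt ℂ (poleTail k N) z := by
  refine (differentiableOn_tsum_of_summable_norm (U := Metric.ball 0 ((N : ℝ) / 2))
    (summable_poleTail_bound hk) (fun n => ?_) Metric.isOpen_ball
    (fun n w hw => norm_poleTail_term_le hN (by simpa using hw) n)).differentiableAt
    (Metric.isOpen_ball.mem_nhds (by simpa using hz))
  intro w hw
  split_ifs with h
  · exact differentiableWithinAt_const 0
  · have h0 : w + n ≠ 0 := by
      rw [← norm_pos_iff]
      refine lt_of_lt_of_le ?_ (half_abs_le_norm_add (by simpa using hw) h)
      have : n ≠ 0 := by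
        rintro rfl
        simp at h
        omega
      positivity
    have : DifferentiableAt ℂ (fun w : ℂ => 1 / (w + n) ^ (k + 1)) w := by
      have : (w + n) ^ (k + 1) ≠ 0 := pow_ne_zero _ h0
      fun_prop (disch := assumption)
    exact this.differentiableWithinAt

lemma hasSum_poleSum (hk : 1 ≤ k) {N : ℕ} (hN : 1 ≤ N) (hz : ‖z‖ < N / 2) :
    HasSum (fun n : ℤ => 1 / (z + n) ^ (k + 1))
      (∑ n ∈ Finset.Ioo (-N : ℤ) N, 1 / (z + n) ^ (k + 1) + poleTail k N z) := by
  have h1 : HasSum (fun n : ℤ => if n.natAbs < N then 1 / (z + n) ^ (k + 1) else 0)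
      (∑ n ∈ Finset.Ioo (-N : ℤ) N, 1 / (z + n) ^ (k + 1)) := by
    have : ∑ n ∈ Finset.Ioo (-N : ℤ) N, 1 / (z + n) ^ (k + 1) =
        ∑ n ∈ Finset.Ioo (-N : ℤ) N, if n.natAbs < N then 1 / (z + n) ^ (k + 1) else 0 := by
      refine Finset.sum_congr rfl fun n hn => ?_
      rw [Finset.mem_Ioo] at hn
      rw [if_pos (by omega)]
    rw [this]
    refine hasSum_sum_of_ne_finset_zero fun n hn => ?_
    rw [Finset.mem_Ioo] at hn
    rw [if_neg (by omega)]
  have h2 : HasSum (fun n : ℤ => if n.natAbs < N then (0 : ℂ) else 1 / (z + n) ^ (k + 1))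
      (poleTail k N z) :=
    (Summable.of_norm_bounded (summable_poleTail_bound hk)
      (norm_poleTail_term_le hN hz)).hasSum
  refine hasSum_of_forall_eq (h1.add h2) fun n => ?_
  split_ifs <;> simp

/-- `∑ 1 / (z + n) ^ (k + 1)`, scaled to have leading term `k! / (2 π i z) ^ (k + 1)`. -/
def poleSum (k : ℕ) (z : ℂ) : ℂ :=
  (k.factorial : ℂ) / (2 * π * I) ^ (k + 1) * ∑' n : ℤ, 1 / (z + n) ^ (k + 1)

lemma poleSum_eq (hk : 1 ≤ k) {N : ℕ} (hN : 1 ≤ N) (hz : ‖z‖ < N / 2) :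
    poleSum k z = (k.factorial : ℂ) / (2 * π * I) ^ (k + 1) *
      (∑ n ∈ Finset.Ioo (-N : ℤ) N, 1 / (z + n) ^ (k + 1) + poleTail k N z) := by
  rw [poleSum, (hasSum_poleSum hk hN hz).tsum_eq]

/-- For `N > 2‖z‖` the terms with `|n| ≥ N` form a series that is holomorphic near `z`, and finitely
many terms remain. -/
lemma differentiableAt_poleSum (hk : 1 ≤ k) (hz : ∀ n : ℤ, z ≠ n) :
    DifferentiableAt ℂ (poleSum k) z := by
  obtain ⟨N, hN⟩ := exists_nat_gt (2 * ‖z‖)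
  have hN1 : 1 ≤ N := by
    have : (0 : ℝ) < N := lt_of_le_of_lt (by positivity) hN
    exact_mod_cast this
  have hzN : ‖z‖ < N / 2 := by linarith
  have e : poleSum k =ᶠ[𝓝 z] fun z => (k.factorial : ℂ) / (2 * π * I) ^ (k + 1) *
      (∑ n ∈ Finset.Ioo (-N : ℤ) N, 1 / (z + n) ^ (k + 1) + poleTail k N z) := by
    filter_upwards [continuous_norm.continuousAt.eventually_lt continuousAt_const hzN] with w hw
    exact poleSum_eq hk hN1 hw
  refine DifferentiableAt.congr_of_eventuallyEq ?_ e
  refine (DifferentiableAt.add ?_ (differentiableAt_poleTail hk hN1 hzN)).const_mul _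
  refine DifferentiableAt.fun_sum fun n _ => ?_
  have h0 : z + n ≠ 0 := by
    intro h
    exact hz (-n) (by push_cast; linear_combination h)
  have : (z + n) ^ (k + 1) ≠ 0 := pow_ne_zero _ h0
  fun_prop (disch := assumption)

lemma poleSum_add_one (k : ℕ) (z : ℂ) : poleSum k (z + 1) = poleSum k z := by
  rw [poleSum, poleSum, ← (Equiv.addRight (1 : ℤ)).tsum_eq fun n : ℤ => 1 / (z + n) ^ (k + 1)]
  congr 1
  refine tsum_congr fun n => ?_
  rw [Equiv.coe_addRight]
  push_cast
  ring_nf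

lemma poleSum_neg (hk : Odd k) (z : ℂ) : poleSum k (-z) = poleSum k z := by
  rw [poleSum, poleSum, ← (Equiv.neg ℤ).tsum_eq fun n : ℤ => 1 / (z + n) ^ (k + 1)]
  congr 1
  refine tsum_congr fun n => ?_
  rw [Equiv.neg_apply, Int.cast_neg, show -z + n = -(z + -n) by ring, hk.add_one.neg_pow]

/-- Lipschitz's formula. Oddness of `k` makes `(-2πi)^(k+1)` equal to `(2πi)^(k+1)`. -/
lemma poleSum_eq_powSum (hk : Odd k) (hz : 0 < z.im) :
    poleSum k z = powSum (fun r => (r : ℂ) ^ k) z := by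
  have h := EisensteinSeries.qExpansion_identity hk.pos ⟨z, hz⟩
  have h0 : (2 * π * I : ℂ) ≠ 0 := by simp [Real.pi_ne_zero]
  have h1 : (k.factorial : ℂ) ≠ 0 := by exact_mod_cast k.factorial_ne_zero
  have h2 : (-2 * π * I : ℂ) ^ (k + 1) = (2 * π * I) ^ (k + 1) := by
    rw [neg_mul, neg_mul, hk.add_one.neg_pow]
  rw [poleSum]
  simp only at h
  rw [h, h2, powSum, ← mul_assoc]
  have : (k.factorial : ℂ) / (2 * π * I) ^ (k + 1) * ((2 * π * I) ^ (k + 1) / k.factorial) = 1 := by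
    field_simp
  rw [this, one_mul]
  exact tsum_congr fun n => by rw [zetapow_natCast]

lemma poleTail_zero (hk : Odd k) : poleTail k 1 0 = 2 * riemannZeta ((k + 1 : ℕ) : ℂ) := by
  rw [two_mul_riemannZeta_eq_tsum_int_inv_pow_of_even (by have := hk.pos; omega) hk.add_one,
    poleTail]
  refine tsum_congr fun n => ?_
  split_ifs with h
  · have : n = 0 := by omega
    simp [this]
  · simp

/-- Euler's evaluation of `ζ(2j)`, normalised so that it gives the constant term of `poleSum` at
`0`. -/
lemma factorial_mul_zeta {j : ℕ} (hj : 1 ≤ j) :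
    ((2 * j - 1).factorial : ℂ) / (2 * π * I) ^ (2 * j) * (2 * riemannZeta ((2 * j : ℕ) : ℂ)) =
      -(((bernoulli (2 * j) : ℚ) : ℂ) / (2 * j)) := by
  obtain ⟨i, rfl⟩ : ∃ i, j = i + 1 := ⟨j - 1, by omega⟩
  have h1 : (((2 * (i + 1)).factorial : ℕ) : ℂ) =
      (2 * (i + 1)) * ((2 * (i + 1) - 1).factorial : ℂ) := by
    rw [← Nat.mul_factorial_pred (by omega : 2 * (i + 1) ≠ 0)]
    push_cast
    ring
  have h2 : ((2 * (i + 1) - 1).factorial : ℂ) ≠ 0 := by exact_mod_cast Nat.factorial_ne_zero _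
  have h3 : ((i : ℂ) + 1) ≠ 0 := by exact_mod_cast Nat.succ_ne_zero i
  have h4 : (π : ℂ) ≠ 0 := by simp [Real.pi_ne_zero]
  have h5 : I ^ (2 * (i + 1)) = (-1) ^ (i + 1) := by rw [pow_mul, I_sq]
  have h6 : ((-1 : ℂ)) ^ (i + 1) ≠ 0 := pow_ne_zero _ (by norm_num)
  rw [Nat.cast_mul, Nat.cast_ofNat, riemannZeta_two_mul_nat (by omega), h1, mul_pow, mul_pow, h5]
  rw [show (2 : ℂ) ^ (2 * (i + 1)) = 2 * 2 ^ (2 * (i + 1) - 1) by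
    rw [← pow_succ']; congr 1]
  push_cast
  rw [pow_succ ((-1 : ℂ)) (i + 1)]
  field_simp

/-- The Laurent expansion of `poleSum` at `0` up to the constant term. -/
lemma tendsto_poleSum_sub {j : ℕ} (hj : 1 ≤ j) :
    Tendsto (fun z => poleSum (2 * j - 1) z - ((2 * j - 1).factorial : ℂ) / (2 * π * I * z) ^ (2 * j))
      (𝓝[≠] 0) (𝓝 (-(((bernoulli (2 * j) : ℚ) : ℂ) / (2 * j)))) := by
  have hk : Odd (2 * j - 1) := ⟨j - 1, by omega⟩
  have hkj : 2 * j - 1 + 1 = 2 * j := by omega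
  rw [← factorial_mul_zeta hj, ← hkj, ← poleTail_zero hk, hkj]
  have h1 : Tendsto (poleTail (2 * j - 1) 1) (𝓝[≠] 0) (𝓝 (poleTail (2 * j - 1) 1 0)) :=
    (differentiableAt_poleTail hk.pos le_rfl (by simp)).continuousAt.tendsto.mono_left
      nhdsWithin_le_nhds
  refine (h1.const_mul _).congr' ?_
  have h2 : ∀ᶠ w : ℂ in 𝓝[≠] 0, ‖w‖ < ((1 : ℕ) : ℝ) / 2 :=
    nhdsWithin_le_nhds (continuous_norm.continuousAt.eventually_lt continuousAt_const (by simp))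
  filter_upwards [h2] with w hw
  rw [poleSum_eq hk.pos le_rfl hw, hkj]
  have : Finset.Ioo (-((1 : ℕ) : ℤ)) ((1 : ℕ) : ℤ) = {0} := by decide
  rw [this, Finset.sum_singleton, Int.cast_zero, add_zero, mul_add, mul_one_div, mul_pow _ w,
    div_div, add_sub_cancel_left]

end

/-! ### Circle integrals depending holomorphically on parameters -/

/-- Cauchy's estimate for the one-variable function `s ↦ f (x + s • v)` on the disc of radius `r /
‖v‖`. -/
lemma norm_fderiv_le_of_bounded {E : Type*} [NormedAddCommGroup E] [NormedSpace ℂ E] {f : E → ℂ}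
    {x : E} {r C : ℝ} (hr : 0 < r) (hd : ∀ y ∈ Metric.ball x (2 * r), DifferentiableAt ℂ f y)
    (hC : ∀ y ∈ Metric.ball x (2 * r), ‖f y‖ ≤ C) : ‖fderiv ℂ f x‖ ≤ C / r := by
  have hx : x ∈ Metric.ball x (2 * r) := Metric.mem_ball_self (by linarith)
  have hC0 : 0 ≤ C := (norm_nonneg _).trans (hC x hx)
  refine ContinuousLinearMap.opNorm_le_bound _ (by positivity) fun v => ?_
  rcases eq_or_ne v 0 with rfl | hv
  · simp
  have hv0 : 0 < ‖v‖ := norm_pos_iff.mpr hv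
  have hmem : ∀ s : ℂ, ‖s‖ < 2 * r / ‖v‖ → x + s • v ∈ Metric.ball x (2 * r) := by
    intro s hs
    rw [mem_ball_iff_norm, add_sub_cancel_left, norm_smul]
    exact (lt_div_iff₀ hv0).mp hs
  have hline : ∀ s : ℂ, ‖s‖ < 2 * r / ‖v‖ →
      DifferentiableAt ℂ (fun s : ℂ => f (x + s • v)) s := by
    intro s hs
    exact (hd _ (hmem s hs)).comp s (by fun_prop)
  have hlt : r / ‖v‖ < 2 * r / ‖v‖ := by gcongr; linarith
  have hderiv : deriv (fun s : ℂ => f (x + s • v)) 0 = fderiv ℂ f x v := by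
    have h0 : HasFDerivAt f (fderiv ℂ f x) (x + (0 : ℂ) • v) := by
      rw [zero_smul, add_zero]
      exact (hd x hx).hasFDerivAt
    have h1 : HasDerivAt (fun s : ℂ => x + s • v) v 0 := by
      simpa using ((hasDerivAt_id (0 : ℂ)).smul_const v).const_add x
    exact (h0.comp_hasDerivAt (0 : ℂ) h1).deriv
  have := Complex.norm_deriv_le_of_forall_mem_sphere_norm_le (c := 0) (R := r / ‖v‖) (C := C)
    (f := fun s : ℂ => f (x + s • v)) (by positivity)
    (DifferentiableOn.diffContOnCl (fun s hs => (hline s (by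
      have := Metric.closure_ball_subset_closedBall hs
      rw [mem_closedBall_zero_iff] at this
      linarith)).differentiableWithinAt))
    (fun s hs => hC _ (hmem s (by
      rw [mem_sphere_zero_iff_norm] at hs
      linarith)))
  rw [hderiv] at this
  calc _ ≤ _ := this
    _ = _ := by field_simp

/-- Differentiation under the integral sign. Compactness bounds `W`, and Cauchy's estimate turns
this into a bound for its derivative, so no regularity of the derivative has to be assumed. -/
theorem differentiableAt_circleIntegral {W : ℂ → ℂ × ℂ → ℂ} {ρ : ℝ} (hρ : 0 ≤ ρ) {x₀ : ℂ × ℂ} {R : ℝ}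
    (hR : 0 < R)
    (hc : ContinuousOn (fun p : ℂ × (ℂ × ℂ) => W p.1 p.2)
      (Metric.sphere 0 ρ ×ˢ Metric.closedBall x₀ R))
    (hd : ∀ w ∈ Metric.sphere (0 : ℂ) ρ, ∀ x ∈ Metric.ball x₀ R, DifferentiableAt ℂ (W w) x) :
    DifferentiableAt ℂ (fun x => ∮ w in C(0, ρ), W w x) x₀ := by
  obtain ⟨C, hC⟩ := ((isCompact_sphere (0 : ℂ) ρ).prod
    (isCompact_closedBall x₀ R)).exists_bound_of_continuousOn hc
  have hcirc : ∀ θ, circleMap 0 ρ θ ∈ Metric.sphere (0 : ℂ) ρ := circleMap_mem_sphere 0 hρ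
  have hC' : ∀ θ, ∀ x ∈ Metric.ball x₀ R, ‖W (circleMap 0 ρ θ) x‖ ≤ C := fun θ x hx =>
    hC (_, x) ⟨hcirc θ, Metric.ball_subset_closedBall hx⟩
  have hcont : ∀ x ∈ Metric.ball x₀ R,
      Continuous fun θ => deriv (circleMap 0 ρ) θ • W (circleMap 0 ρ θ) x := by
    intro x hx
    have h1 : Continuous fun θ => W (circleMap 0 ρ θ) x :=
      hc.comp_continuous ((continuous_circleMap 0 ρ).prodMk continuous_const)
        fun θ => ⟨hcirc θ, Metric.ball_subset_closedBall hx⟩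
    simp only [deriv_circleMap]
    exact ((continuous_circleMap 0 ρ).mul continuous_const).smul h1
  have hx₀ : x₀ ∈ Metric.ball x₀ R := Metric.mem_ball_self hR
  set F' : ℂ × ℂ → ℝ → (ℂ × ℂ →L[ℂ] ℂ) := fun x θ =>
    deriv (circleMap 0 ρ) θ • fderiv ℂ (W (circleMap 0 ρ θ)) x with hF'
  have hderiv : ∀ θ, ∀ x ∈ Metric.ball x₀ R,
      HasFDerivAt (fun x => deriv (circleMap 0 ρ) θ • W (circleMap 0 ρ θ) x) (F' x θ) x :=
    fun θ x hx => (hd _ (hcirc θ) x hx).hasFDerivAt.fun_const_smul _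
  -- Each directional derivative is a pointwise limit of difference quotients continuous in `θ`. The
  -- scales `(n + 1)(2/R)` keep the displaced point within `R/2` of `x₀`.
  have hmeas : ∀ v : ℂ × ℂ, ‖v‖ ≤ 1 → MeasureTheory.AEStronglyMeasurable (fun θ => F' x₀ θ v)
      (MeasureTheory.volume.restrict (Set.uIoc 0 (2 * π))) := by
    intro v hv
    have hcn : ∀ n : ℕ, ‖(((n : ℝ) + 1) * (2 / R) : ℝ)‖ = ((n : ℝ) + 1) * (2 / R) := fun n => by
      rw [Real.norm_eq_abs, abs_of_nonneg (by positivity)]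
    refine aestronglyMeasurable_of_tendsto_ae (u := atTop)
      (f := fun (n : ℕ) θ => ((((n : ℝ) + 1) * (2 / R) : ℝ) : ℂ) •
        (deriv (circleMap 0 ρ) θ • W (circleMap 0 ρ θ)
          (x₀ + ((((n : ℝ) + 1) * (2 / R) : ℝ) : ℂ)⁻¹ • v) -
        deriv (circleMap 0 ρ) θ • W (circleMap 0 ρ θ) x₀)) (fun n => ?_) (MeasureTheory.ae_of_all _ fun θ => ?_)
    · refine Continuous.aestronglyMeasurable
        (Continuous.fun_const_smul (Continuous.sub (hcont _ ?_) (hcont _ hx₀)) _)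
      rw [mem_ball_iff_norm, add_sub_cancel_left, norm_smul, norm_inv, Complex.norm_real, hcn]
      calc (((n : ℝ) + 1) * (2 / R))⁻¹ * ‖v‖ ≤ (1 * (2 / R))⁻¹ * 1 := by
            gcongr
            linarith [n.cast_nonneg (α := ℝ)]
        _ = R / 2 := by rw [one_mul, mul_one, inv_div]
        _ < R := by linarith
    · refine (hderiv θ x₀ hx₀).lim v ?_
      simp only [Complex.norm_real, hcn]
      exact (tendsto_atTop_add_const_right _ _ tendsto_natCast_atTop_atTop).atTop_mul_const
        (by positivity)
  -- On the ball of radius `R/2`, a further ball of radius `2 · (R/4)` still fits inside the domain;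
  -- this gives the bound `C / (R/4)`.
  refine (intervalIntegral.hasFDerivAt_integral_of_dominated_of_fderiv_le (𝕜 := ℂ)
    (s := Metric.ball x₀ (R / 2)) (bound := fun _ => ρ * (C / (R / 4))) (F' := F')
    (Metric.ball_mem_nhds _ (by linarith)) ?_ ?_ ?_ ?_ ?_ ?_).differentiableAt
  · filter_upwards [Metric.ball_mem_nhds x₀ hR] with x hx
    exact (hcont x hx).aestronglyMeasurable
  · exact (hcont x₀ hx₀).intervalIntegrable _ _
  · have e : F' x₀ = fun θ => F' x₀ θ (1, 0) • ContinuousLinearMap.fst ℂ ℂ ℂ +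
        F' x₀ θ (0, 1) • ContinuousLinearMap.snd ℂ ℂ ℂ := by
      ext θ <;> simp
    rw [e]
    exact ((hmeas (1, 0) (by simp [Prod.norm_def])).smul_const _).add
      ((hmeas (0, 1) (by simp [Prod.norm_def])).smul_const _)
  · refine MeasureTheory.ae_of_all _ fun θ _ x hx => ?_
    rw [hF', norm_smul, deriv_circleMap, norm_mul, norm_I, mul_one, norm_circleMap_zero,
      abs_of_nonneg hρ]
    refine mul_le_mul_of_nonneg_left ?_ hρ
    have hsub : Metric.ball x (2 * (R / 4)) ⊆ Metric.ball x₀ R := by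
      refine Metric.ball_subset_ball' ?_
      rw [Metric.mem_ball] at hx
      linarith
    exact norm_fderiv_le_of_bounded (by linarith) (fun y hy => hd _ (hcirc θ) y (hsub hy))
      (fun y hy => hC' θ y (hsub hy))
  · exact continuous_const.intervalIntegrable _ _
  · refine MeasureTheory.ae_of_all _ fun θ _ x hx => hderiv θ x (Metric.ball_subset_ball (by linarith) hx)

/-! ### Laurent expansions -/

/-- `f` has a pole of order at most `M` at `0`, and `c n` is the coefficient of `z ^ (-n)`,
for `0 ≤ n ≤ M`. -/
def HasPolarExpansion (f : ℂ → ℂ) (M : ℕ) (c : ℕ → ℂ) : Prop :=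
  ∃ E : ℂ → ℂ, AnalyticAt ℂ E 0 ∧
    ∀ᶠ z in 𝓝[≠] 0, f z = ∑ n ∈ Finset.range (M + 1), c n * z⁻¹ ^ n + z * E z

/-- Writing `H(z) = H(0) + z · dslope H 0 z` splits off the coefficient of `z^(-M)` and lowers the
pole order by one. -/
lemma exists_hasPolarExpansion (M : ℕ) {f H : ℂ → ℂ} (hH : AnalyticAt ℂ H 0)
    (hf : ∀ᶠ z in 𝓝[≠] 0, f z = z⁻¹ ^ M * H z) : ∃ c, HasPolarExpansion f M c := by
  have hslope : ∀ z : ℂ, H z = H 0 + z * dslope H 0 z := by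
    intro z
    have := sub_smul_dslope H 0 z
    rw [sub_zero, smul_eq_mul] at this
    rw [this]
    ring
  have hE : AnalyticAt ℂ (dslope H 0) 0 := by
    obtain ⟨p, hp⟩ := hH
    exact (hp.has_fpower_series_dslope_fslope).analyticAt
  induction M generalizing f H with
  | zero =>
    refine ⟨fun _ => H 0, dslope H 0, hE, ?_⟩
    filter_upwards [hf] with z hz
    simp [hz, ← hslope z]
  | succ M ih =>
    obtain ⟨c, E, hE', hc⟩ := ih (f := fun z => z⁻¹ ^ M * dslope H 0 z) hE
      (Eventually.of_forall fun _ => rfl) (fun z => by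
        have := sub_smul_dslope (dslope H 0) 0 z
        rw [sub_zero, smul_eq_mul] at this
        rw [this]
        ring) (by
        obtain ⟨p, hp⟩ := hE
        exact (hp.has_fpower_series_dslope_fslope).analyticAt)
    refine ⟨fun n => if n = M + 1 then H 0 else c n, E, hE', ?_⟩
    filter_upwards [hf, hc, self_mem_nhdsWithin] with z hz hcz h0
    rw [Finset.sum_range_succ, if_pos rfl, hz, hslope z, mul_add, pow_succ]
    have h1 : ∑ n ∈ Finset.range (M + 1), (if n = M + 1 then H 0 else c n) * z⁻¹ ^ n =
        ∑ n ∈ Finset.range (M + 1), c n * z⁻¹ ^ n := by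
      refine Finset.sum_congr rfl fun n hn => ?_
      rw [Finset.mem_range] at hn
      rw [if_neg (by omega)]
    have h2 : z⁻¹ ^ M * z⁻¹ * (z * dslope H 0 z) = z⁻¹ ^ M * dslope H 0 z := by
      have : z ≠ 0 := h0
      field_simp
    rw [h1, h2, hcz]
    ring

/-- With `j` the automorphy factor this yields the weight of the Laurent coefficients; with `j =
-1`, their parity. -/
lemma HasPolarExpansion.comp_mul {f : ℂ → ℂ} {M : ℕ} {c : ℕ → ℂ} (h : HasPolarExpansion f M c)
    {j : ℂ} (hj : j ≠ 0) : HasPolarExpansion (fun z => f (j * z)) M fun n => c n * j⁻¹ ^ n := by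
  obtain ⟨E, hE, hf⟩ := h
  refine ⟨fun z => j * E (j * z), ?_, ?_⟩
  · have : AnalyticAt ℂ (fun z : ℂ => j * z) 0 := by fun_prop
    refine analyticAt_const.mul (AnalyticAt.fun_comp ?_ this)
    simpa using hE
  · have ht : Tendsto (fun z : ℂ => j * z) (𝓝[≠] 0) (𝓝[≠] 0) := by
      refine tendsto_nhdsWithin_iff.mpr ⟨?_, ?_⟩
      · have : Tendsto (fun z : ℂ => j * z) (𝓝 0) (𝓝 (j * 0)) :=
          (continuous_const_mul j).tendsto 0
        rw [mul_zero] at this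
        exact this.mono_left nhdsWithin_le_nhds
      · filter_upwards [self_mem_nhdsWithin] with z hz
        exact mul_ne_zero hj hz
    filter_upwards [ht.eventually hf] with z hz
    rw [hz]
    congr 1
    · refine Finset.sum_congr rfl fun n _ => ?_
      rw [mul_inv, mul_pow]
      ring
    · ring

lemma circleIntegral_zpow_mul_polar {r : ℝ} (hr : 0 < r) {M n : ℕ} (hn : n ≤ M) (c : ℕ → ℂ) :
    (∮ z in C(0, r), z ^ ((n : ℤ) - 1) * ∑ i ∈ Finset.range (M + 1), c i * z⁻¹ ^ i) =
      2 * π * I * c n := by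
  have h0 : (0 : ℂ) ∉ Metric.sphere (0 : ℂ) |r| := by
    simp [abs_of_pos hr, hr.ne]
  have hint : ∀ i : ℕ, CircleIntegrable (fun z : ℂ => c i * (z - 0) ^ ((n : ℤ) - 1 - i)) 0 r := by
    intro i
    have : CircleIntegrable (fun z : ℂ => (z - 0) ^ ((n : ℤ) - 1 - i)) 0 r :=
      circleIntegrable_sub_zpow_iff.mpr (Or.inr (Or.inr h0))
    exact this.const_mul _
  have e : (∮ z in C(0, r), z ^ ((n : ℤ) - 1) * ∑ i ∈ Finset.range (M + 1), c i * z⁻¹ ^ i) =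
      ∮ z in C(0, r), ∑ i ∈ Finset.range (M + 1), c i * (z - 0) ^ ((n : ℤ) - 1 - i) := by
    refine circleIntegral.integral_congr hr.le fun z hz => ?_
    have hz0 : z ≠ 0 := by
      rintro rfl
      exact h0 (by simpa [abs_of_pos hr] using hz)
    simp only [Finset.mul_sum]
    refine Finset.sum_congr rfl fun i _ => ?_
    rw [sub_zero, zpow_sub₀ hz0 _ (i : ℤ), zpow_natCast, inv_pow]
    ring
  rw [e, circleIntegral.integral_fun_sum fun i _ => hint i]
  rw [Finset.sum_eq_single n]
  · have : ((n : ℤ) - 1 - n) = -1 := by ring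
    simp only [this, zpow_neg_one]
    rw [circleIntegral.integral_const_mul, circleIntegral.integral_sub_center_inv _ hr.ne']
    ring
  · intro i _ hi
    rw [circleIntegral.integral_const_mul, circleIntegral.integral_sub_zpow_of_ne (by omega),
      mul_zero]
  · intro h
    exact absurd (Finset.mem_range.mpr (by omega)) h

/-- The remainder contributes `z^n E(z)`, whose integral vanishes by Cauchy. The integral is thus
constant for small radii, which evaluates the `limUnder` in `laurentCoeff`. -/
lemma HasPolarExpansion.eventually_circleIntegral {f : ℂ → ℂ} {M : ℕ} {c : ℕ → ℂ}
    (h : HasPolarExpansion f M c) {n : ℕ} (hn : n ≤ M) :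
    ∀ᶠ r : ℝ in 𝓝[>] 0, (∮ z in C(0, r), z ^ ((n : ℤ) - 1) * f z) = 2 * π * I * c n := by
  obtain ⟨E, hE, hf⟩ := h
  have hE' := hE.eventually_analyticAt
  rw [eventually_nhdsWithin_iff] at hf
  obtain ⟨ε, hε, hball⟩ := Metric.eventually_nhds_iff_ball.mp (hf.and hE')
  filter_upwards [Ioo_mem_nhdsGT hε] with r hr
  have hsub : Metric.closedBall (0 : ℂ) r ⊆ Metric.ball 0 ε :=
    Metric.closedBall_subset_ball hr.2
  have hne : ∀ z ∈ Metric.sphere (0 : ℂ) r, z ≠ 0 := by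
    rintro z hz rfl
    simp at hz
    linarith [hr.1]
  have hEd : DifferentiableOn ℂ (fun z => z ^ n * E z) (Metric.closedBall 0 r) := by
    intro z hz
    exact ((differentiableAt_pow (𝕜 := ℂ) n).mul
      (hball z (hsub hz)).2.differentiableAt).differentiableWithinAt
  have e : (∮ z in C(0, r), z ^ ((n : ℤ) - 1) * f z) =
      ∮ z in C(0, r), (z ^ ((n : ℤ) - 1) * ∑ i ∈ Finset.range (M + 1), c i * z⁻¹ ^ i) +
        z ^ n * E z := by
    refine circleIntegral.integral_congr hr.1.le fun z hz => ?_
    have hz0 := hne z hz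
    rw [(hball z (hsub (Metric.sphere_subset_closedBall hz))).1 hz0, mul_add, ← mul_assoc,
      ← zpow_add_one₀ hz0, sub_add_cancel, zpow_natCast]
  rw [e, circleIntegral.integral_add, circleIntegral_zpow_mul_polar hr.1 hn,
    Complex.circleIntegral_eq_zero_of_differentiable_on_off_countable hr.1.le
      Set.countable_empty hEd.continuousOn, add_zero]
  · intro z hz
    exact (hEd z (Metric.ball_subset_closedBall hz.1)).differentiableAt
      (Metric.closedBall_mem_nhds_of_mem hz.1)
  · refine ContinuousOn.circleIntegrable hr.1.le ?_
    refine ContinuousOn.mul (fun z hz => (continuousAt_zpow₀ _ _ (Or.inl (hne z hz))).continuousWithinAt)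
      (continuousOn_finsetSum _ fun i _ => continuousOn_const.mul
        ((ContinuousOn.inv₀ continuousOn_id hne).pow i))
  · exact (hEd.continuousOn.mono Metric.sphere_subset_closedBall).circleIntegrable hr.1.le

lemma HasPolarExpansion.laurentCoeff {f : ℂ → ℂ} {M : ℕ} {c : ℕ → ℂ}
    (h : HasPolarExpansion f M c) {n : ℕ} (hn : n ≤ M) : laurentCoeff f (-(n : ℤ)) = c n := by
  refine Tendsto.limUnder_eq ?_
  refine tendsto_const_nhds.congr' ?_
  filter_upwards [h.eventually_circleIntegral hn] with r hr
  have h0 : (2 * π * I : ℂ) ≠ 0 := by simp [Real.pi_ne_zero]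
  rw [neg_neg, hr, inv_mul_cancel_left₀ h0]

lemma HasPolarExpansion.eq_zero_of_odd {f : ℂ → ℂ} {M : ℕ} {c : ℕ → ℂ}
    (h : HasPolarExpansion f M c) (he : ∀ z, f (-z) = f z) {n : ℕ} (hn : n ≤ M) (ho : Odd n) :
    c n = 0 := by
  have h1 := (h.comp_mul (j := -1) (by norm_num)).laurentCoeff hn
  simp only [neg_one_mul, he, h.laurentCoeff hn] at h1
  rw [inv_neg_one, ho.neg_one_pow] at h1
  linear_combination h1 / 2

section

/-! ### The zeros of the theta function -/

variable {t z : ℂ}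

lemma differentiableAt_thetaC_prod {p : ℂ × ℂ} (hp : 0 < p.2.im) :
    DifferentiableAt ℂ (fun p : ℂ × ℂ => thetaC p.1 p.2) p := by
  have h := (hasFDerivAt_jacobiTheta₂ (p.1 + 1 / 2 + p.2 / 2) hp).differentiableAt
  have h2 : DifferentiableAt ℂ (fun p : ℂ × ℂ => (p.1 + 1 / 2 + p.2 / 2, p.2)) p := by fun_prop
  have h3 : DifferentiableAt ℂ
      (fun p : ℂ × ℂ => jacobiTheta₂ (p.1 + 1 / 2 + p.2 / 2) p.2) p :=
    DifferentiableAt.comp (g := fun p : ℂ × ℂ => jacobiTheta₂ p.1 p.2) p h h2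
  unfold thetaC
  fun_prop

lemma differentiable_thetaC (ht : 0 < t.im) : Differentiable ℂ fun z => thetaC z t := fun z =>
  (differentiableAt_thetaC_prod (p := (z, t)) ht).comp z
    (f := fun z : ℂ => (z, t)) (by fun_prop)

/-- Termwise integration over a period keeps only the term `n = 0`. The nonzero value shows that
theta does not vanish identically. -/
lemma integral_jacobiTheta₂ (ht : 0 < t.im) : ∫ x in (0 : ℝ)..1, jacobiTheta₂ x t = 1 := by
  have hcont : ∀ n : ℤ, Continuous fun x : ℝ => jacobiTheta₂_term n x t := fun n => by
    unfold jacobiTheta₂_term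
    fun_prop
  have h := intervalIntegral.hasSum_intervalIntegral_of_summable_norm (a := 0) (b := 1)
    (f := fun n : ℤ => (⟨fun x : ℝ => jacobiTheta₂_term n x t, hcont n⟩ : C(ℝ, ℂ))) (by
      refine Summable.of_nonneg_of_le (fun n => norm_nonneg _) (fun n => ?_)
        (summable_pow_mul_jacobiTheta₂_term_bound 0 ht 0)
      refine (ContinuousMap.norm_le _ (by positivity)).mpr fun x => ?_
      rw [pow_zero, one_mul]
      exact norm_jacobiTheta₂_term_le ht (by simp) le_rfl n)
  have h0 : ∀ n : ℤ, n ≠ 0 → ∫ x in (0 : ℝ)..1, jacobiTheta₂_term n x t = 0 := by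
    intro n hn
    have hc : (2 * π * I * n : ℂ) ≠ 0 := by simp [Real.pi_ne_zero, hn]
    simp only [jacobiTheta₂_term, Complex.exp_add]
    rw [intervalIntegral.integral_mul_const, integral_exp_mul_complex hc]
    have : cexp (2 * π * I * n) = 1 := by
      rw [mul_comm, exp_int_mul_two_pi_mul_I n]
    simp [this]
  have h1 : ∫ x in (0 : ℝ)..1, jacobiTheta₂_term 0 x t = 1 := by
    simp [jacobiTheta₂_term]
  have h2 := hasSum_single (f := fun n : ℤ => ∫ x in (0 : ℝ)..1, jacobiTheta₂_term n x t) 0 h0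
  rw [h1] at h2
  exact h.unique h2

lemma exists_thetaC_ne_zero (ht : 0 < t.im) : ∃ z, thetaC z t ≠ 0 := by
  by_contra! h
  have hJ : ∀ w, jacobiTheta₂ w t = 0 := by
    intro w
    have := h (w - 1 / 2 - t / 2)
    rw [thetaC, show w - 1 / 2 - t / 2 + 1 / 2 + t / 2 = w by ring] at this
    exact (mul_eq_zero.mp this).resolve_left (Complex.exp_ne_zero _)
  have := integral_jacobiTheta₂ ht
  simp [hJ] at this

lemma sin_pi_mul_ne_zero_of_ne_int (hz : ∀ n : ℤ, z ≠ n) : Complex.sin (π * z) ≠ 0 := by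
  rw [Ne, Complex.sin_eq_zero_iff]
  rintro ⟨n, hn⟩
  have hπ : (π : ℂ) ≠ 0 := by simp [Real.pi_ne_zero]
  exact hz n (mul_left_cancel₀ hπ (by rw [hn]; ring))

lemma sin_pi_mul_eq (z : ℂ) :
    Complex.sin (π * z) = cexp (-(π * I * z)) * (zetapow 1 z - 1) / (2 * I) := by
  rw [Complex.sin, zetapow, mul_sub, ← Complex.exp_add]
  have h : ∀ a b : ℂ, (a - b) * I / 2 = (b - a) / (2 * I) := by
    intro a b
    field_simp
    rw [I_sq]
    ring
  rw [h]
  push_cast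
  ring_nf

/-- On the strip `|Im z| < Im t` the quotient of the theta function by its product expansion is
constant. -/
lemma thetaC_eq_mul_sin (ht : 0 < t.im) (hz : |z.im| < t.im) (hz' : ∀ n : ℤ, z ≠ n) :
    thetaC z t * cexp (lambert (fun r => (r : ℂ)⁻¹) t z) / Complex.sin (π * z) =
      deriv (fun z => thetaC z t) 0 * cexp (lambert (fun r => (r : ℂ)⁻¹) t 0) / π := by
  have hπ : (π : ℂ) ≠ 0 := by simp [Real.pi_ne_zero]
  refine eq_of_tendsto_of_periodic ht (g := fun z =>
    thetaC z t * cexp (lambert (fun r => (r : ℂ)⁻¹) t z) / Complex.sin (π * z)) ?_ ?_ ?_ ?_ hz hz'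
  · intro w hw hw'
    have h1 := (differentiable_thetaC ht) w
    have h2 := hasGrowth_inv.differentiableAt_lambert ht hw
    have h3 := sin_pi_mul_ne_zero_of_ne_int hw'
    fun_prop (disch := assumption)
  · intro w _
    rw [thetaC_add_one, lambert_add_one, mul_add, mul_one, Complex.sin_add_pi, neg_mul, neg_div_neg_eq]
  -- Under `w ↦ w + t` the exponential of the Lambert series gains `(1 - qζ)/(1 - ζ⁻¹)`, which
  -- compensates the multiplier of theta and the quotient of the two sines.
  · intro w h1 h2
    have e1 := exp_powSum_inv (z := -w) (by simpa using h2)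
    have e2 := exp_powSum_inv (z := w + t) (by simp; linarith)
    have n1 : 1 - zetapow 1 (-w) ≠ 0 := by
      exact_mod_cast one_sub_zetapow_ne_zero (t := -w) (by simpa using h2) one_ne_zero
    have n2 : 1 - zetapow 1 (w + t) ≠ 0 := by
      exact_mod_cast one_sub_zetapow_ne_zero (t := w + t) (by simp; linarith) one_ne_zero
    have n3 : zetapow 1 w - 1 ≠ 0 := by
      intro h
      apply n1
      rw [zetapow_neg_right, sub_eq_zero.mp h, inv_one, sub_self]
    rw [thetaC_add_self, hasGrowth_inv.lambert_add_self one_ne_zero h1 h2,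
      Complex.exp_sub (_ + _), Complex.exp_add (lambert _ _ _), e1, e2, sin_pi_mul_eq, sin_pi_mul_eq]
    have e3 : 1 - zetapow 1 (-w) = (zetapow 1 w - 1) * zetapow 1 (-w) := by
      rw [zetapow_neg_right]
      have := zetapow_ne_zero 1 w
      field_simp
    have e4 : cexp (-π * I * t - 2 * π * I * w) =
        cexp (-(π * I * (w + t))) * cexp (-(π * I * w)) := by
      rw [← Complex.exp_add]
      ring_nf
    have e5 : zetapow 1 (-w) = cexp (-(π * I * w)) * cexp (-(π * I * w)) := by
      rw [← Complex.exp_add, zetapow]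
      push_cast
      ring_nf
    rw [e3, e4, e5]
    have n4 := Complex.exp_ne_zero (-(π * I * (w + t)))
    have n5 := Complex.exp_ne_zero (-(π * I * w))
    have n6 : zetapow 1 (w + t) - 1 ≠ 0 := by
      rw [← neg_ne_zero, neg_sub]
      exact n2
    field_simp
    ring
  -- Theta and sine both vanish at `0`, so the limit is the ratio of their derivatives, up to the
  -- exponential factor.
  · have h1 : Tendsto (fun z => thetaC z t / z) (𝓝[≠] 0) (𝓝 (deriv (fun z => thetaC z t) 0)) := by
      have := hasDerivAt_iff_tendsto_slope.mp ((differentiable_thetaC ht) 0).hasDerivAt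
      refine this.congr fun w => ?_
      rw [slope_def_field, thetaC_zero, sub_zero, sub_zero]
    have h2 : Tendsto (fun z : ℂ => Complex.sin (π * z) / z) (𝓝[≠] 0) (𝓝 π) := by
      have hd : HasDerivAt (fun z : ℂ => Complex.sin (π * z)) (Complex.cos (π * 0) * (π * 1)) 0 :=
        ((hasDerivAt_id (0 : ℂ)).const_mul (π : ℂ)).csin
      rw [mul_zero, Complex.cos_zero, one_mul, mul_one] at hd
      refine (hasDerivAt_iff_tendsto_slope.mp hd).congr fun w => ?_
      rw [slope_def_field, mul_zero, Complex.sin_zero, sub_zero, sub_zero]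
    have h3 : Tendsto (fun z => cexp (lambert (fun r => (r : ℂ)⁻¹) t z)) (𝓝[≠] 0)
        (𝓝 (cexp (lambert (fun r => (r : ℂ)⁻¹) t 0))) :=
      ((hasGrowth_inv.differentiableAt_lambert ht (by simpa using ht)).continuousAt.cexp.tendsto).mono_left
        nhdsWithin_le_nhds
    refine ((h1.mul h3).div h2 hπ).congr' ?_
    filter_upwards [self_mem_nhdsWithin] with w hw
    have : w ≠ 0 := hw
    simp only [Pi.div_apply]
    rcases eq_or_ne (Complex.sin (π * w)) 0 with h | h
    · simp [h]
    · field_simp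

/-- Otherwise the constant in `thetaC_eq_mul_sin` is zero, theta vanishes on an open strip, and by
the identity theorem it vanishes everywhere. -/
lemma deriv_thetaC_ne_zero (ht : 0 < t.im) : deriv (fun z => thetaC z t) 0 ≠ 0 := by
  intro h
  obtain ⟨z₀, hz₀⟩ := exists_thetaC_ne_zero ht
  have hA : AnalyticOnNhd ℂ (fun z => thetaC z t) Set.univ := fun z _ =>
    (differentiable_thetaC ht).analyticAt z
  have he : (fun z => thetaC z t) =ᶠ[𝓝 (t / 2)] 0 := by
    have ho : IsOpen {z : ℂ | 0 < z.im ∧ z.im < t.im} :=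
      (isOpen_lt continuous_const Complex.continuous_im).inter
        (isOpen_lt Complex.continuous_im continuous_const)
    filter_upwards [ho.mem_nhds (show t / 2 ∈ _ by simpa using ht)] with w hw
    have hw' : ∀ n : ℤ, w ≠ n := by
      rintro n rfl
      simpa using hw.1
    have := thetaC_eq_mul_sin ht (by rw [abs_of_pos hw.1]; exact hw.2) hw'
    rw [h, zero_mul, zero_div, div_eq_zero_iff] at this
    simpa [sin_pi_mul_ne_zero_of_ne_int hw', Complex.exp_ne_zero] using this
  have := hA.eq_of_eventuallyEq (analyticOnNhd_const (v := (0 : ℂ))) he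
  exact hz₀ (congrFun this z₀)

/-- The zeros of the theta function are the points of the lattice. -/
theorem thetaC_ne_zero (ht : 0 < t.im) (hz : ∀ k l : ℤ, z ≠ k * t + l) : thetaC z t ≠ 0 := by
  -- Subtracting `k * t` brings the point into `0 ≤ Im w < Im t`, where the constant of
  -- `thetaC_eq_mul_sin` is known to be nonzero.
  set k := ⌊z.im / t.im⌋ with hk
  set w := z - k * t with hw
  have hw' : ∀ n : ℤ, w ≠ n := fun n hn => hz k n (by rw [← hn, hw]; ring)
  have h1 : 0 ≤ w.im := by
    have := (le_div_iff₀ ht).mp (Int.floor_le (z.im / t.im))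
    simp only [hw, Complex.sub_im, Complex.mul_im, Complex.intCast_re, Complex.intCast_im, zero_mul,
      add_zero]
    linarith
  have h2 : w.im < t.im := by
    have := (div_lt_iff₀ ht).mp (Int.lt_floor_add_one (z.im / t.im))
    simp only [hw, Complex.sub_im, Complex.mul_im, Complex.intCast_re, Complex.intCast_im, zero_mul,
      add_zero]
    linarith
  have hθ : thetaC w t ≠ 0 := by
    intro h
    have := thetaC_eq_mul_sin ht (by rw [abs_of_nonneg h1]; exact h2) hw'
    rw [h, zero_mul, zero_div, eq_comm, div_eq_zero_iff] at this
    simp [Complex.exp_ne_zero, deriv_thetaC_ne_zero ht, Real.pi_ne_zero] at this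
  have : z = w + k * t := by rw [hw]; ring
  rw [this, thetaC_add_int_mul]
  exact mul_ne_zero (mul_ne_zero (zpow_ne_zero _ (by norm_num)) (Complex.exp_ne_zero _)) hθ

end

section

/-! ### The decomposition into finite and polar part -/

variable {t z : ℂ}

lemma differentiableAt_thetaNum_prod (a b : ℤ) {p : ℂ × ℂ} (hp : 0 < p.2.im) :
    DifferentiableAt ℂ (fun p : ℂ × ℂ => thetaNum a b p.1 p.2) p := by
  have h2 : DifferentiableAt ℂ (fun p : ℂ × ℂ => (p.1 + (a * p.2 + b) / 2, p.2)) p := by fun_prop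
  have h3 : DifferentiableAt ℂ (fun p : ℂ × ℂ => thetaC (p.1 + (a * p.2 + b) / 2) p.2) p :=
    DifferentiableAt.comp (g := fun p : ℂ × ℂ => thetaC p.1 p.2) p
      (differentiableAt_thetaC_prod hp) h2
  unfold thetaNum
  fun_prop

lemma differentiableAt_thetaQuot_prod (a b : ℤ) {p : ℂ × ℂ} (hp : 0 < p.2.im)
    (hz : ∀ k l : ℤ, p.1 ≠ k * p.2 + l) :
    DifferentiableAt ℂ (fun p : ℂ × ℂ => thetaQuot a b p.1 p.2) p := by
  have h1 := differentiableAt_thetaNum_prod a b hp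
  have h2 := differentiableAt_thetaC_prod hp
  have h3 := thetaC_ne_zero hp hz
  unfold thetaQuot
  fun_prop (disch := assumption)

lemma differentiable_thetaNum (a b : ℤ) (ht : 0 < t.im) :
    Differentiable ℂ fun z => thetaNum a b z t := fun z =>
  DifferentiableAt.comp (g := fun p : ℂ × ℂ => thetaNum a b p.1 p.2) z
    (f := fun z : ℂ => (z, t)) (differentiableAt_thetaNum_prod (p := (z, t)) a b ht) (by fun_prop)

lemma differentiableAt_thetaQuot (a b : ℤ) (ht : 0 < t.im) (hz : ∀ k l : ℤ, z ≠ k * t + l) :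
    DifferentiableAt ℂ (fun z => thetaQuot a b z t) z :=
  DifferentiableAt.comp (g := fun p : ℂ × ℂ => thetaQuot a b p.1 p.2) z
    (f := fun z : ℂ => (z, t)) (differentiableAt_thetaQuot_prod (p := (z, t)) a b ht hz)
    (by fun_prop)

lemma ne_lattice_of_ne_int (hz : |z.im| < t.im) (hz' : ∀ n : ℤ, z ≠ n) (k l : ℤ) :
    z ≠ k * t + l := by
  rintro rfl
  have h0 : 0 < t.im := (abs_nonneg _).trans_lt hz
  simp only [Complex.add_im, Complex.mul_im, Complex.intCast_re, Complex.intCast_im, zero_mul,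
    add_zero, abs_mul, abs_of_pos h0] at hz
  have h1 : |(k : ℝ)| < 1 := by
    by_contra! h
    nlinarith
  have h2 : k = 0 := Int.abs_lt_one_iff.mp (by exact_mod_cast h1)
  exact hz' l (by simp [h2])

lemma dslope_thetaC_zero_ne_zero (ht : 0 < t.im) : dslope (fun z => thetaC z t) 0 0 ≠ 0 := by
  rw [dslope_same]
  exact deriv_thetaC_ne_zero ht

lemma analyticAt_dslope_thetaC (ht : 0 < t.im) :
    AnalyticAt ℂ (dslope (fun z => thetaC z t) 0) 0 := by
  obtain ⟨p, hp⟩ := (differentiable_thetaC ht).analyticAt 0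
  exact (hp.has_fpower_series_dslope_fslope).analyticAt

lemma thetaC_eq_mul_dslope (z t : ℂ) : thetaC z t = z * dslope (fun z => thetaC z t) 0 z := by
  have := sub_smul_dslope (fun z => thetaC z t) 0 z
  simpa [thetaC_zero] using this.symm

lemma exists_polarExpansion_thetaQuot (m : ℕ) (a b : ℤ) (ht : 0 < t.im) :
    ∃ c, HasPolarExpansion (fun z => thetaQuot a b z t ^ m) m c := by
  refine exists_hasPolarExpansion m
    (H := fun z => (thetaNum a b z t / dslope (fun z => thetaC z t) 0 z) ^ m) ?_ ?_
  · exact ((differentiable_thetaNum a b ht).analyticAt 0).div (analyticAt_dslope_thetaC ht)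
      (dslope_thetaC_zero_ne_zero ht) |>.pow m
  · refine Eventually.of_forall fun z => ?_
    rw [← mul_pow, thetaQuot, thetaC_eq_mul_dslope z t]
    congr 1
    rw [div_mul_eq_div_div_swap, div_eq_inv_mul]

/-- The coefficient of `(2 π i z) ^ (-n)` in the Laurent expansion at `0` of a power of a theta
quotient. -/
def quotCoeff (m : ℕ) (a b : ℤ) (n : ℕ) (τ : ℍ) : ℂ :=
  (2 * π * I) ^ n * laurentCoeff (fun z => thetaQuot a b z τ ^ m) (-(n : ℤ))

lemma D_eq_quotCoeff (m n : ℕ) (τ : ℍ) : D m n τ = quotCoeff m 0 1 n τ := by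
  simp only [D, quotCoeff, phi_eq_thetaQuot]

/-- The finite part of a power of a theta quotient. -/
def finitePart (m : ℕ) (a b : ℤ) (τ : ℍ) : ℂ :=
  quotCoeff m a b 0 τ + ∑ j ∈ Finset.Icc 1 (m / 2),
    ((bernoulli (2 * j) : ℚ) : ℂ) / ((2 * j).factorial : ℂ) * quotCoeff m a b (2 * j) τ * eisen j τ

lemma phiF_eq_finitePart (m : ℕ) (τ : ℍ) : phiF m τ = finitePart m 0 1 τ := by
  simp only [phiF, finitePart, D_eq_quotCoeff]

lemma bernoulli_two_mul_ne_zero {j : ℕ} (hj : 1 ≤ j) : ((bernoulli (2 * j) : ℚ) : ℂ) ≠ 0 := by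
  intro h
  have h1 := riemannZeta_two_mul_nat (k := j) (by omega)
  have h2 : riemannZeta (2 * (j : ℂ)) ≠ 0 := riemannZeta_ne_zero_of_one_lt_re (by
    have : (1 : ℝ) ≤ j := by exact_mod_cast hj
    simp
    linarith)
  rw [h, mul_zero, zero_div] at h1
  exact h2 h1

/-- The Lambert series at `0` is twice the divisor sum series. The left side is the constant term of
`polarFun j` at `0`; this is how Eisenstein series enter the finite part. -/
lemma lambert_zero_eq_eisen {j : ℕ} (hj : 1 ≤ j) (τ : ℍ) :
    -(((bernoulli (2 * j) : ℚ) : ℂ) / (2 * j)) + lambert (fun r => (r : ℂ) ^ (2 * j - 1)) τ 0 =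
      -(((bernoulli (2 * j) : ℚ) : ℂ) / (2 * j)) * eisen j τ := by
  have hB := bernoulli_two_mul_ne_zero hj
  have hj0 : (j : ℂ) ≠ 0 := by exact_mod_cast (by omega : j ≠ 0)
  have h := tsum_pow_div_one_sub_eq_tsum_sigma (norm_cexp_lt_one τ.im_pos) (2 * j - 1)
  have e1 : ∑' r : ℕ+, ((r : ℕ) : ℂ) ^ (2 * j - 1) *
      (zetapow ((r : ℕ) : ℤ) τ / (1 - zetapow ((r : ℕ) : ℤ) τ)) =
      ∑' l : ℕ+, (ArithmeticFunction.sigma (2 * j - 1) (l : ℕ) : ℂ) * qpow ((l : ℕ) : ℝ) τ := by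
    calc _ = ∑' n : ℕ+, ((n : ℕ) : ℂ) ^ (2 * j - 1) * cexp (2 * π * I * τ) ^ (n : ℕ) /
          (1 - cexp (2 * π * I * τ) ^ (n : ℕ)) := tsum_congr fun n => by
            rw [zetapow_natCast, mul_div_assoc]
      _ = _ := h
      _ = _ := tsum_congr fun n => by
            have := qpow_intCast (n : ℕ) τ
            rw [Int.cast_natCast] at this
            rw [this, zetapow_natCast]
  rw [(hasGrowth_pow (2 * j - 1)).lambert_zero (by omega) τ.im_pos, e1, eisen]
  field_simp
  ring

lemma sum_range_eq_sum_even {c : ℕ → ℂ} {p : ℕ} (hc : ∀ n ≤ 2 * p, Odd n → c n = 0) (x : ℂ) :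
    ∑ n ∈ Finset.range (2 * p + 1), c n * x ^ n =
      c 0 + ∑ j ∈ Finset.Icc 1 p, c (2 * j) * x ^ (2 * j) := by
  induction p with
  | zero => simp
  | succ p ih =>
    rw [show 2 * (p + 1) + 1 = 2 * p + 1 + 1 + 1 by ring, Finset.sum_range_succ,
      Finset.sum_range_succ, ih fun n hn => hc n (by omega),
      hc (2 * p + 1) (by omega) ⟨p, rfl⟩, Finset.sum_Icc_succ_top (by omega),
      show 2 * p + 1 + 1 = 2 * (p + 1) by ring]
    ring

/-- The continuation of `∑_{r ≠ 0} r ^ (2j-1) / (1 - q ^ r) ζ ^ r` to the strip `|Im z| < Im t`. -/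
def polarFun (j : ℕ) (t z : ℂ) : ℂ :=
  poleSum (2 * j - 1) z + lambert (fun r => (r : ℂ) ^ (2 * j - 1)) t z

lemma odd_two_mul_sub_one {j : ℕ} (hj : 1 ≤ j) : Odd (2 * j - 1) := ⟨j - 1, by omega⟩

lemma polarFun_eq_tsum {j : ℕ} (hj : 1 ≤ j) {τ : ℍ} (h1 : 0 < z.im) (h2 : z.im < τ.im) :
    polarFun j τ z = ∑' r, polarTerm j z τ r := by
  rw [(hasSum_polarTerm hj h1 h2).tsum_eq, polarFun, poleSum_eq_powSum (odd_two_mul_sub_one hj) h1]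

/-- `poleSum` is even and has a Fourier series in the upper half-plane; its values at `z` and `z +
t` are exactly the two power series by which the Lambert series fails to be periodic. -/
lemma polarFun_add_self {j : ℕ} (hj : 1 ≤ j) (h1 : -t.im < z.im) (h2 : z.im < 0) :
    polarFun j t (z + t) = polarFun j t z := by
  have ho := odd_two_mul_sub_one hj
  rw [polarFun, polarFun, (hasGrowth_pow (2 * j - 1)).lambert_add_self ho.pos.ne' h1 h2,
    ← poleSum_neg ho z, poleSum_eq_powSum ho (z := z + t) (by simp; linarith),
    poleSum_eq_powSum ho (z := -z) (by simpa using h2)]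
  ring

/-- The difference of the quotient power and the polar sum has both periods and, by evenness, no
pole left at `0`, so it is constant; its limit at `0` is the finite part. -/
theorem thetaQuot_pow_eq (p : ℕ) (a b : ℤ) {τ : ℍ} (hz : |z.im| < τ.im) (hz' : ∀ n : ℤ, z ≠ n) :
    thetaQuot a b z τ ^ (2 * p) = finitePart (2 * p) a b τ +
      ∑ j ∈ Finset.Icc 1 p, quotCoeff (2 * p) a b (2 * j) τ / ((2 * j - 1).factorial : ℂ) *
        polarFun j τ z := by
  have ht : 0 < (τ : ℂ).im := τ.im_pos
  have hI : (2 * π * I : ℂ) ≠ 0 := by simp [Real.pi_ne_zero]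
  set d : ℕ → ℂ := fun j => quotCoeff (2 * p) a b (2 * j) τ / ((2 * j - 1).factorial : ℂ) with hd
  suffices h : thetaQuot a b z τ ^ (2 * p) - ∑ j ∈ Finset.Icc 1 p, d j * polarFun j τ z =
      finitePart (2 * p) a b τ by
    rw [← h]
    ring
  obtain ⟨c, hc⟩ := exists_polarExpansion_thetaQuot (2 * p) a b ht
  have hodd : ∀ n ≤ 2 * p, Odd n → c n = 0 := fun n hn ho =>
    hc.eq_zero_of_odd (fun w => thetaQuot_neg_pow a b w τ p) hn ho
  have hcoeff : ∀ n ≤ 2 * p, quotCoeff (2 * p) a b n τ = (2 * π * I) ^ n * c n := fun n hn => by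
    rw [quotCoeff, hc.laurentCoeff hn]
  have hfac : ∀ j : ℕ, ((2 * j - 1).factorial : ℂ) ≠ 0 := fun j => by
    exact_mod_cast Nat.factorial_ne_zero _
  refine eq_of_tendsto_of_periodic ht (g := fun z => thetaQuot a b z τ ^ (2 * p) -
    ∑ j ∈ Finset.Icc 1 p, d j * polarFun j τ z) ?_ ?_ ?_ ?_ hz hz'
  · intro w hw hw'
    refine ((differentiableAt_thetaQuot a b ht (ne_lattice_of_ne_int hw hw')).pow _).sub
      (DifferentiableAt.fun_sum fun j hj => ?_)
    rw [Finset.mem_Icc] at hj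
    exact ((differentiableAt_poleSum (odd_two_mul_sub_one hj.1).pos hw').add
      ((hasGrowth_pow _).differentiableAt_lambert ht hw)).const_mul _
  · intro w _
    simp only [thetaQuot_pow_add_one, polarFun, poleSum_add_one, lambert_add_one]
  · intro w h1 h2
    simp only [thetaQuot_pow_add_self]
    congr 1
    refine Finset.sum_congr rfl fun j hj => ?_
    rw [Finset.mem_Icc] at hj
    rw [polarFun_add_self hj.1 h1 h2]
  · have hlim : finitePart (2 * p) a b τ = c 0 + 0 - ∑ j ∈ Finset.Icc 1 p, d j *
        (-(((bernoulli (2 * j) : ℚ) : ℂ) / (2 * j)) +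
          lambert (fun r => (r : ℂ) ^ (2 * j - 1)) τ 0) := by
      rw [finitePart, hcoeff 0 (by omega), pow_zero, one_mul, add_zero, sub_eq_add_neg,
        ← Finset.sum_neg_distrib, Nat.mul_div_cancel_left p two_pos]
      congr 1
      refine Finset.sum_congr rfl fun j hj => ?_
      rw [Finset.mem_Icc] at hj
      have hj0 : (j : ℂ) ≠ 0 := by exact_mod_cast (by omega : j ≠ 0)
      have h1 : (((2 * j).factorial : ℕ) : ℂ) = (2 * j) * ((2 * j - 1).factorial : ℂ) := by
        rw [← Nat.mul_factorial_pred (by omega : 2 * j ≠ 0)]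
        push_cast
        ring
      have h2 := hfac j
      rw [lambert_zero_eq_eisen hj.1, h1, hd]
      field_simp
    obtain ⟨E, hE, hf⟩ := hc
    have hzE : Tendsto (fun w => w * E w) (𝓝[≠] 0) (𝓝 0) := by
      have : Tendsto (fun w => w * E w) (𝓝[≠] 0) (𝓝 (0 * E 0)) :=
        (continuousAt_id.mul hE.continuousAt).tendsto.mono_left nhdsWithin_le_nhds
      rwa [zero_mul] at this
    have hL : ∀ j : ℕ, Tendsto (lambert (fun r => (r : ℂ) ^ (2 * j - 1)) τ) (𝓝[≠] 0)
        (𝓝 (lambert (fun r => (r : ℂ) ^ (2 * j - 1)) τ 0)) := fun j =>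
      ((hasGrowth_pow _).differentiableAt_lambert ht (by simpa using ht)).continuousAt.tendsto.mono_left
        nhdsWithin_le_nhds
    rw [hlim]
    refine ((tendsto_const_nhds.add hzE).sub (tendsto_finsetSum _ fun j hj =>
      ((tendsto_poleSum_sub (Finset.mem_Icc.mp hj).1).add (hL j)).const_mul (d j))).congr' ?_
    filter_upwards [hf, self_mem_nhdsWithin] with w hw hw0
    have hw0' : w ≠ 0 := hw0
    rw [hw, sum_range_eq_sum_even hodd]
    have e : ∑ j ∈ Finset.Icc 1 p, c (2 * j) * w⁻¹ ^ (2 * j) =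
        ∑ j ∈ Finset.Icc 1 p, d j * (((2 * j - 1).factorial : ℂ) / (2 * π * I * w) ^ (2 * j)) := by
      refine Finset.sum_congr rfl fun j hj => ?_
      rw [Finset.mem_Icc] at hj
      have := hfac j
      simp only [hd]
      rw [hcoeff (2 * j) (by omega), mul_pow _ w, inv_pow]
      have h3 := pow_ne_zero (2 * j) hI
      have h4 := pow_ne_zero (2 * j) hw0'
      field_simp
    rw [e]
    simp only [polarFun, mul_add, mul_sub, Finset.sum_add_distrib, Finset.sum_sub_distrib]
    ring

end

/-! ### The Laurent coefficients as functions of `τ` -/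

lemma HasPolarExpansion.const_mul {f : ℂ → ℂ} {M : ℕ} {c : ℕ → ℂ} (h : HasPolarExpansion f M c)
    (k : ℂ) : HasPolarExpansion (fun z => k * f z) M fun n => k * c n := by
  obtain ⟨E, hE, hf⟩ := h
  refine ⟨fun z => k * E z, analyticAt_const.mul hE, ?_⟩
  filter_upwards [hf] with z hz
  rw [hz, mul_add, Finset.mul_sum]
  congr 1
  · exact Finset.sum_congr rfl fun n _ => by ring
  · ring

lemma quotCoeff_smul (m : ℕ) (a b : ℤ) {n : ℕ} (hn : n ≤ m) (γ : SL(2, ℤ)) (τ : ℍ) :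
    quotCoeff m a b n (γ • τ) = (γ 1 0 * τ + γ 1 1 : ℂ)⁻¹ ^ n *
      quotCoeff m (a * γ 0 0 + b * γ 1 0) (a * γ 0 1 + b * γ 1 1) n τ := by
  have hj := cocycle_ne_zero γ τ
  obtain ⟨c, hc⟩ := exists_polarExpansion_thetaQuot m (a * γ 0 0 + b * γ 1 0)
    (a * γ 0 1 + b * γ 1 1) τ.im_pos
  have e : (fun z => thetaQuot a b z (γ • τ : ℍ) ^ m) = fun z =>
      thetaQuot (a * γ 0 0 + b * γ 1 0) (a * γ 0 1 + b * γ 1 1) ((γ 1 0 * τ + γ 1 1) * z) τ ^ m := by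
    funext z
    rw [← thetaQuot_smul, mul_div_cancel_left₀ _ hj]
  rw [quotCoeff, e, quotCoeff, (hc.comp_mul hj).laurentCoeff hn, hc.laurentCoeff hn]
  ring

lemma quotCoeff_shift (p : ℕ) (a b k l : ℤ) {n : ℕ} (hn : n ≤ 2 * p) (τ : ℍ) :
    quotCoeff (2 * p) (a + 2 * k) (b + 2 * l) n τ =
      (-1) ^ ((a * l - k * b) * p) * quotCoeff (2 * p) a b n τ := by
  obtain ⟨c, hc⟩ := exists_polarExpansion_thetaQuot (2 * p) a b τ.im_pos
  simp only [quotCoeff, thetaQuot_shift_pow]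
  rw [(hc.const_mul _).laurentCoeff hn, hc.laurentCoeff hn]
  ring

lemma not_int_of_norm_lt_one {z : ℂ} (h0 : z ≠ 0) (h1 : ‖z‖ < 1) (n : ℤ) : z ≠ n := by
  rintro rfl
  rw [Complex.norm_intCast] at h1
  have : n = 0 := Int.abs_lt_one_iff.mp (by exact_mod_cast h1)
  exact h0 (by simp [this])

/-- The bounds on `ρ` exclude nonzero lattice points from the closed disc, so the small circle can
be enlarged to a radius that works for all nearby `τ`. -/
lemma quotCoeff_eq_circleIntegral (m : ℕ) (a b : ℤ) {n : ℕ} (hn : n ≤ m) {τ : ℍ} {ρ : ℝ}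
    (h0 : 0 < ρ) (h1 : ρ < 1) (h2 : ρ < τ.im) :
    quotCoeff m a b n τ = (2 * π * I) ^ n * ((2 * π * I)⁻¹ *
      ∮ z in C(0, ρ), z ^ ((n : ℤ) - 1) * thetaQuot a b z τ ^ m) := by
  obtain ⟨c, hc⟩ := exists_polarExpansion_thetaQuot m a b τ.im_pos
  obtain ⟨r, hr, hr'⟩ := ((hc.eventually_circleIntegral hn).and (Ioo_mem_nhdsGT h0)).exists
  have hI : (2 * π * I : ℂ) ≠ 0 := by simp [Real.pi_ne_zero]
  have hd : ∀ z ∈ Metric.closedBall (0 : ℂ) ρ \ Metric.ball 0 r,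
      DifferentiableAt ℂ (fun z => z ^ ((n : ℤ) - 1) * thetaQuot a b z τ ^ m) z := by
    intro z hz
    have hn1 : ‖z‖ ≤ ρ := by simpa using hz.1
    have hz0 : z ≠ 0 := by
      rintro rfl
      exact hz.2 (by simpa using hr'.1)
    exact (differentiableAt_zpow.mpr (Or.inl hz0)).mul
      ((differentiableAt_thetaQuot a b τ.im_pos (ne_lattice_of_ne_int
        (((Complex.abs_im_le_norm z).trans hn1).trans_lt h2)
        (not_int_of_norm_lt_one hz0 (hn1.trans_lt h1)))).pow m)
  rw [Complex.circleIntegral_eq_of_differentiable_on_annulus_off_countable hr'.1 hr'.2.le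
    Set.countable_empty (fun z hz => (hd z hz).continuousAt.continuousWithinAt)
    (fun z hz => hd z ⟨Metric.ball_subset_closedBall hz.1.1,
      fun h => hz.1.2 (Metric.ball_subset_closedBall h)⟩), hr, inv_mul_cancel_left₀ hI, quotCoeff,
    hc.laurentCoeff hn]

lemma differentiableAt_thetaQuot_param (a b : ℤ) {ρ R : ℝ} (h0 : 0 < ρ) (h1 : ρ < 1)
    {x₀ : ℂ × ℂ} (h2 : ρ + R < x₀.2.im) {w : ℂ} (hw : w ∈ Metric.sphere (0 : ℂ) ρ) {x : ℂ × ℂ}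
    (hx : x ∈ Metric.closedBall x₀ R) :
    DifferentiableAt ℂ (fun q : ℂ × ℂ => thetaQuot a b q.1 q.2) (w, x.2) := by
  have hn : ‖w‖ = ρ := by simpa using hw
  have hx2 : x₀.2.im - R ≤ x.2.im := by
    have e1 : ‖x.2 - x₀.2‖ ≤ R := by
      rw [Metric.mem_closedBall, dist_eq_norm] at hx
      exact (norm_snd_le (x - x₀)).trans hx
    have e2 := (Complex.abs_im_le_norm _).trans e1
    rw [Complex.sub_im, abs_le] at e2
    linarith
  have hw0 : w ≠ 0 := by
    rintro rfl
    simp at hn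
    linarith
  have h3 : |w.im| < x.2.im := by
    have := Complex.abs_im_le_norm w
    linarith
  exact differentiableAt_thetaQuot_prod a b ((abs_nonneg _).trans_lt h3)
    (ne_lattice_of_ne_int h3 (not_int_of_norm_lt_one hw0 (by rwa [hn])))

lemma mdifferentiable_quotCoeff (m : ℕ) (a b : ℤ) {n : ℕ} (hn : n ≤ m) :
    MDifferentiable 𝓘(ℂ) 𝓘(ℂ) (quotCoeff m a b n) := by
  rw [UpperHalfPlane.mdifferentiable_iff]
  intro t ht
  have ht' : 0 < t.im := ht
  refine DifferentiableAt.differentiableWithinAt ?_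
  obtain ⟨ρ, h0, h1, h2⟩ : ∃ ρ : ℝ, 0 < ρ ∧ ρ < 1 ∧ 2 * ρ < t.im :=
    ⟨min (1 / 2) (t.im / 4), by positivity, by
      have := min_le_left (1 / 2) (t.im / 4); linarith, by
      have := min_le_right (1 / 2) (t.im / 4); linarith⟩
  have hp : ∀ w ∈ Metric.sphere (0 : ℂ) ρ, ∀ x ∈ Metric.closedBall ((0 : ℂ), t) ρ,
      w ≠ 0 ∧ DifferentiableAt ℂ (fun q : ℂ × ℂ => thetaQuot a b q.1 q.2) (w, x.2) := by
    intro w hw x hx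
    refine ⟨?_, differentiableAt_thetaQuot_param a b h0 h1 (by simp; linarith) hw hx⟩
    rintro rfl
    simp at hw
    linarith
  -- The first parameter is a dummy, present only to match `differentiableAt_circleIntegral`.
  have key : DifferentiableAt ℂ (fun x : ℂ × ℂ => ∮ w in C(0, ρ),
      w ^ ((n : ℤ) - 1) * thetaQuot a b w x.2 ^ m) (0, t) := by
    refine differentiableAt_circleIntegral (W := fun w x => w ^ ((n : ℤ) - 1) *
      thetaQuot a b w x.2 ^ m) h0.le h0 ?_ ?_
    · rintro ⟨w, x⟩ ⟨hw, hx⟩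
      obtain ⟨hw0, hd⟩ := hp w hw x hx
      refine ContinuousAt.continuousWithinAt ?_
      have h3 : ContinuousAt (fun p : ℂ × ℂ × ℂ => thetaQuot a b p.1 p.2.2) (w, x) :=
        ContinuousAt.comp (g := fun q : ℂ × ℂ => thetaQuot a b q.1 q.2)
          (f := fun p : ℂ × ℂ × ℂ => (p.1, p.2.2)) hd.continuousAt (by fun_prop)
      exact (continuousAt_fst.zpow₀ _ (Or.inl hw0)).mul (h3.pow m)
    · intro w hw x hx
      have := (hp w hw x (Metric.ball_subset_closedBall hx)).2
      have h3 : DifferentiableAt ℂ (fun x : ℂ × ℂ => thetaQuot a b w x.2) x :=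
        DifferentiableAt.comp (g := fun q : ℂ × ℂ => thetaQuot a b q.1 q.2)
          (f := fun x : ℂ × ℂ => (w, x.2)) x this (by fun_prop)
      exact (h3.pow m).const_mul _
  have h3 : DifferentiableAt ℂ (fun s : ℂ => ∮ w in C(0, ρ),
      w ^ ((n : ℤ) - 1) * thetaQuot a b w s ^ m) t :=
    DifferentiableAt.comp (g := fun x : ℂ × ℂ => ∮ w in C(0, ρ),
      w ^ ((n : ℤ) - 1) * thetaQuot a b w x.2 ^ m) (f := fun s : ℂ => ((0 : ℂ), s)) t key
      (by fun_prop)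
  refine ((h3.const_mul (2 * π * I)⁻¹).const_mul ((2 * π * I) ^ n)).congr_of_eventuallyEq ?_
  have : ∀ᶠ s : ℂ in 𝓝 t, ρ < s.im :=
    Complex.continuous_im.continuousAt.eventually (lt_mem_nhds (by linarith))
  filter_upwards [this] with s hs
  have hs0 : 0 < s.im := h0.trans hs
  have e : ((ofComplex s : ℍ) : ℂ) = s := by rw [ofComplex_apply_of_im_pos hs0]
  rw [Function.comp_apply, quotCoeff_eq_circleIntegral m a b hn h0 h1, e]
  rw [← UpperHalfPlane.coe_im, e]
  exact hs

lemma quotCoeff_congr {m n : ℕ} {a b : ℤ} {τ τ' : ℍ} (h : (τ' : ℂ) = τ + 8) :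
    quotCoeff m a b n τ' = quotCoeff m a b n τ := by
  simp only [quotCoeff, h, thetaQuot_add_eight]

/-! ### Growth at the cusp -/

/-- After completing the square the terms are `exp(πi (n + α)² t + 2πi (n + α) z)` up to a phase,
with `α = (a + 1)/2`. No exponent of `q` is negative, so `Im t = 1` is the worst case. -/
lemma exists_norm_thetaNum_le (a b : ℤ) : ∃ B : ℝ, ∀ z t : ℂ, |z.im| ≤ 1 / 2 → 1 ≤ t.im →
    ‖thetaNum a b z t‖ ≤ B := by
  set α : ℝ := (a + 1) / 2 with hα
  set u : ℤ → ℝ := fun n => rexp (π * |α|) *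
    ((|n| ^ 0 : ℝ) * rexp (-π * (1 * n ^ 2 - 2 * (|α| + 1 / 2) * |n|))) with hu
  have hs : Summable u := (summable_pow_mul_jacobiTheta₂_term_bound _ one_pos 0).mul_left _
  refine ⟨∑' n, u n, fun z t hz ht => ?_⟩
  rw [thetaNum, thetaC, jacobiTheta₂, ← tsum_mul_left, ← tsum_mul_left]
  refine tsum_of_norm_bounded hs.hasSum fun n => ?_
  have e : cexp (π * I * (a / 2) * (a * t / 2 + b / 2) + π * I * a * z) *
      (cexp (π * I * t / 4 + π * I * (z + (a * t + b) / 2 + 1 / 2)) *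
        jacobiTheta₂_term n (z + (a * t + b) / 2 + 1 / 2 + t / 2) t) =
      cexp (((π * (n + α) ^ 2 : ℝ) : ℂ) * t * I + ((2 * π * (n + α) : ℝ) : ℂ) * z * I +
        ((π * (a * b / 4 + b / 2 + 1 / 2 + n * b + n) : ℝ) : ℂ) * I) := by
    rw [jacobiTheta₂_term, ← Complex.exp_add, ← Complex.exp_add, hα]
    push_cast
    ring_nf
  rw [e, Complex.norm_exp]
  simp only [Complex.add_re, Complex.mul_I_re, Complex.im_ofReal_mul, Complex.ofReal_im, neg_zero,
    add_zero, hu, pow_zero, one_mul, ← Real.exp_add, Real.exp_le_exp]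
  have hπ := Real.pi_pos
  have h1 : -((2 * (n + α)) * z.im) ≤ |n + α| := by
    refine (neg_le_abs _).trans ?_
    rw [abs_mul, abs_mul, abs_two]
    nlinarith [abs_nonneg ((n : ℝ) + α)]
  have h2 : -((n + α) ^ 2 * t.im) ≤ -(n + α) ^ 2 := by nlinarith [sq_nonneg ((n : ℝ) + α)]
  have h3 : |(n : ℝ) + α| ≤ |(n : ℝ)| + |α| := abs_add_le _ _
  have h4 : -(n * α) ≤ |(n : ℝ)| * |α| := by
    rw [← abs_mul]
    exact neg_le_abs _
  have h5 : -((n + α) ^ 2 * t.im) - 2 * (n + α) * z.im ≤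
      |α| - (n ^ 2 - 2 * (|α| + 1 / 2) * |(n : ℝ)|) := by nlinarith [sq_nonneg α]
  rw [show ((|n| : ℤ) : ℝ) = |(n : ℝ)| by push_cast; rfl]
  nlinarith

lemma sum_jacobiTheta₂_term_main (z t : ℂ) :
    jacobiTheta₂_term 0 (z + 1 / 2 + t / 2) t + jacobiTheta₂_term (-1) (z + 1 / 2 + t / 2) t =
      1 - cexp (-(2 * π * I * z)) := by
  rw [jacobiTheta₂_term, jacobiTheta₂_term]
  push_cast
  rw [show 2 * π * I * -1 * (z + 1 / 2 + t / 2) + π * I * (-1) ^ 2 * t =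
    -(2 * π * I * z) - π * I by ring, Complex.exp_sub, exp_pi_mul_I]
  simp
  ring

/-- The `n`-th term carries `q^((n² + n)/2)`. The exponent is zero for `n = 0, -1`, which give the
main term, and `n² + n ≥ 2` otherwise. -/
lemma exists_norm_jacobiTheta₂_sub_le : ∃ B : ℝ, ∀ z t : ℂ, |z.im| ≤ 1 / 2 → 1 ≤ t.im →
    ‖jacobiTheta₂ (z + 1 / 2 + t / 2) t - (1 - cexp (-(2 * π * I * z)))‖ ≤
      rexp (-2 * π * (t.im - 1)) * B := by
  set u : ℤ → ℝ := fun n => (|n| ^ 0 : ℝ) * rexp (-π * (1 * n ^ 2 - 2 * 1 * |n|)) with hu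
  have hs : Summable u := summable_pow_mul_jacobiTheta₂_term_bound _ one_pos 0
  refine ⟨∑' n, u n, fun z t hz ht => ?_⟩
  have ht0 : 0 < t.im := by linarith
  have hsum := hasSum_jacobiTheta₂_term (z + 1 / 2 + t / 2) ht0
  have h2 := hsum.sub (hasSum_sum_of_ne_finset_zero (s := {0, -1})
    (f := fun n : ℤ => if n = 0 ∨ n = -1 then jacobiTheta₂_term n (z + 1 / 2 + t / 2) t else 0)
    (by
      intro n hn
      simp only [Finset.mem_insert, Finset.mem_singleton] at hn
      exact if_neg hn))
  have e : ∑ n ∈ ({0, -1} : Finset ℤ), (if n = 0 ∨ n = -1 then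
      jacobiTheta₂_term n (z + 1 / 2 + t / 2) t else 0) = 1 - cexp (-(2 * π * I * z)) := by
    rw [← sum_jacobiTheta₂_term_main z t, Finset.sum_pair (by norm_num)]
    simp
  rw [e] at h2
  rw [← h2.tsum_eq, ← tsum_mul_left]
  refine tsum_of_norm_bounded (hs.mul_left _).hasSum fun n => ?_
  have hπ := Real.pi_pos
  split_ifs with hn
  · rw [sub_self, norm_zero]
    positivity
  · rw [sub_zero, norm_jacobiTheta₂_term]
    simp only [hu, pow_zero, one_mul, ← Real.exp_add, Real.exp_le_exp]
    have hi : (z + 1 / 2 + t / 2).im = z.im + t.im / 2 := by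
      simp
    have hq : (2 : ℝ) ≤ n ^ 2 + n := by
      have : (2 : ℤ) ≤ n ^ 2 + n := by
        rcases (show 1 ≤ n ∨ n ≤ -2 by omega) with h | h <;> nlinarith
      exact_mod_cast this
    have h1 : -(2 * n * z.im) ≤ |(n : ℝ)| := by
      refine (neg_le_abs _).trans ?_
      rw [abs_mul, abs_mul, abs_two]
      nlinarith [abs_nonneg (n : ℝ)]
    have h2 : -(n : ℝ) ≤ |(n : ℝ)| := neg_le_abs _
    have h3 : -((n ^ 2 + n) * t.im) - 2 * n * z.im ≤
        -2 * (t.im - 1) - (n ^ 2 - 2 * 1 * |(n : ℝ)|) := by nlinarith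
    rw [hi, show ((|n| : ℤ) : ℝ) = |(n : ℝ)| by push_cast; rfl]
    nlinarith

/-- The circle of radius `1/2` contains no integer, so `1 - ζ⁻¹` is at least some `δ > 0` there and
dominates the error for large `Im t`. The growth `exp(π Im t / 4)` comes from the factor `q^(1/8)`
of theta in the denominator. -/
lemma exists_norm_thetaQuot_le (a b : ℤ) : ∃ C A : ℝ, 0 ≤ C ∧ 1 ≤ A ∧ ∀ z t : ℂ, ‖z‖ = 1 / 2 →
    A ≤ t.im → ‖thetaQuot a b z t‖ ≤ C * rexp (π * t.im / 4) := by
  obtain ⟨B, hB⟩ := exists_norm_thetaNum_le a b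
  obtain ⟨B', hB'⟩ := exists_norm_jacobiTheta₂_sub_le
  have hcpt : IsCompact (Metric.sphere (0 : ℂ) (1 / 2)) := isCompact_sphere _ _
  obtain ⟨z₀, hz₀, hmin⟩ := hcpt.exists_isMinOn (f := fun z : ℂ => ‖1 - cexp (-(2 * π * I * z))‖)
    (NormedSpace.sphere_nonempty.mpr (by norm_num)) (by fun_prop)
  set δ : ℝ := ‖1 - cexp (-(2 * π * I * z₀))‖ with hδ
  have hδ0 : 0 < δ := by
    rw [hδ, norm_pos_iff, sub_ne_zero]
    intro h
    have hn : ‖z₀‖ = 1 / 2 := by simpa using hz₀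
    obtain ⟨k, hk⟩ := Complex.exp_eq_one_iff.mp h.symm
    have hI : (2 * π * I : ℂ) ≠ 0 := by simp [Real.pi_ne_zero]
    have : z₀ = ((-k : ℤ) : ℂ) := by
      push_cast
      exact mul_left_cancel₀ hI (by linear_combination -hk)
    refine not_int_of_norm_lt_one ?_ (by rw [hn]; norm_num) (-k) this
    rintro rfl
    simp at hn
  have hlim : Tendsto (fun v : ℝ => rexp (-2 * π * (v - 1)) * B') atTop (𝓝 (0 * B')) := by
    refine Tendsto.mul_const _ (Real.tendsto_exp_atBot.comp ?_)
    refine Tendsto.const_mul_atTop_of_neg (by have := Real.pi_pos; linarith)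
      (tendsto_atTop_add_const_right _ _ tendsto_id)
  rw [zero_mul] at hlim
  obtain ⟨A, hA⟩ := eventually_atTop.mp (hlim.eventually (ge_mem_nhds (half_pos hδ0)))
  have hB0 : 0 ≤ B := (norm_nonneg _).trans (hB 0 I (by simp) (by simp))
  refine ⟨B / (rexp (-(π / 2)) * (δ / 2)), max A 1, by positivity, le_max_right _ _,
    fun z t hz ht => ?_⟩
  have ht1 : 1 ≤ t.im := (le_max_right _ _).trans ht
  have hzi : |z.im| ≤ 1 / 2 := hz ▸ Complex.abs_im_le_norm z
  have h1 := (hB' z t hzi ht1).trans (hA t.im ((le_max_left _ _).trans ht))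
  have h2 : δ ≤ ‖1 - cexp (-(2 * π * I * z))‖ := hmin (by simpa using hz)
  have h3 : δ / 2 ≤ ‖jacobiTheta₂ (z + 1 / 2 + t / 2) t‖ := by
    have := norm_sub_norm_le (1 - cexp (-(2 * π * I * z))) (jacobiTheta₂ (z + 1 / 2 + t / 2) t)
    rw [norm_sub_rev _ (jacobiTheta₂ _ _)] at this
    linarith
  have h4 : rexp (-(π / 2)) * rexp (-(π * t.im / 4)) ≤
      ‖cexp (π * I * t / 4 + π * I * (z + 1 / 2))‖ := by
    rw [Complex.norm_exp, ← Real.exp_add, Real.exp_le_exp]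
    have : (π * I * t / 4 + π * I * (z + 1 / 2) : ℂ).re = -(π * t.im / 4) - π * z.im := by
      rw [show (π * I * t / 4 + π * I * (z + 1 / 2) : ℂ) =
        ((π / 4 : ℝ) : ℂ) * t * I + ((π : ℝ) : ℂ) * (z + ((1 / 2 : ℝ) : ℂ)) * I by push_cast; ring]
      simp only [Complex.add_re, Complex.mul_I_re, Complex.im_ofReal_mul, Complex.add_im,
        Complex.ofReal_im]
      ring
    rw [this]
    have := (le_abs_self _).trans hzi
    nlinarith [Real.pi_pos]
  have h5 : rexp (-(π / 2)) * rexp (-(π * t.im / 4)) * (δ / 2) ≤ ‖thetaC z t‖ := by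
    rw [thetaC, norm_mul]
    gcongr
  rw [thetaQuot, norm_div]
  have h6 : 0 < rexp (-(π / 2)) * rexp (-(π * t.im / 4)) * (δ / 2) := by positivity
  calc ‖thetaNum a b z t‖ / ‖thetaC z t‖
      ≤ B / (rexp (-(π / 2)) * rexp (-(π * t.im / 4)) * (δ / 2)) :=
        div_le_div₀ hB0 (hB z t hzi ht1) h6 h5
    _ = _ := by
        rw [Real.exp_neg (π * t.im / 4)]
        field_simp

lemma norm_qpow (x : ℝ) (τ : ℍ) : ‖qpow x τ‖ = rexp (-(2 * π * x * τ.im)) := by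
  rw [qpow, Complex.norm_exp, show (2 * π * I * x * (τ : ℂ)) =
    ((2 * π * x : ℝ) : ℂ) * τ * I by push_cast; ring, Complex.mul_I_re, Complex.im_ofReal_mul,
    UpperHalfPlane.coe_im]

lemma isBoundedAtImInfty_qpow_mul_quotCoeff (m : ℕ) (a b : ℤ) {n : ℕ} (hn : n ≤ m) :
    IsBoundedAtImInfty fun τ => qpow (m : ℝ) τ * quotCoeff m a b n τ := by
  obtain ⟨C, A, hC, hA, h⟩ := exists_norm_thetaQuot_le a b
  rw [isBoundedAtImInfty_iff]
  have hI : (2 * π * I : ℂ) ≠ 0 := by simp [Real.pi_ne_zero]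
  refine ⟨‖(2 * π * I : ℂ) ^ n‖ * (‖(2 * π * I : ℂ)⁻¹‖ *
    (2 * π * (1 / 2) * ((1 / 2) ^ ((n : ℤ) - 1) * C ^ m))), A, fun τ hτ => ?_⟩
  have hv : 1 ≤ τ.im := hA.trans hτ
  rw [quotCoeff_eq_circleIntegral m a b hn (ρ := 1 / 2) (by norm_num) (by norm_num) (by linarith)]
  rw [← mul_assoc, mul_comm (qpow _ _), mul_assoc, norm_mul (_ ^ n), mul_left_comm (qpow _ _),
    norm_mul _⁻¹, ← circleIntegral.integral_const_mul]
  gcongr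
  refine circleIntegral.norm_integral_le_of_norm_le_const (by norm_num) fun z hz => ?_
  have hz' : ‖z‖ = 1 / 2 := by simpa using hz
  have h1 := h z τ hz' hτ
  rw [norm_mul, norm_mul, norm_zpow, hz', norm_pow, norm_qpow, mul_left_comm]
  refine mul_le_mul_of_nonneg_left ?_ (by positivity)
  have hπ := Real.pi_pos
  calc rexp (-(2 * π * m * τ.im)) * ‖thetaQuot a b z τ‖ ^ m
      ≤ rexp (-(2 * π * m * τ.im)) * (C * rexp (π * (τ : ℂ).im / 4)) ^ m := by gcongr
    _ = C ^ m * rexp (-(2 * π * m * τ.im) + m * (π * τ.im / 4)) := by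
        rw [mul_pow, ← Real.exp_nat_mul, Real.exp_add, UpperHalfPlane.coe_im]
        ring
    _ ≤ C ^ m * 1 := by
        gcongr
        rw [Real.exp_le_one_iff]
        have : (0 : ℝ) ≤ m * (π * τ.im) := by positivity
        nlinarith
    _ = C ^ m := mul_one _

/-! ### Weakly holomorphic functions -/

lemma qpow_add (x y : ℝ) (τ : ℍ) : qpow (x + y) τ = qpow x τ * qpow y τ := by
  rw [qpow, qpow, qpow, ← Complex.exp_add]
  push_cast
  ring_nf

lemma isBoundedAtImInfty_qpow (N : ℕ) : IsBoundedAtImInfty fun τ => qpow (N : ℝ) τ := by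
  rw [isBoundedAtImInfty_iff]
  refine ⟨1, 0, fun τ _ => ?_⟩
  rw [norm_qpow, Real.exp_le_one_iff]
  have := Real.pi_pos
  have := τ.im_pos
  have : 0 ≤ 2 * π * N * τ.im := by positivity
  linarith

lemma IsWeaklyHolomorphicAtInfty.add {f g : ℍ → ℂ} (hf : IsWeaklyHolomorphicAtInfty f)
    (hg : IsWeaklyHolomorphicAtInfty g) : IsWeaklyHolomorphicAtInfty fun τ => f τ + g τ := by
  obtain ⟨hf, M, hM⟩ := hf
  obtain ⟨hg, N, hN⟩ := hg
  refine ⟨hf.add hg, M + N, ?_⟩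
  have h := ((isBoundedAtImInfty_qpow N).mul hM).add ((isBoundedAtImInfty_qpow M).mul hN)
  refine (congrArg IsBoundedAtImInfty (funext fun τ => ?_)).mp h
  simp only [Pi.add_apply, Pi.mul_apply]
  push_cast
  rw [qpow_add]
  ring

lemma IsWeaklyHolomorphicAtInfty.mul {f g : ℍ → ℂ} (hf : IsWeaklyHolomorphicAtInfty f)
    (hg : IsWeaklyHolomorphicAtInfty g) : IsWeaklyHolomorphicAtInfty fun τ => f τ * g τ := by
  obtain ⟨hf, M, hM⟩ := hf
  obtain ⟨hg, N, hN⟩ := hg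
  refine ⟨hf.mul hg, M + N, ?_⟩
  refine (congrArg IsBoundedAtImInfty (funext fun τ => ?_)).mp (hM.mul hN)
  simp only [Pi.mul_apply]
  push_cast
  rw [qpow_add]
  ring

lemma isWeaklyHolomorphicAtInfty_of_isBounded {f : ℍ → ℂ} (hf : MDifferentiable 𝓘(ℂ) 𝓘(ℂ) f)
    (hb : IsBoundedAtImInfty f) : IsWeaklyHolomorphicAtInfty f := by
  refine ⟨hf, 0, ?_⟩
  simpa [qpow] using hb

lemma isWeaklyHolomorphicAtInfty_const (c : ℂ) : IsWeaklyHolomorphicAtInfty fun _ => c :=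
  isWeaklyHolomorphicAtInfty_of_isBounded mdifferentiable_const (const_boundedAtFilter _ c)

lemma isWeaklyHolomorphicAtInfty_sum {ι : Type*} (s : Finset ι) {f : ι → ℍ → ℂ}
    (hf : ∀ i ∈ s, IsWeaklyHolomorphicAtInfty (f i)) :
    IsWeaklyHolomorphicAtInfty fun τ => ∑ i ∈ s, f i τ := by
  classical
  induction s using Finset.induction_on with
  | empty => simpa using isWeaklyHolomorphicAtInfty_const 0
  | insert i s hi ih =>
    simp only [Finset.sum_insert hi]
    exact (hf i (Finset.mem_insert_self i s)).add
      (ih fun j hj => hf j (Finset.mem_insert_of_mem hj))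

lemma isWeaklyHolomorphicAtInfty_quotCoeff (m : ℕ) (a b : ℤ) {n : ℕ} (hn : n ≤ m) :
    IsWeaklyHolomorphicAtInfty (quotCoeff m a b n) :=
  ⟨mdifferentiable_quotCoeff m a b hn, m, isBoundedAtImInfty_qpow_mul_quotCoeff m a b hn⟩

/-- The `q ^ (1/8)`-expansion of a function of period `8` that is weakly holomorphic at `i∞`. -/
lemma IsWeaklyHolomorphicAtInfty.exists_hasSum {g : ℍ → ℂ} (hg : IsWeaklyHolomorphicAtInfty g)
    (hper : ∀ τ τ' : ℍ, (τ' : ℂ) = τ + 8 → g τ' = g τ) :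
    ∃ (N : ℕ) (c : ℕ → ℂ), ∀ τ : ℍ,
      HasSum (fun n : ℕ => c n * qpow ((((n : ℤ) - 8 * N : ℤ) : ℝ) / 8) τ) (g τ) := by
  obtain ⟨hd, N, hN⟩ := hg
  -- Multiplication by `q^N` makes `g` bounded and preserves the period `8`; dividing it out
  -- afterwards shifts the exponents by `8N`.
  set f : ℍ → ℂ := fun τ => qpow (N : ℝ) τ * g τ with hf
  have hq : MDifferentiable 𝓘(ℂ) 𝓘(ℂ) fun τ : ℍ => qpow (N : ℝ) τ := by
    rw [UpperHalfPlane.mdifferentiable_iff]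
    have h1 : DifferentiableOn ℂ (fun z : ℂ => cexp (2 * π * I * (N : ℝ) * z))
        {z | 0 < z.im} := by fun_prop
    refine h1.congr fun z hz => ?_
    rw [Function.comp_apply, qpow, ofComplex_apply_of_im_pos hz]
  have hfd : MDifferentiable 𝓘(ℂ) 𝓘(ℂ) f := hq.mul hd
  have hfp : Function.Periodic (f ∘ ofComplex) ((8 : ℝ) : ℂ) := by
    intro w
    by_cases hw : 0 < w.im
    · have hw' : 0 < (w + ((8 : ℝ) : ℂ)).im := by
        simpa using hw
      rw [Function.comp_apply, Function.comp_apply, ofComplex_apply_of_im_pos hw,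
        ofComplex_apply_of_im_pos hw']
      simp only [hf]
      rw [hper ⟨w, hw⟩ ⟨w + ((8 : ℝ) : ℂ), hw'⟩ (by simp)]
      congr 1
      rw [qpow, qpow, Complex.exp_eq_exp_iff_exists_int]
      refine ⟨8 * N, ?_⟩
      push_cast
      ring
    -- Off the half-plane `ofComplex` takes one fixed value, so periodicity holds there too.
    · have hw' : (w + ((8 : ℝ) : ℂ)).im ≤ 0 := by
        simpa using hw
      simp only [Function.comp_apply, ofComplex_apply_of_im_nonpos hw',
        ofComplex_apply_of_im_nonpos (not_lt.mp hw)]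
  refine ⟨N, fun n => (qExpansion 8 f).coeff n, fun τ => ?_⟩
  have h := (hasSum_qExpansion (by norm_num) hfp hfd hN τ).mul_left (qpow (-(N : ℝ)) τ)
  have e : qpow (-(N : ℝ)) τ * f τ = g τ := by
    rw [hf, ← mul_assoc, ← qpow_add, neg_add_cancel]
    simp [qpow]
  rw [e] at h
  refine hasSum_of_forall_eq h fun n => ?_
  rw [smul_eq_mul, mul_left_comm]
  congr 1
  rw [Function.Periodic.qParam, ← Complex.exp_nat_mul, qpow, qpow, ← Complex.exp_add]
  congr 1
  push_cast
  ring

/-! ### Eisenstein series -/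

lemma eisen_eq_E {j : ℕ} (hj : 2 ≤ j) (τ : ℍ) :
    eisen j τ = ModularForm.E (show 3 ≤ 2 * j by omega) τ := by
  rw [EisensteinSeries.q_expansion_bernoulli _ (even_two_mul j), eisen]
  push_cast
  congr 2
  · ring
  · refine tsum_congr fun l => ?_
    rw [qpow, zpow_natCast, ← Complex.exp_nat_mul]
    push_cast
    ring_nf

lemma eisen_one (τ : ℍ) : eisen 1 τ = EisensteinSeries.E2 τ := by
  rw [EisensteinSeries.E2_eq_tsum_cexp, eisen, bernoulli_two]
  congr 2
  · norm_num
  · refine tsum_congr fun l => ?_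
    rw [qpow, ← Complex.exp_nat_mul]
    push_cast
    ring_nf

lemma isWeaklyHolomorphicAtInfty_eisen {j : ℕ} (hj : 1 ≤ j) :
    IsWeaklyHolomorphicAtInfty (eisen j) := by
  rcases hj.eq_or_lt with rfl | hj
  · rw [funext eisen_one]
    exact isWeaklyHolomorphicAtInfty_of_isBounded E2_mdifferentiable
      EisensteinSeries.isBoundedAtImInfty_E2
  · rw [funext (eisen_eq_E hj)]
    exact isWeaklyHolomorphicAtInfty_of_isBounded (ModularFormClass.holo _)
      (ModularFormClass.bdd_at_infty _)

lemma eisen_smul {j : ℕ} (hj : 2 ≤ j) (γ : SL(2, ℤ)) (τ : ℍ) :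
    eisen j (γ • τ) = (γ 1 0 * τ + γ 1 1 : ℂ) ^ (2 * j) * eisen j τ := by
  rw [eisen_eq_E hj, eisen_eq_E hj]
  have h := SlashInvariantForm.slash_action_eqn'' (ModularForm.E (show 3 ≤ 2 * j by omega))
    (γ := (γ : GL (Fin 2) ℝ)) (by exact ⟨γ, rfl⟩) τ
  rw [ModularGroup.denom_apply] at h
  exact_mod_cast h

lemma eisen_one_smul (γ : SL(2, ℤ)) (τ : ℍ) :
    eisen 1 (γ • τ) = (γ 1 0 * τ + γ 1 1 : ℂ) ^ 2 * eisen 1 τ -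
      6 * I * γ 1 0 / π * (γ 1 0 * τ + γ 1 1 : ℂ) := by
  rw [eisen_one, eisen_one]
  have h := congrFun (EisensteinSeries.E2_slash_action γ) τ
  have hj := cocycle_ne_zero γ τ
  have hπ : (π : ℂ) ≠ 0 := by exact_mod_cast Real.pi_ne_zero
  rw [ModularForm.SL_slash_apply, Pi.sub_apply, Pi.smul_apply, EisensteinSeries.D2,
    ModularGroup.denom_apply, riemannZeta_two, smul_eq_mul, zpow_neg, ← div_eq_mul_inv,
    div_eq_iff (zpow_ne_zero _ hj)] at h
  rw [h, zpow_ofNat]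
  field_simp

/-! ### The completed finite part -/

lemma isWeaklyHolomorphicAtInfty_finitePart (m : ℕ) (a b : ℤ) :
    IsWeaklyHolomorphicAtInfty (finitePart m a b) := by
  refine (isWeaklyHolomorphicAtInfty_quotCoeff m a b (Nat.zero_le m)).add
    (isWeaklyHolomorphicAtInfty_sum _ fun j hj => ?_)
  rw [Finset.mem_Icc] at hj
  exact ((isWeaklyHolomorphicAtInfty_const _).mul
    (isWeaklyHolomorphicAtInfty_quotCoeff m a b (by omega))).mul
    (isWeaklyHolomorphicAtInfty_eisen hj.1)

/-- The weights `-2j` and `2j` cancel in every term except `j = 1`, where `B_2/2! = 1/12` times the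
anomaly of `E_2` remains. -/
lemma finitePart_smul {m : ℕ} (hm : 2 ≤ m) (γ : SL(2, ℤ)) (τ : ℍ) :
    finitePart m 0 1 (γ • τ) = finitePart m (γ 1 0) (γ 1 1) τ -
      I * γ 1 0 / (2 * π * (γ 1 0 * τ + γ 1 1)) * quotCoeff m (γ 1 0) (γ 1 1) 2 τ := by
  have hj := cocycle_ne_zero γ τ
  have hq : ∀ n ≤ m, quotCoeff m 0 1 n (γ • τ) =
      (γ 1 0 * τ + γ 1 1 : ℂ)⁻¹ ^ n * quotCoeff m (γ 1 0) (γ 1 1) n τ := fun n hn => by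
    simpa using quotCoeff_smul m 0 1 hn γ τ
  have hs : ∀ s : ℕ → ℂ, ∑ j ∈ Finset.Icc 1 (m / 2), s j =
      s 1 + ∑ j ∈ Finset.Icc 2 (m / 2), s j := fun s =>
    (Finset.add_sum_Ioc_eq_sum_Icc (f := s) (by omega : 1 ≤ m / 2)).symm
  rw [finitePart, finitePart, hs, hs, hq 0 (Nat.zero_le _)]
  have e : ∑ j ∈ Finset.Icc 2 (m / 2), ((bernoulli (2 * j) : ℚ) : ℂ) / ((2 * j).factorial : ℂ) *
      quotCoeff m 0 1 (2 * j) (γ • τ) * eisen j (γ • τ) =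
      ∑ j ∈ Finset.Icc 2 (m / 2), ((bernoulli (2 * j) : ℚ) : ℂ) / ((2 * j).factorial : ℂ) *
        quotCoeff m (γ 1 0) (γ 1 1) (2 * j) τ * eisen j τ := by
    refine Finset.sum_congr rfl fun j hj' => ?_
    rw [Finset.mem_Icc] at hj'
    rw [hq _ (by omega), eisen_smul hj'.1, inv_pow]
    field_simp
  have hπ : (π : ℂ) ≠ 0 := by exact_mod_cast Real.pi_ne_zero
  rw [e, hq (2 * 1) (by omega), eisen_one_smul, mul_one, bernoulli_two]
  simp only [Nat.factorial_two]
  push_cast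
  field_simp
  ring

/-- `1 / Im(γτ) = |cτ + d|² / v`, with the conjugate of `cτ + d` written as `cτ + d - 2icv`. The
second summand produces the term that cancels the anomaly in `finitePart_smul`. -/
lemma inv_im_smul (γ : SL(2, ℤ)) (τ : ℍ) :
    (((γ • τ).im : ℝ) : ℂ)⁻¹ = (γ 1 0 * τ + γ 1 1 : ℂ) *
      ((γ 1 0 * τ + γ 1 1 : ℂ) - 2 * I * γ 1 0 * τ.im) * (τ.im : ℂ)⁻¹ := by
  have h1 : (starRingEnd ℂ) (γ 1 0 * τ + γ 1 1 : ℂ) =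
      (γ 1 0 * τ + γ 1 1 : ℂ) - 2 * I * γ 1 0 * τ.im := by
    apply Complex.ext <;> simp
    ring
  rw [ModularGroup.im_smul_eq_div_normSq, ModularGroup.denom_apply, Complex.ofReal_div, inv_div,
    Complex.normSq_eq_conj_mul_self, ← h1]
  ring

lemma phiFHat_smul {m : ℕ} (hm : 2 ≤ m) (γ : SL(2, ℤ)) (τ : ℍ) :
    phiFHat m (γ • τ) = finitePart m (γ 1 0) (γ 1 1) τ -
      quotCoeff m (γ 1 0) (γ 1 1) 2 τ / (4 * π) * (τ.im : ℂ)⁻¹ := by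
  have hj := cocycle_ne_zero γ τ
  have hπ : (π : ℂ) ≠ 0 := by exact_mod_cast Real.pi_ne_zero
  have hv : (τ.im : ℂ) ≠ 0 := by exact_mod_cast τ.im_ne_zero
  have hq := quotCoeff_smul m 0 1 hm γ τ
  rw [phiFHat, phiF_eq_finitePart, finitePart_smul hm, D_eq_quotCoeff, hq,
    div_mul_eq_div_mul_one_div _ (4 * π : ℂ), one_div, inv_im_smul]
  simp only [zero_mul, one_mul, zero_add]
  field_simp
  ring

lemma phiFHat_eq {m : ℕ} (hm : 2 ≤ m) (τ : ℍ) :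
    phiFHat m τ = finitePart m 0 1 τ - quotCoeff m 0 1 2 τ / (4 * π) * (τ.im : ℂ)⁻¹ := by
  simpa using phiFHat_smul hm 1 τ

/-- With `c` even, the determinant forces `d` odd, so the bottom row is an even shift of `(0, 1)`.
For `c = 2k` the exponent `mc/4` is `kp`, which matches the pairing up to sign. -/
lemma exists_shift_of_mem_Gamma0 {γ : SL(2, ℤ)} (hγ : γ ∈ CongruenceSubgroup.Gamma0 2) (p : ℕ) :
    ∃ k l : ℤ, γ 1 0 = 0 + 2 * k ∧ γ 1 1 = 1 + 2 * l ∧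
      psi (2 * p) γ = (-1) ^ ((0 * l - k * 1) * p) := by
  rw [CongruenceSubgroup.Gamma0_mem, ZMod.intCast_zmod_eq_zero_iff_dvd] at hγ
  obtain ⟨k, hk⟩ := hγ
  have hdet := γ.det_coe
  rw [Matrix.det_fin_two] at hdet
  push_cast at hk
  have hodd : Odd (γ 1 1) := by
    by_contra h
    rw [Int.not_odd_iff_even] at h
    obtain ⟨r, hr⟩ := h
    rw [hk, hr] at hdet
    have : (2 : ℤ) ∣ 1 := ⟨γ 0 0 * r - γ 0 1 * k, by linear_combination -hdet⟩
    norm_num at this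
  obtain ⟨l, hl⟩ := hodd
  refine ⟨k, l, by rw [hk]; ring, by rw [hl]; ring, ?_⟩
  rw [psi, hk, show ((2 * p : ℕ) : ℤ) * (2 * k) / 4 = k * p by
    push_cast
    rw [show 2 * (p : ℤ) * (2 * k) = 4 * (k * p) by ring]
    exact Int.mul_ediv_cancel_left _ (by norm_num)]
  rw [show (0 * l - k * 1) * (p : ℤ) = -(k * p) by ring, zpow_neg, ← inv_zpow]
  norm_num

lemma finitePart_shift (p : ℕ) (a b k l : ℤ) (τ : ℍ) :
    finitePart (2 * p) (a + 2 * k) (b + 2 * l) τ =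
      (-1) ^ ((a * l - k * b) * p) * finitePart (2 * p) a b τ := by
  rw [finitePart, finitePart, quotCoeff_shift p a b k l (Nat.zero_le _), mul_add, Finset.mul_sum]
  congr 1
  refine Finset.sum_congr rfl fun j hj => ?_
  rw [Finset.mem_Icc] at hj
  rw [quotCoeff_shift p a b k l (by omega)]
  ring

theorem isAlmostHolomorphicModularForm_phiFHat {p : ℕ} (hp : 1 ≤ p) :
    IsAlmostHolomorphicModularForm 0 (CongruenceSubgroup.Gamma0 2) (psi (2 * p))
      (phiFHat (2 * p)) := by
  have hm : 2 ≤ 2 * p := by omega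
  refine ⟨fun γ hγ τ => ?_, fun γ => ?_⟩
  · obtain ⟨k, l, h1, h2, h3⟩ := exists_shift_of_mem_Gamma0 hγ p
    rw [ModularForm.SL_slash_apply, neg_zero, zpow_zero, mul_one, phiFHat_smul hm, phiFHat_eq hm,
      h1, h2, finitePart_shift, quotCoeff_shift p 0 1 k l hm, h3]
    ring
  · refine ⟨1, fun k => if k = 0 then finitePart (2 * p) (γ 1 0) (γ 1 1) else
      fun τ => -(1 / (4 * π)) * quotCoeff (2 * p) (γ 1 0) (γ 1 1) 2 τ, fun k _ => ?_, fun τ => ?_⟩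
    · dsimp only
      split_ifs
      · exact isWeaklyHolomorphicAtInfty_finitePart _ _ _
      · exact (isWeaklyHolomorphicAtInfty_const _).mul
          (isWeaklyHolomorphicAtInfty_quotCoeff _ _ _ hm)
    · rw [ModularForm.SL_slash_apply, neg_zero, zpow_zero, mul_one, phiFHat_smul hm,
        Finset.sum_range_succ, Finset.sum_range_one]
      simp
      ring

/-! ### Fourier developments -/

/-- A Fourier development in powers of `q ^ (1/8)` and `ζ`. -/
def HasEighthDevelopment (g : ℂ → ℍ → ℂ) : Prop :=
  ∃ (n₀ : ℤ) (c : ℤ × ℤ → ℂ), (∀ x, c x ≠ 0 → n₀ ≤ x.1) ∧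
    ∀ (τ : ℍ) (z : ℂ), 0 < z.im → z.im < τ.im →
      HasSum (fun x : ℤ × ℤ => c x * qpow ((x.1 : ℝ) / 8) τ * zetapow x.2 z) (g z τ)

lemma HasEighthDevelopment.hasFourierDevelopment {g : ℂ → ℍ → ℂ} (h : HasEighthDevelopment g) :
    HasFourierDevelopment g := by
  obtain ⟨n₀, c, hc, hs⟩ := h
  refine ⟨8, n₀, fun n r => c (n, r), by norm_num, fun n r hn => ?_, fun τ z h1 h2 => ?_⟩
  · by_contra h
    exact absurd (hc _ h) (not_le.mpr hn)
  · simpa using hs τ z h1 h2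

/-- Terms of a double series with the same exponents may be collected. -/
lemma hasEighthDevelopment_of_family {ι : Type*} (e : ι → ℤ × ℤ) (a : ι → ℂ) (n₀ : ℤ)
    (ha : ∀ i, a i ≠ 0 → n₀ ≤ (e i).1) {g : ℂ → ℍ → ℂ}
    (hs : ∀ (τ : ℍ) (z : ℂ), 0 < z.im → z.im < τ.im →
      HasSum (fun i => a i * qpow (((e i).1 : ℝ) / 8) τ * zetapow (e i).2 z) (g z τ)) :
    HasEighthDevelopment g := by
  refine ⟨n₀, fun x => ∑' i : {i // e i = x}, a i, fun x hx => ?_, fun τ z h1 h2 => ?_⟩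
  · obtain ⟨i, hi⟩ : ∃ i : {i // e i = x}, a i ≠ 0 := by
      by_contra! h
      exact hx (by simp [h])
    have := ha i hi
    rwa [i.2] at this
  · have h := (Equiv.sigmaFiberEquiv e).hasSum_iff.mpr (hs τ z h1 h2)
    refine h.sigma fun x => ?_
    have hf := h.summable.sigma_factor x
    have e1 : ∀ i : {i // e i = x}, ((fun i => a i * qpow (((e i).1 : ℝ) / 8) τ *
        zetapow (e i).2 z) ∘ Equiv.sigmaFiberEquiv e) ⟨x, i⟩ =
        a i * (qpow ((x.1 : ℝ) / 8) τ * zetapow x.2 z) := by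
      rintro ⟨i, rfl⟩
      simp [mul_assoc]
    rw [funext e1] at hf ⊢
    have := hf.hasSum
    rwa [tsum_mul_right, ← mul_assoc] at this

lemma HasEighthDevelopment.add {f g : ℂ → ℍ → ℂ} (hf : HasEighthDevelopment f)
    (hg : HasEighthDevelopment g) : HasEighthDevelopment fun z τ => f z τ + g z τ := by
  obtain ⟨n₁, c, hc, hs⟩ := hf
  obtain ⟨n₂, d, hd, ht⟩ := hg
  refine ⟨min n₁ n₂, fun x => c x + d x, fun x hx => ?_, fun τ z h1 h2 => ?_⟩
  · by_cases h : c x = 0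
    · simp only [h, zero_add] at hx
      exact (min_le_right _ _).trans (hd x hx)
    · exact (min_le_left _ _).trans (hc x h)
  · simpa only [add_mul] using (hs τ z h1 h2).add (ht τ z h1 h2)

lemma HasEighthDevelopment.const_mul {f : ℂ → ℍ → ℂ} (hf : HasEighthDevelopment f) (k : ℂ) :
    HasEighthDevelopment fun z τ => k * f z τ := by
  obtain ⟨n₁, c, hc, hs⟩ := hf
  refine ⟨n₁, fun x => k * c x, fun x hx => hc x (right_ne_zero_of_mul hx), fun τ z h1 h2 => ?_⟩
  simpa only [mul_assoc] using (hs τ z h1 h2).mul_left k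

lemma HasEighthDevelopment.mul {f g : ℂ → ℍ → ℂ} (hf : HasEighthDevelopment f)
    (hg : HasEighthDevelopment g) : HasEighthDevelopment fun z τ => f z τ * g z τ := by
  obtain ⟨n₁, c, hc, hs⟩ := hf
  obtain ⟨n₂, d, hd, ht⟩ := hg
  refine hasEighthDevelopment_of_family (ι := (ℤ × ℤ) × (ℤ × ℤ)) (fun i => i.1 + i.2)
    (fun i => c i.1 * d i.2) (n₁ + n₂) (fun i hi => ?_) fun τ z h1 h2 => ?_
  · exact add_le_add (hc _ (left_ne_zero_of_mul hi)) (hd _ (right_ne_zero_of_mul hi))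
  · set F := fun x : ℤ × ℤ => c x * qpow ((x.1 : ℝ) / 8) τ * zetapow x.2 z with hF
    set G := fun x : ℤ × ℤ => d x * qpow ((x.1 : ℝ) / 8) τ * zetapow x.2 z with hG
    have hFs : HasSum F (f z τ) := hs τ z h1 h2
    have hGs : HasSum G (g z τ) := ht τ z h1 h2
    have h := hFs.mul hGs (summable_mul_of_summable_norm hFs.summable.norm hGs.summable.norm)
    refine hasSum_of_forall_eq h fun i => ?_
    simp only [hF, hG]
    rw [Prod.fst_add, Prod.snd_add, Int.cast_add, add_div, qpow_add]
    rw [show zetapow (i.1.2 + i.2.2) z = zetapow i.1.2 z * zetapow i.2.2 z by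
      rw [zetapow, zetapow, zetapow, ← Complex.exp_add]
      push_cast
      ring_nf]
    ring

lemma hasEighthDevelopment_sum {ι : Type*} (s : Finset ι) {f : ι → ℂ → ℍ → ℂ}
    (hf : ∀ i ∈ s, HasEighthDevelopment (f i)) :
    HasEighthDevelopment fun z τ => ∑ i ∈ s, f i z τ := by
  classical
  induction s using Finset.induction_on with
  | empty => exact ⟨0, 0, fun x hx => absurd rfl hx, fun τ z _ _ => by simp⟩
  | insert i s hi ih =>
    simp only [Finset.sum_insert hi]
    exact (hf i (Finset.mem_insert_self i s)).add
      (ih fun j hj => hf j (Finset.mem_insert_of_mem hj))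

lemma hasEighthDevelopment_quotCoeff (m : ℕ) (a b : ℤ) {n : ℕ} (hn : n ≤ m) :
    HasEighthDevelopment fun _ τ => quotCoeff m a b n τ := by
  obtain ⟨N, c, hc⟩ := (isWeaklyHolomorphicAtInfty_quotCoeff m a b hn).exists_hasSum
    fun τ τ' h => quotCoeff_congr h
  refine hasEighthDevelopment_of_family (fun n : ℕ => ((n : ℤ) - 8 * N, 0)) c (-(8 * N))
    (fun i _ => by simp) fun τ z _ _ => ?_
  refine hasSum_of_forall_eq (hc τ) fun i => ?_
  simp [zetapow]

/-- The exponent of `q` in the terms of the geometric series for `1 / (1 - q ^ r)`. -/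
def polarExponent (r : ℤ) (l : ℕ) : ℤ := if 0 < r then l * r else (l + 1) * -r

/-- The general term of the double series for the polar part. -/
def polarDoubleTerm (j : ℕ) (z t : ℂ) (r : ℤ) (l : ℕ) : ℂ :=
  (((|r| : ℤ) : ℝ) : ℂ) ^ (2 * j - 1) * zetapow (polarExponent r l) t * zetapow r z

/-- For `r < 0` one expands `1/(1 - q^r) = -q^|r|/(1 - q^|r|)`; the minus sign is absorbed by the
odd power, so the coefficients become powers of `|r|`. -/
lemma hasSum_polarDoubleTerm {j : ℕ} (hj : 1 ≤ j) (z : ℂ) (τ : ℍ) (r : {r : ℤ // r ≠ 0}) :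
    HasSum (fun l => polarDoubleTerm j z τ r l) (polarTerm j z τ r) := by
  obtain ⟨r, hr⟩ := r
  have hmul : ∀ (l : ℕ) (s : ℕ), zetapow ((l : ℤ) * s) τ = zetapow s τ ^ l := fun l s => by
    rw [zetapow, zetapow, ← Complex.exp_nat_mul]
    push_cast
    ring_nf
  have hlt : ∀ s : ℕ, s ≠ 0 → ‖zetapow s τ‖ < 1 := fun s hs => by
    rw [zetapow_natCast, norm_pow]
    exact pow_lt_one₀ (norm_nonneg _) (norm_cexp_lt_one τ.im_pos) hs
  rw [polarTerm, qpow_intCast]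
  rcases lt_or_gt_of_ne hr with h | h
  · obtain ⟨s, rfl⟩ : ∃ s : ℕ, r = -(s : ℤ) := ⟨r.natAbs, by omega⟩
    have hs : s ≠ 0 := by omega
    have hg := ((hasSum_geometric_of_norm_lt_one (hlt s hs)).mul_left
      ((s : ℂ) ^ (2 * j - 1) * zetapow s τ)).mul_right (zetapow (-(s : ℤ)) z)
    have h0 := zetapow_ne_zero s τ
    have h1 := one_sub_zetapow_ne_zero τ.im_pos hs
    have ho := odd_two_mul_sub_one hj
    have e : (((-(s : ℤ) : ℤ) : ℂ)) ^ (2 * j - 1) / (1 - zetapow (-(s : ℤ)) τ) *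
        zetapow (-(s : ℤ)) z = (s : ℂ) ^ (2 * j - 1) * zetapow s τ * (1 - zetapow s τ)⁻¹ *
        zetapow (-(s : ℤ)) z := by
      rw [zetapow_neg _ (τ : ℂ), zetapow_neg_right]
      push_cast
      rw [ho.neg_pow]
      have h2 : 1 - (zetapow s τ)⁻¹ ≠ 0 := by
        rw [sub_ne_zero] at h1 ⊢
        exact fun h => h1 (by rw [← inv_inv (zetapow s τ), ← h, inv_one])
      congr 1
      rw [div_eq_iff h2]
      field_simp
      ring
    rw [e]
    refine hasSum_of_forall_eq hg fun l => ?_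
    rw [polarDoubleTerm, polarExponent, if_neg (not_lt.mpr h.le), neg_neg]
    have := hmul (l + 1) s
    push_cast at this
    rw [this, abs_neg, Nat.abs_cast, pow_succ]
    push_cast
    ring
  · obtain ⟨s, rfl⟩ : ∃ s : ℕ, r = (s : ℤ) := ⟨r.natAbs, by omega⟩
    have hs : s ≠ 0 := by omega
    have hg := ((hasSum_geometric_of_norm_lt_one (hlt s hs)).mul_left
      ((s : ℂ) ^ (2 * j - 1))).mul_right (zetapow (s : ℤ) z)
    rw [div_eq_mul_inv, Int.cast_natCast]
    refine hasSum_of_forall_eq hg fun l => ?_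
    rw [polarDoubleTerm, polarExponent, if_pos h, hmul, Nat.abs_cast]
    push_cast
    ring

lemma zetapow_im_mul_I (r : ℤ) (z : ℂ) : zetapow r (z.im * I) = (‖zetapow r z‖ : ℂ) := by
  rw [norm_zetapow, zetapow, Complex.ofReal_exp]
  congr 1
  push_cast
  linear_combination (2 * π * r * z.im : ℂ) * I_mul_I

lemma polarDoubleTerm_im_mul_I (j : ℕ) (z t : ℂ) (r : ℤ) (l : ℕ) :
    polarDoubleTerm j (z.im * I) (t.im * I) r l = (‖polarDoubleTerm j z t r l‖ : ℂ) := by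
  have : 0 ≤ ((|r| : ℤ) : ℝ) := by exact_mod_cast abs_nonneg r
  rw [polarDoubleTerm, polarDoubleTerm, zetapow_im_mul_I, zetapow_im_mul_I, norm_mul, norm_mul,
    norm_pow, Complex.norm_real, Real.norm_of_nonneg this]
  push_cast
  rfl

/-- Replacing `z` and `τ` by `i Im z` and `i Im τ` turns every term into its norm. Absolute
convergence is thus convergence of the polar series at purely imaginary arguments. -/
lemma summable_polarDoubleTerm {j : ℕ} (hj : 1 ≤ j) {z : ℂ} {τ : ℍ} (h1 : 0 < z.im)
    (h2 : z.im < τ.im) :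
    Summable fun x : {r : ℤ // r ≠ 0} × ℕ => polarDoubleTerm j z τ x.1 x.2 := by
  refine Summable.of_norm ?_
  rw [summable_prod_of_nonneg fun _ => norm_nonneg _]
  set τ' : ℍ := ⟨(τ : ℂ).im * I, by simpa using τ.im_pos⟩ with hτ'
  have hs : ∀ r : {r : ℤ // r ≠ 0}, HasSum (fun l => (‖polarDoubleTerm j z τ r l‖ : ℂ))
      (polarTerm j (z.im * I) τ' r) := fun r => by
    simpa only [← polarDoubleTerm_im_mul_I] using hasSum_polarDoubleTerm hj (z.im * I) τ' r
  have hs' : ∀ r : {r : ℤ // r ≠ 0}, Summable fun l => ‖polarDoubleTerm j z τ r l‖ := fun r =>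
    Complex.summable_ofReal.mp (hs r).summable
  refine ⟨hs', ?_⟩
  rw [← Complex.summable_ofReal]
  have hp := (hasSum_polarTerm hj (z := z.im * I) (τ := τ') (by simpa using h1) (by
    rw [← UpperHalfPlane.coe_im, hτ']
    simpa using h2)).summable
  refine hp.congr fun r => ?_
  rw [← (hs r).tsum_eq, Complex.ofReal_tsum]

lemma hasEighthDevelopment_polarFun {j : ℕ} (hj : 1 ≤ j) :
    HasEighthDevelopment fun z τ => polarFun j τ z := by
  refine hasEighthDevelopment_of_family (ι := {r : ℤ // r ≠ 0} × ℕ)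
    (fun x => (8 * polarExponent x.1 x.2, x.1))
    (fun x => (((|(x.1 : ℤ)| : ℤ) : ℝ) : ℂ) ^ (2 * j - 1)) 0 (fun x _ => ?_) fun τ z h1 h2 => ?_
  · dsimp only
    rw [polarExponent]
    split_ifs <;> nlinarith
  · rw [polarFun_eq_tsum hj h1 h2]
    have h := (summable_polarDoubleTerm hj h1 h2).hasSum
    have hp := h.prod_fiberwise fun r => hasSum_polarDoubleTerm hj z τ r
    rw [← hp.tsum_eq] at h
    refine hasSum_of_forall_eq h fun x => ?_
    have : ((8 * polarExponent x.1 x.2 : ℤ) : ℝ) / 8 = (polarExponent x.1 x.2 : ℝ) := by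
      push_cast
      ring
    rw [this, qpow_intCast, polarDoubleTerm]

/-! ### Meromorphy off the lattice -/

lemma IsMeromorphicOffLattice.add {f g : ℂ → ℍ → ℂ} (hf : IsMeromorphicOffLattice f)
    (hg : IsMeromorphicOffLattice g) : IsMeromorphicOffLattice fun z τ => f z τ + g z τ := by
  refine ⟨hf.1.add hg.1, fun τ l n => ?_⟩
  obtain ⟨M, F, hF⟩ := hf.2 τ l n
  obtain ⟨N, G, hG⟩ := hg.2 τ l n
  refine ⟨M + N, fun x => (x.1 - l * x.2 - n) ^ N * F x + (x.1 - l * x.2 - n) ^ M * G x, ?_⟩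
  filter_upwards [hF, hG] with x hx hx'
  have hFx := hx.1
  have hGx := hx'.1
  refine ⟨by fun_prop, fun h => ?_⟩
  rw [← hx.2 h, ← hx'.2 h]
  ring

lemma eventually_im_pos {t : ℂ} (ht : 0 < t.im) (z : ℂ) :
    ∀ᶠ x : ℂ × ℂ in 𝓝 (z, t), 0 < x.2.im :=
  (Complex.continuous_im.comp continuous_snd).continuousAt.eventually (lt_mem_nhds ht)

lemma isMeromorphicOffLattice_of_mdifferentiable {g : ℍ → ℂ}
    (hg : MDifferentiable 𝓘(ℂ) 𝓘(ℂ) g) : IsMeromorphicOffLattice fun _ τ => g τ := by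
  rw [UpperHalfPlane.mdifferentiable_iff] at hg
  have hd : ∀ x : ℂ × ℂ, 0 < x.2.im →
      DifferentiableAt ℂ (fun x : ℂ × ℂ => g (ofComplex x.2)) x := fun x hx =>
    DifferentiableAt.comp (g := g ∘ ofComplex) (f := Prod.snd) x
      (hg.differentiableAt (isOpen_upperHalfPlaneSet.mem_nhds hx)) differentiableAt_snd
  refine ⟨fun x hx => (hd x hx.1).differentiableWithinAt, fun τ l n =>
    ⟨0, fun x => g (ofComplex x.2), ?_⟩⟩
  filter_upwards [eventually_im_pos τ.im_pos (l * τ + n)] with x hx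
  exact ⟨hd x hx, fun _ => by simp⟩

lemma coe_ofComplex {t : ℂ} (ht : 0 < t.im) : ((ofComplex t : ℍ) : ℂ) = t := by
  rw [ofComplex_apply_of_im_pos ht]

/-- The Cauchy integral of `w ^ m` times the `m`-th power of a theta quotient. -/
def clearedPower (m : ℕ) (a b : ℤ) (ρ : ℝ) (x : ℂ × ℂ) : ℂ :=
  ∮ w in C(0, ρ), w ^ m * thetaQuot a b w x.2 ^ m * (w - x.1)⁻¹

lemma differentiableAt_clearedPower (m : ℕ) (a b : ℤ) {ρ : ℝ} (h0 : 0 < ρ) (h1 : ρ < 1)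
    {x : ℂ × ℂ} (hx1 : ‖x.1‖ < ρ / 2) (hx2 : 3 / 2 * ρ < x.2.im) :
    DifferentiableAt ℂ (clearedPower m a b ρ) x := by
  have hp : ∀ w ∈ Metric.sphere (0 : ℂ) ρ, ∀ y ∈ Metric.closedBall x (ρ / 2),
      w - y.1 ≠ 0 ∧ DifferentiableAt ℂ (fun q : ℂ × ℂ => thetaQuot a b q.1 q.2) (w, y.2) := by
    intro w hw y hy
    refine ⟨?_, differentiableAt_thetaQuot_param a b h0 h1 (by linarith) hw hy⟩
    have hn : ‖w‖ = ρ := by simpa using hw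
    have hy1 : ‖y.1 - x.1‖ ≤ ρ / 2 := by
      rw [Metric.mem_closedBall, dist_eq_norm] at hy
      exact (norm_fst_le (y - x)).trans hy
    intro h
    have h2 : ‖w‖ ≤ ‖y.1 - x.1‖ + ‖x.1‖ := by
      rw [sub_eq_zero.mp h]
      simpa using norm_add_le (y.1 - x.1) x.1
    linarith
  refine differentiableAt_circleIntegral (W := fun w x => w ^ m * thetaQuot a b w x.2 ^ m *
    (w - x.1)⁻¹) h0.le (R := ρ / 2) (by positivity) ?_ ?_
  · rintro ⟨w, y⟩ ⟨hw, hy⟩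
    obtain ⟨hw0, hd⟩ := hp w hw y hy
    refine ContinuousAt.continuousWithinAt ?_
    have h3 : ContinuousAt (fun p : ℂ × ℂ × ℂ => thetaQuot a b p.1 p.2.2) (w, y) :=
      ContinuousAt.comp (g := fun q : ℂ × ℂ => thetaQuot a b q.1 q.2)
        (f := fun p : ℂ × ℂ × ℂ => (p.1, p.2.2)) hd.continuousAt (by fun_prop)
    have h4 : ContinuousAt (fun p : ℂ × ℂ × ℂ => p.1 - p.2.1) (w, y) := by fun_prop
    exact ((continuousAt_fst.pow m).mul (h3.pow m)).mul (h4.inv₀ hw0)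
  · intro w hw y hy
    obtain ⟨hw0, hd⟩ := hp w hw y (Metric.ball_subset_closedBall hy)
    have h3 : DifferentiableAt ℂ (fun x : ℂ × ℂ => thetaQuot a b w x.2) y :=
      DifferentiableAt.comp (g := fun q : ℂ × ℂ => thetaQuot a b q.1 q.2)
        (f := fun x : ℂ × ℂ => (w, x.2)) y hd (by fun_prop)
    have h4 : DifferentiableAt ℂ (fun x : ℂ × ℂ => w - x.1) y := by fun_prop
    exact ((h3.pow m).const_mul _).mul (h4.inv hw0)

/-- Dividing theta by `w` removes its only zero in the disc, so `w^m` times the power extends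
holomorphically over `0` and Cauchy's formula recovers it. The integral form is what gives joint
holomorphy in `(w, t)`. -/
lemma clearedPower_eq (m : ℕ) (a b : ℤ) {ρ : ℝ} (h1 : ρ < 1) {w t : ℂ}
    (hw : ‖w‖ < ρ) (hw0 : w ≠ 0) (ht : ρ < t.im) :
    clearedPower m a b ρ (w, t) = 2 * π * I * (w ^ m * thetaQuot a b w t ^ m) := by
  have h0 : 0 < ρ := (norm_nonneg w).trans_lt hw
  have ht0 : 0 < t.im := h0.trans ht
  set h : ℂ → ℂ := fun w => (thetaNum a b w t / dslope (fun z => thetaC z t) 0 w) ^ m with hh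
  have heq : ∀ w : ℂ, w ≠ 0 → w ^ m * thetaQuot a b w t ^ m = h w := fun w hw0 => by
    rw [hh, ← mul_pow, thetaQuot, thetaC_eq_mul_dslope w t]
    congr 1
    field_simp
  have hne : ∀ w ∈ Metric.closedBall (0 : ℂ) ρ, dslope (fun z => thetaC z t) 0 w ≠ 0 := by
    intro w hw
    have hn : ‖w‖ ≤ ρ := by simpa using hw
    rcases eq_or_ne w 0 with rfl | hw0
    · exact dslope_thetaC_zero_ne_zero ht0
    · intro h
      have := thetaC_eq_mul_dslope w t
      rw [h, mul_zero] at this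
      exact thetaC_ne_zero ht0 (ne_lattice_of_ne_int
        (((Complex.abs_im_le_norm w).trans hn).trans_lt ht)
        (not_int_of_norm_lt_one hw0 (hn.trans_lt h1))) this
  have hds : Differentiable ℂ (dslope (fun z => thetaC z t) 0) := by
    rw [← differentiableOn_univ, Complex.differentiableOn_dslope univ_mem, differentiableOn_univ]
    exact differentiable_thetaC ht0
  have hd : DifferentiableOn ℂ h (Metric.closedBall 0 ρ) := fun w hw =>
    (((differentiable_thetaNum a b ht0 w).div (hds w) (hne w hw)).pow m).differentiableWithinAt
  have hc := Complex.two_pi_I_inv_smul_circleIntegral_sub_inv_smul_of_differentiable_on_off_countable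
    Set.countable_empty (w := w) (by simpa using hw) hd.continuousOn
    fun x hx => (hd x (Metric.ball_subset_closedBall hx.1)).differentiableAt
      (Metric.closedBall_mem_nhds_of_mem hx.1)
  have hI : (2 * π * I : ℂ) ≠ 0 := by simp [Real.pi_ne_zero]
  rw [heq w hw0, ← hc, smul_eq_mul, mul_inv_cancel_left₀ hI, clearedPower]
  refine circleIntegral.integral_congr h0.le fun u hu => ?_
  have hu0 : u ≠ 0 := by
    rintro rfl
    simp at hu
    linarith
  simp only [smul_eq_mul]
  rw [heq u hu0, mul_comm]

lemma isMeromorphicOffLattice_thetaQuot_pow (p : ℕ) (a b : ℤ) :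
    IsMeromorphicOffLattice fun z τ => thetaQuot a b z τ ^ (2 * p) := by
  refine ⟨fun x hx => DifferentiableAt.differentiableWithinAt ?_, fun τ l n => ?_⟩
  · have hz : ∀ k l : ℤ, x.1 ≠ k * x.2 + l := fun k l h => hx.2 ⟨k, l, by rw [coe_ofComplex hx.1, h]⟩
    refine ((differentiableAt_thetaQuot_prod a b hx.1 hz).pow (2 * p)).congr_of_eventuallyEq ?_
    filter_upwards [eventually_im_pos hx.1 x.1] with y hy
    rw [coe_ofComplex hy]
    rfl
  · have ht' : 0 < (τ : ℂ).im := τ.im_pos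
    obtain ⟨ρ, h0, h1, h2⟩ : ∃ ρ : ℝ, 0 < ρ ∧ ρ < 1 ∧ 3 / 2 * ρ < (τ : ℂ).im :=
      ⟨min (1 / 2) ((τ : ℂ).im / 4), by positivity, by
        have := min_le_left (1 / 2) ((τ : ℂ).im / 4); linarith, by
        have := min_le_right (1 / 2) ((τ : ℂ).im / 4); linarith⟩
    have hI : (2 * π * I : ℂ) ≠ 0 := by simp [Real.pi_ne_zero]
    -- Periodicity moves the lattice point `lτ + n` to `0`, where `clearedPower` supplies the
    -- holomorphic function.
    refine ⟨2 * p, fun x => (2 * π * I)⁻¹ *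
      clearedPower (2 * p) a b ρ (x.1 - l * x.2 - n, x.2), ?_⟩
    have hc1 : Continuous fun x : ℂ × ℂ => ‖x.1 - l * x.2 - n‖ := by fun_prop
    have hc2 : Continuous fun x : ℂ × ℂ => x.2.im := Complex.continuous_im.comp continuous_snd
    have hc0 : ‖(l * (τ : ℂ) + n - l * (τ : ℂ) - n : ℂ)‖ < ρ / 2 := by
      rw [show (l * (τ : ℂ) + n - l * (τ : ℂ) - n : ℂ) = 0 by ring, norm_zero]
      positivity
    filter_upwards [hc1.continuousAt.eventually (gt_mem_nhds hc0),
      hc2.continuousAt.eventually (lt_mem_nhds h2)] with x hx1 hx2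
    have hx0 : 0 < x.2.im := by linarith
    refine ⟨?_, fun hx => ?_⟩
    · refine DifferentiableAt.const_mul ?_ _
      exact DifferentiableAt.comp (g := clearedPower (2 * p) a b ρ)
        (f := fun x : ℂ × ℂ => (x.1 - l * x.2 - n, x.2)) x
        (differentiableAt_clearedPower (2 * p) a b h0 h1 hx1 hx2) (by fun_prop)
    · have hw0 : x.1 - l * x.2 - n ≠ 0 := fun h => hx (by linear_combination h)
      rw [clearedPower_eq (2 * p) a b h1 (by linarith) hw0 (by linarith), inv_mul_cancel_left₀ hI,
        coe_ofComplex hx0, ← thetaQuot_pow_add_lattice a b (x.1 - l * x.2 - n) x.2 l n p]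
      congr 3
      ring

/-! ### The completed polar part -/

/-- The completed polar part, as a function on all of `ℂ × ℍ`. -/
def polarPart (m : ℕ) (z : ℂ) (τ : ℍ) : ℂ := phi m z τ - phiFHat m τ

lemma jacobiSlash_polarPart {m : ℕ} (hm : 2 ≤ m) (γ : SL(2, ℤ)) (z : ℂ) (τ : ℍ) :
    jacobiSlash 0 0 (polarPart m) γ z τ = thetaQuot (γ 1 0) (γ 1 1) z τ ^ m -
      finitePart m (γ 1 0) (γ 1 1) τ +
      quotCoeff m (γ 1 0) (γ 1 1) 2 τ / (4 * π) * (τ.im : ℂ)⁻¹ := by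
  have h := thetaQuot_smul γ 0 1 z τ
  simp only [zero_mul, one_mul, zero_add] at h
  rw [jacobiSlash, polarPart, phi_eq_thetaQuot, h, phiFHat_smul hm]
  simp
  ring

lemma polarPart_eq {m : ℕ} (hm : 2 ≤ m) (z : ℂ) (τ : ℍ) :
    polarPart m z τ = thetaQuot 0 1 z τ ^ m - finitePart m 0 1 τ +
      quotCoeff m 0 1 2 τ / (4 * π) * (τ.im : ℂ)⁻¹ := by
  rw [polarPart, phi_eq_thetaQuot, phiFHat_eq hm]
  ring

lemma thetaQuot_pow_sub_finitePart (p : ℕ) (a b : ℤ) {z : ℂ} {τ : ℍ} (h1 : 0 < z.im)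
    (h2 : z.im < τ.im) :
    thetaQuot a b z τ ^ (2 * p) - finitePart (2 * p) a b τ =
      ∑ j ∈ Finset.Icc 1 p, 1 / ((2 * j - 1).factorial : ℂ) *
        (quotCoeff (2 * p) a b (2 * j) τ * polarFun j τ z) := by
  rw [thetaQuot_pow_eq p a b (by rwa [abs_of_pos h1]) (by rintro n rfl; simp at h1),
    add_sub_cancel_left]
  exact Finset.sum_congr rfl fun j _ => by ring

lemma phi_eq_phiFHat_add_phiPHat (p : ℕ) {z : ℂ} {τ : ℍ} (h1 : 0 < z.im) (h2 : z.im < τ.im) :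
    phi (2 * p) z τ = phiFHat (2 * p) τ + phiPHat (2 * p) z τ := by
  have h := thetaQuot_pow_sub_finitePart p 0 1 h1 h2
  rw [← phi_eq_thetaQuot, sub_eq_iff_eq_add] at h
  rw [h, phiFHat, phiF_eq_finitePart, phiPHat, phiP, Nat.mul_div_cancel_left p two_pos]
  have e : ∑ j ∈ Finset.Icc 1 p, 1 / ((2 * j - 1).factorial : ℂ) *
        (quotCoeff (2 * p) 0 1 (2 * j) τ * polarFun j τ z) =
      ∑ j ∈ Finset.Icc 1 p, D (2 * p) (2 * j) τ / ((2 * j - 1).factorial : ℂ) *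
        ∑' r, polarTerm j z τ r := by
    refine Finset.sum_congr rfl fun j hj => ?_
    rw [Finset.mem_Icc] at hj
    rw [polarFun_eq_tsum hj.1 h1 h2, D_eq_quotCoeff]
    ring
  rw [e]
  ring

theorem isNonholomorphicJacobiForm_polarPart {p : ℕ} (hp : 1 ≤ p) :
    IsNonholomorphicJacobiForm 0 0 (CongruenceSubgroup.Gamma0 2) (psi (2 * p))
      (polarPart (2 * p)) := by
  have hm : 2 ≤ 2 * p := by omega
  refine ⟨fun γ hγ τ z _ => ?_, fun l n τ z _ => ?_, fun γ => ?_⟩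
  · obtain ⟨k, l, h1, h2, h3⟩ := exists_shift_of_mem_Gamma0 hγ p
    rw [jacobiSlash_polarPart hm, polarPart_eq hm, h1, h2, thetaQuot_shift_pow, finitePart_shift,
      quotCoeff_shift p 0 1 k l hm, h3]
    ring
  · rw [polarPart, polarPart, phi_eq_thetaQuot, phi_eq_thetaQuot, thetaQuot_pow_add_lattice]
    simp
  · refine ⟨1, fun k => if k = 0 then
      fun z τ => thetaQuot (γ 1 0) (γ 1 1) z τ ^ (2 * p) +
        (-1) * finitePart (2 * p) (γ 1 0) (γ 1 1) τ else
      fun _ τ => 1 / (4 * π) * quotCoeff (2 * p) (γ 1 0) (γ 1 1) 2 τ, fun k _ => ?_,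
      fun τ z _ => ?_⟩
    · dsimp only
      split_ifs
      · refine ⟨(isMeromorphicOffLattice_thetaQuot_pow p _ _).add
          (isMeromorphicOffLattice_of_mdifferentiable
            ((isWeaklyHolomorphicAtInfty_const (-1)).mul
              (isWeaklyHolomorphicAtInfty_finitePart _ _ _)).1), ?_⟩
        -- In the strip this coefficient is a finite combination of products of Laurent coefficients
        -- and polar functions, so the theta quotient itself need not be expanded.
        obtain ⟨n₀, c, hc, hs⟩ := hasEighthDevelopment_sum (Finset.Icc 1 p)
          (f := fun j z τ => 1 / ((2 * j - 1).factorial : ℂ) *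
            (quotCoeff (2 * p) (γ 1 0) (γ 1 1) (2 * j) τ * polarFun j τ z)) fun j hj => by
          rw [Finset.mem_Icc] at hj
          exact ((hasEighthDevelopment_quotCoeff _ _ _ (by omega)).mul
            (hasEighthDevelopment_polarFun hj.1)).const_mul _
        refine HasEighthDevelopment.hasFourierDevelopment ⟨n₀, c, hc, fun τ z h1 h2 => ?_⟩
        dsimp only
        rw [neg_one_mul, ← sub_eq_add_neg, thetaQuot_pow_sub_finitePart p _ _ h1 h2]
        exact hs τ z h1 h2
      · exact ⟨isMeromorphicOffLattice_of_mdifferentiable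
          ((isWeaklyHolomorphicAtInfty_const _).mul
            (isWeaklyHolomorphicAtInfty_quotCoeff _ _ _ hm)).1,
          ((hasEighthDevelopment_quotCoeff _ _ _ hm).const_mul _).hasFourierDevelopment⟩
    · rw [jacobiSlash_polarPart hm, Finset.sum_range_succ, Finset.sum_range_one]
      simp
      ring

end KacWakimoto

end

theorem theorem1p2 (m : ℕ) (hm : 0 < m) (hm_even : Even m) :
    -- the series defining the polar part converge, and `φ` is the sum of its two completed parts
    (∀ (τ : ℍ) (z : ℂ), 0 < z.im → z.im < τ.im →
      (∀ j ∈ Finset.Icc 1 (m / 2), Summable (KacWakimoto.polarTerm j z τ)) ∧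
      KacWakimoto.phi m z τ = KacWakimoto.phiFHat m τ + KacWakimoto.phiPHat m z τ) ∧
    -- the completed finite part
    KacWakimoto.IsAlmostHolomorphicModularForm 0 (CongruenceSubgroup.Gamma0 2)
      (KacWakimoto.psi m) (KacWakimoto.phiFHat m) ∧
    -- the completed polar part, continued from the strip `0 < Im z < Im τ` to all `z ∉ ℤ τ + ℤ`
    ∃ Φ : ℂ → ℍ → ℂ,
      (∀ (τ : ℍ) (z : ℂ), 0 < z.im → z.im < τ.im → Φ z τ = KacWakimoto.phiPHat m z τ) ∧
      (∀ (τ : ℍ) (z : ℂ), z ∉ KacWakimoto.lattice τ →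
        KacWakimoto.phi m z τ = KacWakimoto.phiFHat m τ + Φ z τ) ∧
      KacWakimoto.IsNonholomorphicJacobiForm 0 0 (CongruenceSubgroup.Gamma0 2)
        (KacWakimoto.psi m) Φ := by
  obtain ⟨p, rfl⟩ := hm_even.two_dvd
  have hp : 1 ≤ p := by omega
  refine ⟨fun τ z h1 h2 => ⟨fun j hj => ?_, KacWakimoto.phi_eq_phiFHat_add_phiPHat p h1 h2⟩,
    KacWakimoto.isAlmostHolomorphicModularForm_phiFHat hp,
    KacWakimoto.polarPart (2 * p), fun τ z h1 h2 => ?_, fun τ z _ => ?_,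
    KacWakimoto.isNonholomorphicJacobiForm_polarPart hp⟩
  · exact (KacWakimoto.hasSum_polarTerm (Finset.mem_Icc.mp hj).1 h1 h2).summable
  · rw [KacWakimoto.polarPart, KacWakimoto.phi_eq_phiFHat_add_phiPHat p h1 h2, add_sub_cancel_left]
  · rw [KacWakimoto.polarPart, add_sub_cancel]
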